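/- Let $(M,\xi)$ be a closed contact manifold of dimension $2n-1$, with $\xi$ cooriented and $M$ oriented by $\xi$ (i.e. by $\alpha\wedge d\alpha^{n-1}$ for any form $\alpha$ defining $\xi$ with its coorientation). Let $\mathrm{Diff}(M,\xi)$ be its group of (coorientation preserving) contactomorphisms, and let $\rho\colon\pi_1(\mathbb{T}^2)=\mathbb{Z}^2\to\mathrm{Diff}(M,\xi)$ be a homomorphism. Let $\pi\colon V=M\times_{\rho}\mathbb{T}^2\to\mathbb{T}^2=\mathbb{R}^2/\mathbb{Z}^2$ be the bundle obtained as the quotient of $M\times\mathbb{R}^2\to\mathbb{R}^2$ by the diagonal action $c\cdot(p,t)=(\rho(c)p,\,t+c)$ of $\mathbb{Z}^2$, with $V$ oriented by the product orientation of $M\times\mathbb{R}^2$. On $V$ consider the distribution $\xi_{fib}$ and the flat connection $\mathcal{H}_0$ induced respectively by $\xi\oplus\{0\}$ and $\{0\}\oplus T\mathbb{R}^2$ on $M\times\mathbb{R}^2$; so $(\pi,\eta_0=\xi_{fib}\oplus\mathcal{H}_0)$ is a flat contact bundle. A strong Bourgeois contact structure on $(\pi,\eta_0)$, for the standard flat connection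 $\nabla^{\mathbb{T}^2}$ on $\mathbb{T}^2$, is a positive cooriented contact structure $\eta$ on $V$ with $\eta\cap\ker d\pi=\xi_{fib}$ (as cooriented distributions in the fibers) whose potential $A$ is $\overline\nabla$-parallel. Here, if $\eta=\ker\alpha$, the contact connection $\mathcal{H}$ of $\eta$ is the $d\alpha|_\eta$-orthogonal of $\xi_{fib}$ in $\eta$; the potential $A$ assigns to a vector $u$ tangent to $\mathbb{T}^2$ the vertical vector field $A_u=\widehat u-\widehat u^0$ along the fiber, the difference of the $\mathcal{H}$- and $\mathcal{H}_0$-horizontal lifts of $u$; and $A$ is parallel if $[\widehat U^0,A_W]=A_{\nabla^{\mathbb{T}^2}_UW}$ for all vector fields $U,W$ on $\mathbb{T}^2$, where $\widehat U^0$ is the $\mathcal{H}_0$-horizontal lift of $U$. A smooth map $\phi\colon M\to\mathbb{R}^2$ defines an open book $(B,\phi/\|\phi\|)$ with binding $B=\phi^{-1}(0)$ (possibly empty) if $\phi$ is transverse to $0$ and $\phi/\|\phi\|\colon M\setminus B\to\mathbb{S}^1$ is a submersion (hence, $M$ being closed, a fibration); its fibers are the pages. The open book supports $\xi$ if $B$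 is a positive contact submanifold of $(M,\xi)$ and there is a form defining $\xi$ (with its coorientation) whose differential is a positive symplectic form on the pages. **Proposition.** Let $\eta$ be a strong Bourgeois contact structure on $(\pi,\eta_0)$, for the standard flat connection $\nabla^{\mathbb{T}^2}$. Then there is a smooth $\mathrm{Im}(\rho)$-invariant map $\phi=(\phi_1,\phi_2)\colon M\to\mathbb{R}^2$ which defines an open book supporting $\xi$, and there is an $\mathrm{Im}(\rho)$-invariant contact form $\beta$ defining $\xi$, with $d\beta$ positively symplectic on the pages of this open book, such that $\eta$ is the cooriented hyperplane field on $V$ induced by $\ker(\beta+\phi_1\,d\theta_1-\phi_2\,d\theta_2)$ on $M\times\mathbb{R}^2$, where $(\theta_1,\theta_2)$ are the standard coordinates of $\mathbb{R}^2$. -/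

import Mathlib

open scoped Manifold ContDiff Topology
open Set

/-! ## Smooth quotients by free properly discontinuous actions -/

/-- If a group acts freely, properly discontinuously and by smooth maps on a manifold, then the
orbit space (with the charts that Mathlib gives it) is a smooth manifold. -/
theorem isManifold_orbitQuotient {E H M G : Type*} [NormedAddCommGroup E] [NormedSpace ℝ E]
    [TopologicalSpace H] (I : ModelWithCorners ℝ E H) [TopologicalSpace M] [ChartedSpace H M]
    [IsManifold I ∞ M] [Group G] [MulAction G M] [ProperlyDiscontinuousSMul G M]
    [ContinuousConstSMul G M] [IsCancelSMul G M] [T2Space M] [LocallyCompactSpace M]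
    (hG : ∀ g : G, ContMDiff I I ∞ (fun x : M => g • x)) :
    IsManifold I ∞ (MulAction.orbitRel.Quotient G M) := by
  have hQ : IsLocalHomeomorph (Quotient.mk (MulAction.orbitRel G M)) :=
    isQuotientCoveringMap_quotientMk_of_properlyDiscontinuousSMul.isCoveringMap.isLocalHomeomorph
  have key : ∀ x x' : M, ContDiffOn ℝ ∞
      (I ∘ (((hQ.localInverseAt x).trans (chartAt H x)).symm.trans
        ((hQ.localInverseAt x').trans (chartAt H x'))) ∘ I.symm)
      (I.symm ⁻¹' (((hQ.localInverseAt x).trans (chartAt H x)).symm.trans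
        ((hQ.localInverseAt x').trans (chartAt H x'))).source ∩ range I) := by
    rintro x x' y ⟨hy, hyr⟩
    simp only [mem_preimage, OpenPartialHomeomorph.trans_source,
      OpenPartialHomeomorph.symm_source, OpenPartialHomeomorph.trans_target,
      OpenPartialHomeomorph.coe_trans_symm, mem_inter_iff, Function.comp_apply,
      IsLocalHomeomorph.localInverseAt_symm] at hy
    obtain ⟨⟨hz, ha⟩, hb, hc⟩ := hy
    set a := (chartAt H x).symm (I.symm y) with ha_def
    obtain ⟨g, hg⟩ : ∃ g : G, g • a = hQ.localInverseAt x' (Quotient.mk _ a) := by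
      have h1 := hQ.apply_localInverseAt_of_mem hb
      exact Quotient.exact h1
    have hgt : g • a ∈ (hQ.localInverseAt x').target := by
      rw [hg]; exact (hQ.localInverseAt x').map_source hb
    have hfun : ∀ᶠ a' in 𝓝 a, hQ.localInverseAt x' (Quotient.mk _ a') = g • a' := by
      have hcont : ContinuousAt (fun a' : M => g • a') a := (continuous_const_smul g).continuousAt
      filter_upwards [hcont ((hQ.localInverseAt x').open_target.mem_nhds hgt),
        hQ.continuous.continuousAt ((hQ.localInverseAt x').open_source.mem_nhds hb)] with a' h1 h2
      refine hQ.injOn_localInverseAt_target ((hQ.localInverseAt x').map_source h2) h1 ?_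
      rw [hQ.apply_localInverseAt_of_mem h2]
      exact Quotient.sound (MulAction.orbitRel_apply.2 ⟨g⁻¹, by simp⟩)
    have e1 : ContMDiffWithinAt 𝓘(ℝ, E) I ∞ (extChartAt I x).symm (range I) y := by
      refine contMDiffWithinAt_extChartAt_symm_range x ?_
      simp only [extChartAt_target, mem_inter_iff, mem_preimage]
      exact ⟨hz, hyr⟩
    have e2 : ContMDiffAt I I ∞ (fun x : M => g • x) ((extChartAt I x).symm y) := (hG g) _
    have e3 : ContMDiffAt I 𝓘(ℝ, E) ∞ (extChartAt I x') (g • (extChartAt I x).symm y) := by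
      refine contMDiffAt_extChartAt' ?_
      change g • a ∈ _
      rw [hg]; exact hc
    have e4 := ((e3.comp _ e2).comp_contMDiffWithinAt y e1).contDiffWithinAt
    refine (e4.mono inter_subset_right).congr_of_eventuallyEq ?_ ?_
    · have hca : ContinuousWithinAt (extChartAt I x).symm (range I) y := e1.continuousWithinAt
      have := hca.eventually hfun
      filter_upwards [this.filter_mono (nhdsWithin_mono _ inter_subset_right)] with y' hy'
      simpa using congrArg (fun m => I (chartAt H x' m)) hy'
    · have := hfun.self_of_nhds
      simpa using congrArg (fun m => I (chartAt H x' m)) this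
  apply isManifold_of_contDiffOn
  rintro _ _ ⟨q, rfl⟩ ⟨q', rfl⟩
  exact key _ _

/-! ## Differential forms, hyperplane fields and contact structures -/

section Forms

variable {E H M : Type*} [NormedAddCommGroup E] [NormedSpace ℝ E] [TopologicalSpace H]
  (I : ModelWithCorners ℝ E H) [TopologicalSpace M] [ChartedSpace H M]

/-- A (not necessarily smooth) `1`-form. -/
abbrev OneForm (I : ModelWithCorners ℝ E H) (M : Type*) [TopologicalSpace M]
    [ChartedSpace H M] :=
  (p : M) → TangentSpace I p →L[ℝ] ℝ

/-- A `1`-form is smooth if it is smooth as a function on the tangent bundle. -/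
def IsSmoothOneForm [IsManifold I ∞ M] (α : OneForm I M) : Prop :=
  ContMDiff I.tangent 𝓘(ℝ, ℝ) ∞ (fun X : TangentBundle I M => α X.1 X.2)

/-- A vector field is smooth if it is smooth as a section of the tangent bundle. -/
def IsSmoothVectorField [IsManifold I ∞ M] (X : (p : M) → TangentSpace I p) : Prop :=
  ContMDiff I I.tangent ∞ (fun p => (⟨p, X p⟩ : TangentBundle I M))

/-- The expression of the `1`-form `α` in the preferred chart at `p`. -/
noncomputable def OneForm.inChart (α : OneForm I M) (p : M) (y : E) : E →L[ℝ] ℝ :=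
  (α ((extChartAt I p).symm y)).comp (mfderiv 𝓘(ℝ, E) I (extChartAt I p).symm y)

/-- The exterior derivative `dα` of a `1`-form on a manifold without boundary, computed in the
preferred chart at `p`: `dα (v, w) = D_v α (w) - D_w α (v)`. -/
noncomputable def OneForm.d (α : OneForm I M) (p : M) (v w : TangentSpace I p) : ℝ :=
  fderiv ℝ (α.inChart I p) (extChartAt I p p)
      (mfderiv I 𝓘(ℝ, E) (extChartAt I p) p v) (mfderiv I 𝓘(ℝ, E) (extChartAt I p) p w)
    - fderiv ℝ (α.inChart I p) (extChartAt I p p)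
      (mfderiv I 𝓘(ℝ, E) (extChartAt I p) p w) (mfderiv I 𝓘(ℝ, E) (extChartAt I p) p v)

/-- The exterior power `Ω ∧ ⋯ ∧ Ω` (`m` factors) of a `2`-form `Ω` on a vector space, evaluated on
`2 m` vectors, up to the positive constant `2 ^ m`. -/
noncomputable def twoFormPower {T : Type*} (Ω : T → T → ℝ) (m : ℕ) (v : Fin (2 * m) → T) : ℝ :=
  ∑ σ : Equiv.Perm (Fin (2 * m)), ((Equiv.Perm.sign σ : ℤ) : ℝ) *
    ∏ j : Fin m, Ω (v (σ ⟨2 * j, by omega⟩)) (v (σ ⟨2 * j + 1, by omega⟩))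

/-- The exterior product `a ∧ Ω ∧ ⋯ ∧ Ω` (`m` factors `Ω`) of a `1`-form `a` and a `2`-form `Ω` on
a vector space, evaluated on `2 m + 1` vectors, up to the positive constant `2 ^ m`. -/
noncomputable def oneFormWedgePower {T : Type*} (a : T → ℝ) (Ω : T → T → ℝ) (m : ℕ)
    (v : Fin (2 * m + 1) → T) : ℝ :=
  ∑ σ : Equiv.Perm (Fin (2 * m + 1)), ((Equiv.Perm.sign σ : ℤ) : ℝ) *
    (a (v (σ 0)) *
      ∏ j : Fin m, Ω (v (σ ⟨2 * j + 1, by omega⟩)) (v (σ ⟨2 * j + 2, by omega⟩)))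

/-- `α ∧ (dα) ^ m` at the point `p`, evaluated on `2 m + 1` tangent vectors (up to a positive
constant). -/
noncomputable def OneForm.contactVolume (α : OneForm I M) (m : ℕ) (p : M)
    (v : Fin (2 * m + 1) → TangentSpace I p) : ℝ :=
  oneFormWedgePower (fun u => α p u) (α.d I p) m v

/-- A smooth cooriented hyperplane field: the hyperplanes, and in each tangent space the open half
space on the positive side of the hyperplane. -/
structure CoorientedHyperplaneField (M : Type*) [TopologicalSpace M] [ChartedSpace H M]
    [IsManifold I ∞ M] where
  plane : (p : M) → Submodule ℝ (TangentSpace I p)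
  pos : (p : M) → Set (TangentSpace I p)
  exists_form : ∃ α : OneForm I M, IsSmoothOneForm I α ∧ ∀ p, α p ≠ 0 ∧
    (∀ v, v ∈ plane p ↔ α p v = 0) ∧ (∀ v, v ∈ pos p ↔ 0 < α p v)

variable {I} [IsManifold I ∞ M]

/-- The smooth nowhere vanishing `1`-form `α` defines the cooriented hyperplane field `η`, i.e.
`η = ker α` as cooriented hyperplane fields. -/
def CoorientedHyperplaneField.DefinedBy (η : CoorientedHyperplaneField I M) (α : OneForm I M) :
    Prop :=
  IsSmoothOneForm I α ∧ ∀ p, α p ≠ 0 ∧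
    (∀ v, v ∈ η.plane p ↔ α p v = 0) ∧ (∀ v, v ∈ η.pos p ↔ 0 < α p v)

/-- `ξ` is a contact structure on the `(2 d + 1)`-dimensional manifold `M`: it is defined by a form
`α` such that `α ∧ (dα) ^ d` vanishes nowhere. -/
def CoorientedHyperplaneField.IsContact (ξ : CoorientedHyperplaneField I M) (d : ℕ) : Prop :=
  ∃ α, ξ.DefinedBy α ∧ ∀ p, ∃ v, α.contactVolume I d p v ≠ 0

/-- A contact manifold `(M, ξ)` is oriented by `α ∧ (dα) ^ d`, where `α` is any form defining the
cooriented contact structure `ξ`. This says that `v` is a positively oriented basis of `T_p M`. -/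
def CoorientedHyperplaneField.IsPositiveBasis (ξ : CoorientedHyperplaneField I M) (d : ℕ) (p : M)
    (v : Fin (2 * d + 1) → TangentSpace I p) : Prop :=
  ∃ α, ξ.DefinedBy α ∧ 0 < α.contactVolume I d p v

end Forms

/-! ## The group of contactomorphisms -/

section Contactomorphisms

variable {E H M : Type*} [NormedAddCommGroup E] [NormedSpace ℝ E] [TopologicalSpace H]
  {I : ModelWithCorners ℝ E H} [TopologicalSpace M] [ChartedSpace H M]

/-- Diffeomorphisms of `M` form a group under composition. -/
noncomputable instance diffeomorphGroup : Group (M ≃ₘ⟮I, I⟯ M) where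
  mul f g := g.trans f
  one := Diffeomorph.refl I M ∞
  inv f := f.symm
  mul_assoc _ _ _ := rfl
  one_mul _ := rfl
  mul_one _ := rfl
  inv_mul_cancel f := Diffeomorph.ext fun x => f.symm_apply_apply x

theorem diffeomorph_mul_apply (f g : M ≃ₘ⟮I, I⟯ M) (p : M) : (f * g) p = f (g p) := rfl

theorem diffeomorph_one_apply (p : M) : (1 : M ≃ₘ⟮I, I⟯ M) p = p := rfl

variable [IsManifold I ∞ M]

/-- `g` is a contactomorphism of `(M, ξ)`: its differential maps `ξ` to `ξ` and preserves the
coorientation. -/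
def CoorientedHyperplaneField.IsContactomorphism (ξ : CoorientedHyperplaneField I M)
    (g : M ≃ₘ⟮I, I⟯ M) : Prop :=
  ∀ p v, (mfderiv I I g p v ∈ ξ.plane (g p) ↔ v ∈ ξ.plane p) ∧
    (mfderiv I I g p v ∈ ξ.pos (g p) ↔ v ∈ ξ.pos p)

/-- The group of contactomorphisms of `(M, ξ)`. -/
noncomputable def CoorientedHyperplaneField.contactomorphismGroup (ξ : CoorientedHyperplaneField I M) :
    Subgroup (M ≃ₘ⟮I, I⟯ M) where
  carrier := {g | ξ.IsContactomorphism g}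
  one_mem' := by
    intro p v
    have h : mfderiv I I (1 : M ≃ₘ⟮I, I⟯ M) p = ContinuousLinearMap.id ℝ _ := mfderiv_id
    rw [h]
    exact ⟨Iff.rfl, Iff.rfl⟩
  mul_mem' := by
    intro f g hf hg p v
    have h : mfderiv I I (f * g : M ≃ₘ⟮I, I⟯ M) p =
        (mfderiv I I f (g p)).comp (mfderiv I I g p) :=
      mfderiv_comp p (f.mdifferentiable (by simp) _) (g.mdifferentiable (by simp) _)
    rw [h]
    exact ⟨(hf (g p) _).1.trans (hg p v).1, (hf (g p) _).2.trans (hg p v).2⟩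
  inv_mem' := by
    intro f hf p v
    obtain ⟨q, rfl⟩ := f.surjective p
    have hq : f.symm (f q) = q := f.symm_apply_apply q
    have h1 : (mfderiv I I f (f.symm (f q))).comp (mfderiv I I f.symm (f q)) =
        ContinuousLinearMap.id ℝ (TangentSpace I (f q)) := by
      have h1 := mfderiv_comp (f q) (f.mdifferentiable (by simp) (f.symm (f q)))
        (f.symm.mdifferentiable (by simp) (f q))
      have h2 : (f : M → M) ∘ f.symm = id := by ext x; simp
      rw [h2, mfderiv_id] at h1
      exact h1.symm
    have h2 : ∀ r, r = q → ∀ u : E,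
        ((mfderiv I I f r : E →L[ℝ] E) u = v → (((u : TangentSpace I r) ∈ ξ.plane r ↔
          v ∈ ξ.plane (f q)) ∧ ((u : TangentSpace I r) ∈ ξ.pos r ↔ v ∈ ξ.pos (f q)))) := by
      rintro r rfl u rfl
      exact ⟨(hf r u).1.symm, (hf r u).2.symm⟩
    exact h2 _ hq _ (congrArg (fun L => L v) h1)

end Contactomorphisms

/-! ## The torus and the flat bundle `M ×_ρ T² → T²` -/

/-- The fundamental group `ℤ²` of the torus `T² = ℝ² / ℤ²`, written multiplicatively. -/
abbrev TorusGroup : Type := Multiplicative (ℤ × ℤ)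

/-- The deck transformation of `ℝ² → T²` given by `c ∈ ℤ²` is the translation by this vector. -/
def latticeVector (c : TorusGroup) : ℝ × ℝ := ((c.toAdd.1 : ℝ), (c.toAdd.2 : ℝ))

theorem latticeVector_one : latticeVector 1 = 0 := by
  simp [latticeVector]

theorem latticeVector_mul (c c' : TorusGroup) :
    latticeVector (c * c') = latticeVector c + latticeVector c' := by
  simp [latticeVector]

theorem latticeVector_injective : Function.Injective latticeVector := by
  intro c c' h
  simp only [latticeVector, Prod.mk.injEq, Int.cast_inj] at h
  exact Multiplicative.toAdd.injective (Prod.ext h.1 h.2)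

/-- Only finitely many lattice vectors lie in a compact set. -/
theorem latticeVector_finite {K : Set (ℝ × ℝ)} (hK : IsCompact K) :
    {c | latticeVector c ∈ K}.Finite := by
  have h : Topology.IsClosedEmbedding (fun z : ℤ × ℤ => ((z.1 : ℝ), (z.2 : ℝ))) :=
    Int.isClosedEmbedding_coe_real.prodMap Int.isClosedEmbedding_coe_real
  have h1 := (h.isCompact_preimage hK).finite_of_discrete
  exact h1.preimage (f := Multiplicative.toAdd) Multiplicative.toAdd.injective.injOn

/-- The action of `ℤ²` on the universal cover `ℝ²` of the torus by translations. -/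
noncomputable instance planeAction : MulAction TorusGroup (ℝ × ℝ) where
  smul c t := t + latticeVector c
  one_smul t := by
    change t + latticeVector 1 = t
    rw [latticeVector_one, add_zero]
  mul_smul c c' t := by
    change t + latticeVector (c * c') = (t + latticeVector c') + latticeVector c
    rw [latticeVector_mul, add_assoc, add_comm (latticeVector c)]

theorem plane_smul_def (c : TorusGroup) (t : ℝ × ℝ) : c • t = t + latticeVector c := rfl

theorem contMDiff_plane_smul (c : TorusGroup) :
    ContMDiff 𝓘(ℝ, ℝ × ℝ) 𝓘(ℝ, ℝ × ℝ) ∞ (fun t : ℝ × ℝ => c • t) :=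
  (contDiff_id.add contDiff_const : ContDiff ℝ ∞
    (fun t : ℝ × ℝ => t + latticeVector c)).contMDiff

instance : ContinuousConstSMul TorusGroup (ℝ × ℝ) :=
  ⟨fun c => (contMDiff_plane_smul c).continuous⟩

instance : IsCancelSMul TorusGroup (ℝ × ℝ) where
  right_cancel' _ _ t h := latticeVector_injective (add_left_cancel (a := t) h)

instance : ProperlyDiscontinuousSMul TorusGroup (ℝ × ℝ) where
  finite_disjoint_inter_image {K L} hK hL := by
    refine (latticeVector_finite ((hL.prod hK).image continuous_sub)).subset ?_
    rintro c ⟨_, ⟨t, ht, rfl⟩, hL'⟩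
    exact ⟨(_, t), ⟨hL', ht⟩, add_sub_cancel_left t (latticeVector c)⟩

/-- The torus `T² = ℝ² / ℤ²`. -/
abbrev Torus : Type := MulAction.orbitRel.Quotient TorusGroup (ℝ × ℝ)

instance : IsManifold 𝓘(ℝ, ℝ × ℝ) ∞ Torus :=
  isManifold_orbitQuotient _ contMDiff_plane_smul

/-- The covering map `q : ℝ² → T²`. -/
noncomputable def torusCover (t : ℝ × ℝ) : Torus := Quotient.mk _ t

/-- A vector field on `T²` lifted to `ℝ²`. -/
noncomputable def liftToPlane (W : (b : Torus) → TangentSpace 𝓘(ℝ, ℝ × ℝ) b) (t : ℝ × ℝ) : ℝ × ℝ :=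
  (mfderiv 𝓘(ℝ, ℝ × ℝ) 𝓘(ℝ, ℝ × ℝ) torusCover t).inverse (W (torusCover t))

/-- The standard flat covariant derivative `∇_U W` of vector fields on `T²`, at the point `q t`: it
is the image under `q` of the derivative, in the direction of the lift of `U`, of the lift of `W`
to `ℝ²`. -/
noncomputable def torusNabla (U W : (b : Torus) → TangentSpace 𝓘(ℝ, ℝ × ℝ) b) (t : ℝ × ℝ) :
    TangentSpace 𝓘(ℝ, ℝ × ℝ) (torusCover t) :=
  mfderiv 𝓘(ℝ, ℝ × ℝ) 𝓘(ℝ, ℝ × ℝ) torusCover t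
    (fderiv ℝ (liftToPlane W) t (liftToPlane U t))

section FlatBundle

variable {E M : Type*} [NormedAddCommGroup E] [NormedSpace ℝ E] [TopologicalSpace M]
  [ChartedSpace E M]

/-- The product `M × ℝ²`, on which `c ∈ ℤ²` acts by `ρ c` on the first factor and by the deck
transformation on the second factor. -/
def Cover (_ : TorusGroup →* (M ≃ₘ⟮𝓘(ℝ, E), 𝓘(ℝ, E)⟯ M)) : Type _ := M × (ℝ × ℝ)

variable (E) in
/-- The model with corners of `M × ℝ²` and of `M ×_ρ T²`. -/
noncomputable abbrev bundleModel : ModelWithCorners ℝ (E × (ℝ × ℝ)) (ModelProd E (ℝ × ℝ)) :=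
  𝓘(ℝ, E).prod 𝓘(ℝ, ℝ × ℝ)

variable (ρ : TorusGroup →* (M ≃ₘ⟮𝓘(ℝ, E), 𝓘(ℝ, E)⟯ M))

namespace Cover

instance : TopologicalSpace (Cover ρ) := inferInstanceAs (TopologicalSpace (M × (ℝ × ℝ)))
instance : ChartedSpace (ModelProd E (ℝ × ℝ)) (Cover ρ) :=
  inferInstanceAs (ChartedSpace (ModelProd E (ℝ × ℝ)) (M × (ℝ × ℝ)))
instance [IsManifold 𝓘(ℝ, E) ∞ M] : IsManifold (bundleModel E) ∞ (Cover ρ) :=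
  inferInstanceAs (IsManifold (bundleModel E) ∞ (M × (ℝ × ℝ)))
instance [T2Space M] : T2Space (Cover ρ) := inferInstanceAs (T2Space (M × (ℝ × ℝ)))
instance [LocallyCompactSpace M] : LocallyCompactSpace (Cover ρ) :=
  inferInstanceAs (LocallyCompactSpace (M × (ℝ × ℝ)))

noncomputable instance : MulAction TorusGroup (Cover ρ) where
  smul c x := ((ρ c x.1, x.2 + latticeVector c) : M × (ℝ × ℝ))
  one_smul x := by
    change ((ρ 1 x.1, x.2 + latticeVector 1) : M × (ℝ × ℝ)) = x
    rw [latticeVector_one, add_zero, map_one, diffeomorph_one_apply]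
    rfl
  mul_smul c c' x := by
    change ((ρ (c * c') x.1, x.2 + latticeVector (c * c')) : M × (ℝ × ℝ)) =
      (ρ c (ρ c' x.1), (x.2 + latticeVector c') + latticeVector c)
    rw [latticeVector_mul, add_assoc, add_comm (latticeVector c), map_mul, diffeomorph_mul_apply]

theorem contMDiff_smul (c : TorusGroup) :
    ContMDiff (bundleModel E) (bundleModel E) ∞ (fun x : Cover ρ => c • x) :=
  (ρ c).contMDiff.prodMap (contMDiff_plane_smul c)

instance : ContinuousConstSMul TorusGroup (Cover ρ) := ⟨fun c => (contMDiff_smul ρ c).continuous⟩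

instance : IsCancelSMul TorusGroup (Cover ρ) where
  right_cancel' c c' x h := by
    have h2 : x.2 + latticeVector c = x.2 + latticeVector c' := congrArg Prod.snd h
    exact latticeVector_injective (add_left_cancel h2)

instance : ProperlyDiscontinuousSMul TorusGroup (Cover ρ) where
  finite_disjoint_inter_image {K L} hK hL := by
    have h1 : IsCompact ((Prod.snd : M × (ℝ × ℝ) → ℝ × ℝ) '' K) := hK.image continuous_snd
    have h2 : IsCompact ((Prod.snd : M × (ℝ × ℝ) → ℝ × ℝ) '' L) := hL.image continuous_snd
    refine (latticeVector_finite ((h2.prod h1).image continuous_sub)).subset ?_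
    rintro c ⟨_, ⟨x, hx, rfl⟩, hL'⟩
    exact ⟨(x.2 + latticeVector c, x.2), ⟨⟨_, hL', rfl⟩, ⟨x, hx, rfl⟩⟩,
      add_sub_cancel_left x.2 (latticeVector c)⟩

end Cover

/-- The total space `M ×_ρ T²`, the quotient of `M × ℝ²` by the diagonal action of `ℤ²`. -/
abbrev FlatBundle : Type _ := MulAction.orbitRel.Quotient TorusGroup (Cover ρ)

/-- The quotient map `Q : M × ℝ² → M ×_ρ T²`. -/
noncomputable def bundleCover (x : Cover ρ) : FlatBundle ρ := Quotient.mk _ x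

/-- The bundle projection `π : M ×_ρ T² → T²`, induced by `M × ℝ² → ℝ²`. -/
noncomputable def bundleProj : FlatBundle ρ → Torus :=
  Quotient.map' (fun x : Cover ρ => x.2) (by
    rintro _ y ⟨c, rfl⟩
    exact ⟨c, rfl⟩)

theorem bundleProj_bundleCover (x : Cover ρ) :
    bundleProj ρ (bundleCover ρ x) = torusCover x.2 := rfl

variable [IsManifold 𝓘(ℝ, E) ∞ M] [T2Space M] [LocallyCompactSpace M]

instance : IsManifold (bundleModel E) ∞ (FlatBundle ρ) :=
  isManifold_orbitQuotient _ (Cover.contMDiff_smul ρ)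

/-- The differential of `Q` at `(p, t)`, as a map on `T_p M × ℝ²`. -/
noncomputable def dCover (x : Cover ρ) (u : TangentSpace 𝓘(ℝ, E) x.1) (s : ℝ × ℝ) :
    TangentSpace (bundleModel E) (bundleCover ρ x) :=
  mfderiv (bundleModel E) (bundleModel E) (bundleCover ρ) x (u, s)

/-- The differential of `π`. -/
noncomputable def dProj (v : FlatBundle ρ) (w : TangentSpace (bundleModel E) v) :
    TangentSpace 𝓘(ℝ, ℝ × ℝ) (bundleProj ρ v) :=
  mfderiv (bundleModel E) 𝓘(ℝ, ℝ × ℝ) (bundleProj ρ) v w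

/-- The flat reference connection `H₀` on `π`, induced by `{0} ⊕ T ℝ²` on `M × ℝ²`. -/
def flatConnection (v : FlatBundle ρ) : Set (TangentSpace (bundleModel E) v) :=
  {w | ∃ (x : Cover ρ) (s : ℝ × ℝ),
    (⟨v, w⟩ : TangentBundle (bundleModel E) (FlatBundle ρ)) = ⟨bundleCover ρ x, dCover ρ x 0 s⟩}

/-- The distribution `ξ_fib` of contact hyperplanes of the fibres, induced by `ξ ⊕ {0}` on
`M × ℝ²`. -/
def fibrePlane (ξ : CoorientedHyperplaneField 𝓘(ℝ, E) M) (v : FlatBundle ρ) :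
    Set (TangentSpace (bundleModel E) v) :=
  {w | ∃ (x : Cover ρ), ∃ u ∈ ξ.plane x.1,
    (⟨v, w⟩ : TangentBundle (bundleModel E) (FlatBundle ρ)) = ⟨bundleCover ρ x, dCover ρ x u 0⟩}

/-- The coorientation of `ξ_fib` in the fibres: the vertical vectors on its positive side. -/
def fibrePos (ξ : CoorientedHyperplaneField 𝓘(ℝ, E) M) (v : FlatBundle ρ) :
    Set (TangentSpace (bundleModel E) v) :=
  {w | ∃ (x : Cover ρ), ∃ u ∈ ξ.pos x.1,
    (⟨v, w⟩ : TangentBundle (bundleModel E) (FlatBundle ρ)) = ⟨bundleCover ρ x, dCover ρ x u 0⟩}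

variable {ρ}

/-- `η` is a contact fibre bundle on `π` with the same underlying bundle with contact fibres
as the flat one: it is a cooriented hyperplane field on the total space whose intersection with
`ker dπ` is `ξ_fib`, with its coorientation. -/
def IsContactFibreBundle (ξ : CoorientedHyperplaneField 𝓘(ℝ, E) M)
    (η : CoorientedHyperplaneField (bundleModel E) (FlatBundle ρ)) : Prop :=
  ∀ v w, ((w ∈ η.plane v ∧ dProj ρ v w = 0) ↔ w ∈ fibrePlane ρ ξ v) ∧
    ((w ∈ η.pos v ∧ dProj ρ v w = 0) ↔ w ∈ fibrePos ρ ξ v)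

/-- The contact connection `H` of a contact fibre bundle `η = ker α`: the `dα`-orthogonal, inside
`η`, of the vertical part of `η`. -/
def contactConnection (α : OneForm (bundleModel E) (FlatBundle ρ)) (v : FlatBundle ρ) :
    Set (TangentSpace (bundleModel E) v) :=
  {w | α v w = 0 ∧ ∀ u, α v u = 0 → dProj ρ v u = 0 → α.d (bundleModel E) v w u = 0}

/-- A `1`-form on `T²` whose value on a vector `u` tangent to `T²` at `b` is a vector field along
the fibre of `π` over `b`; its value at the point `v` of the fibre is `A v u`. -/
abbrev FibreForm (ρ : TorusGroup →* (M ≃ₘ⟮𝓘(ℝ, E), 𝓘(ℝ, E)⟯ M)) :=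
  (v : FlatBundle ρ) →
    TangentSpace 𝓘(ℝ, ℝ × ℝ) (bundleProj ρ v) →L[ℝ] TangentSpace (bundleModel E) v

/-- `A` is the potential of the contact connection of `η` with respect to `H₀`: it is a smooth form
with vertical values, and for every vector `u` tangent to `T²`, `A_u` is the difference of the
horizontal lifts of `u` for the contact connection of `η` and for `H₀`. -/
structure IsPotential (η : CoorientedHyperplaneField (bundleModel E) (FlatBundle ρ))
    (A : FibreForm ρ) : Prop where
  smooth : ∀ U : (b : Torus) → TangentSpace 𝓘(ℝ, ℝ × ℝ) b, IsSmoothVectorField 𝓘(ℝ, ℝ × ℝ) U →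
    IsSmoothVectorField (bundleModel E) (fun v => A v (U (bundleProj ρ v)))
  vertical : ∀ v u, dProj ρ v (A v u) = 0
  lift : ∀ α, η.DefinedBy α → ∀ v, ∀ w ∈ flatConnection ρ v,
    w + A v (dProj ρ v w) ∈ contactConnection α v

/-- The form `A` is parallel for the covariant derivative `∇` on forms with values in the vector
fields along the fibres that is induced by `H₀` and by the standard flat connection of `T²`: for
all vector fields `U`, `W` on `T²`, `∇_U (A_W) = A_{∇_U W}`, where `∇_U` of a field of vertical
vector fields is the Lie bracket with the `H₀`-horizontal lift `U'` of `U`. -/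
def IsParallel (A : FibreForm ρ) : Prop :=
  ∀ (U W : (b : Torus) → TangentSpace 𝓘(ℝ, ℝ × ℝ) b)
    (U' : (v : FlatBundle ρ) → TangentSpace (bundleModel E) v),
    IsSmoothVectorField 𝓘(ℝ, ℝ × ℝ) U → IsSmoothVectorField 𝓘(ℝ, ℝ × ℝ) W →
    (∀ v, U' v ∈ flatConnection ρ v ∧ dProj ρ v (U' v) = U (bundleProj ρ v)) →
    ∀ x : Cover ρ,
      VectorField.mlieBracket (bundleModel E) U' (fun v => A v (W (bundleProj ρ v)))
          (bundleCover ρ x) =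
        A (bundleCover ρ x) (torusNabla U W x.2)

/-- `η` is a positive contact structure on the total space, of dimension `2 d + 3`, with the
orientation induced by the product orientation of `M × ℝ²`, where `M` is oriented by `ξ`: it is
defined by a form `α` such that `α ∧ (dα) ^ (d + 1)` is positive on positively oriented bases. -/
def IsPositiveContact (d : ℕ) (ξ : CoorientedHyperplaneField 𝓘(ℝ, E) M)
    (η : CoorientedHyperplaneField (bundleModel E) (FlatBundle ρ)) : Prop :=
  ∃ α, η.DefinedBy α ∧ ∀ (x : Cover ρ) (u : Fin (2 * d + 1) → TangentSpace 𝓘(ℝ, E) x.1),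
    ξ.IsPositiveBasis d x.1 u →
      0 < α.contactVolume (bundleModel E) (d + 1) (bundleCover ρ x)
        (Fin.cons (dCover ρ x 0 (1, 0)) (Fin.cons (dCover ρ x 0 (0, 1))
          (fun i => dCover ρ x (u i) 0)))

/-- `η` is a strong Bourgeois contact structure on the flat contact bundle `M ×_ρ T² → T²`: a
contact fibre bundle which is a (positive) contact structure on the total space and whose
potential is parallel for the standard flat connection of `T²`. -/
def IsStrongBourgeois (d : ℕ) (ξ : CoorientedHyperplaneField 𝓘(ℝ, E) M)
    (η : CoorientedHyperplaneField (bundleModel E) (FlatBundle ρ)) : Prop :=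
  IsContactFibreBundle ξ η ∧ IsPositiveContact d ξ η ∧ ∃ A, IsPotential η A ∧ IsParallel A

/-- `η` is the cooriented hyperplane field on `M ×_ρ T²` induced by the kernel of
`β + φ₁ dθ₁ - φ₂ dθ₂` on `M × ℝ²`, where `(θ₁, θ₂)` are the coordinates of `ℝ²`. -/
def IsInducedBy (η : CoorientedHyperplaneField (bundleModel E) (FlatBundle ρ))
    (β : OneForm 𝓘(ℝ, E) M) (φ : M → ℝ × ℝ) : Prop :=
  ∀ (x : Cover ρ) (u : TangentSpace 𝓘(ℝ, E) x.1) (s : ℝ × ℝ),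
    (dCover ρ x u s ∈ η.plane (bundleCover ρ x) ↔
      β x.1 u + (φ x.1).1 * s.1 - (φ x.1).2 * s.2 = 0) ∧
    (dCover ρ x u s ∈ η.pos (bundleCover ρ x) ↔
      0 < β x.1 u + (φ x.1).1 * s.1 - (φ x.1).2 * s.2)

end FlatBundle

/-! ## Open books -/

section OpenBooks

variable {E M : Type*} [NormedAddCommGroup E] [NormedSpace ℝ E] [TopologicalSpace M]
  [ChartedSpace E M]

/-- The pullback by `φ / ‖φ‖` of the angular form of the circle, `(φ₁ dφ₂ - φ₂ dφ₁) / ‖φ‖ ^ 2`,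
i.e. the differential of the argument of `φ`, at points where `φ` does not vanish. -/
noncomputable def dArg (φ : M → ℝ × ℝ) (p : M) (u : TangentSpace 𝓘(ℝ, E) p) : ℝ :=
  ((φ p).1 * (mfderiv 𝓘(ℝ, E) 𝓘(ℝ, ℝ × ℝ) φ p u : ℝ × ℝ).2
    - (φ p).2 * (mfderiv 𝓘(ℝ, E) 𝓘(ℝ, ℝ × ℝ) φ p u : ℝ × ℝ).1) / ((φ p).1 ^ 2 + (φ p).2 ^ 2)

/-- The smooth map `φ` on a closed manifold defines an open book `(B, φ / ‖φ‖)` with binding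
`B = φ⁻¹(0)`: it is transverse to `0`, and its argument `φ / ‖φ‖ : M \ B → S¹` is a submersion
(hence a fibration, as `M` is closed and `φ` is transverse to `0`). The pages are the fibres of
`φ / ‖φ‖`. -/
structure DefinesOpenBook (φ : M → ℝ × ℝ) : Prop where
  smooth : ContMDiff 𝓘(ℝ, E) 𝓘(ℝ, ℝ × ℝ) ∞ φ
  transverse : ∀ p, φ p = 0 → Function.Surjective (mfderiv 𝓘(ℝ, E) 𝓘(ℝ, ℝ × ℝ) φ p)
  submersion : ∀ p, φ p ≠ 0 → ∃ u : TangentSpace 𝓘(ℝ, E) p, dArg φ p u ≠ 0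

variable [IsManifold 𝓘(ℝ, E) ∞ M]

/-- `dβ` is a positive symplectic form on the pages of the open book defined by `φ`. A basis `w` of
the tangent space of a page is positive if `(N, w)` is a positive basis of `T_p M` for
vectors `N` in the direction of increasing argument. -/
def IsSymplecticOnPages (d : ℕ) (ξ : CoorientedHyperplaneField 𝓘(ℝ, E) M)
    (φ : M → ℝ × ℝ) (β : OneForm 𝓘(ℝ, E) M) : Prop :=
  ∀ p, φ p ≠ 0 → ∀ (N : TangentSpace 𝓘(ℝ, E) p) (w : Fin (2 * d) → TangentSpace 𝓘(ℝ, E) p),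
    0 < dArg φ p N → (∀ i, dArg φ p (w i) = 0) →
      (ξ.IsPositiveBasis d p (Fin.cons N w) ↔ 0 < twoFormPower (β.d 𝓘(ℝ, E) p) d w)

/-- The binding `B = φ⁻¹(0)` of the open book defined by `φ`, oriented as the boundary of the pages,
is a positive contact submanifold of `(M, ξ)`, `ξ = ker β`. A basis `w` of `T_p B` is positive if
`(N₁, N₂, w)` is a positive basis of `T_p M` for vectors `N₁`, `N₂` that `dφ` maps to a
positive basis of `ℝ²`. The dimension of `M` is `2 m + 3`. -/
def IsContactBinding (m : ℕ) (ξ : CoorientedHyperplaneField 𝓘(ℝ, E) M) (φ : M → ℝ × ℝ)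
    (β : OneForm 𝓘(ℝ, E) M) : Prop :=
  ∀ p, φ p = 0 → ∀ (N₁ N₂ : TangentSpace 𝓘(ℝ, E) p)
    (w : Fin (2 * m + 1) → TangentSpace 𝓘(ℝ, E) p),
    0 < (mfderiv 𝓘(ℝ, E) 𝓘(ℝ, ℝ × ℝ) φ p N₁ : ℝ × ℝ).1 *
          (mfderiv 𝓘(ℝ, E) 𝓘(ℝ, ℝ × ℝ) φ p N₂ : ℝ × ℝ).2
        - (mfderiv 𝓘(ℝ, E) 𝓘(ℝ, ℝ × ℝ) φ p N₁ : ℝ × ℝ).2 *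
          (mfderiv 𝓘(ℝ, E) 𝓘(ℝ, ℝ × ℝ) φ p N₂ : ℝ × ℝ).1 →
    (∀ i, mfderiv 𝓘(ℝ, E) 𝓘(ℝ, ℝ × ℝ) φ p (w i) = 0) →
      (ξ.IsPositiveBasis (m + 1) p (Fin.cons N₁ (Fin.cons N₂ w)) ↔
        0 < β.contactVolume 𝓘(ℝ, E) m p w)

/-- `β` is a contact form adapted to the open book defined by `φ`, on the contact manifold `(M, ξ)`
of dimension `2 d + 1`: it defines `ξ`, the binding is a positive contact submanifold (there is
nothing to ask if `d = 0`, where the binding is empty), and `dβ` is a positive symplectic form on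
the pages. -/
structure IsAdaptedForm (d : ℕ) (ξ : CoorientedHyperplaneField 𝓘(ℝ, E) M) (φ : M → ℝ × ℝ)
    (β : OneForm 𝓘(ℝ, E) M) : Prop where
  definedBy : ξ.DefinedBy β
  binding : ∀ m, d = m + 1 → IsContactBinding m ξ φ β
  pages : IsSymplecticOnPages d ξ φ β

/-- The open book defined by `φ` supports the contact structure `ξ`. -/
def Supports (d : ℕ) (φ : M → ℝ × ℝ) (ξ : CoorientedHyperplaneField 𝓘(ℝ, E) M) : Prop :=
  DefinesOpenBook (E := E) φ ∧ ∃ β, IsAdaptedForm d ξ φ β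

end OpenBooks

/-! Parallelism makes the potential constant along the flat directions. Its values on the two
coordinate fields of the torus therefore come from vector fields `X`, `Y` on `M` alone, which are
invariant under the image of `ρ` (`IsParallel.exists_field`). Upstairs on `M × ℝ²` the contact
connection is spanned by `∂₁ + X` and `∂₂ + Y`. If `ξ = ker α`, a form defining `η` then pulls back
to a positive multiple of `σ = α - α(X) dθ₁ - α(Y) dθ₂` (`IsContactFibreBundle.exists_pullback_eq`).
Two facts follow. The `dσ`-orthogonality of `∂₁ + X` and `∂₂ + Y` to `ξ` says that `L_X α` and `L_Y
α` vanish on `ξ`, so `X` and `Y` are contact vector fields. Moreover `dσ(∂₁ + X, ∂₂ + Y) = -α([X,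
Y])`, so positivity of `η` amounts to `α([X, Y]) < 0` (`contactVolume_connectionForm`).

The problem is now one on `M`: among the positive multiples `β` of `α`, find an invariant one
adapted to the open book of `φ = (-β(X), β(Y))`. Near the binding the sign of `β([X, Y])` suffices:
where `β(X) = β(Y) = 0`, it forces `φ` to be transverse to `0` and makes `X`, `Y` span the
symplectic normal plane of the binding. Off the binding, `dβ` is positive on the pages as soon as
the Reeb field `R` is positively transverse to them. If `L_X β = k β` and `L_Y β = g β`, then
`R(β(X)) = k` and `R(β(Y)) = g`, so this condition reads `β(Y) k - β(X) g > 0`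
(`isAdaptedForm_of_lieForm`).

To reach it, normalise first to `β([X, Y]) = -1`. As `β([X, Y])` scales with `β`, every
contactomorphism preserving `X` and `Y` preserves this `β` (`invariant_of_bracketTerm_eq_one`). Put
`K = β(X)`, `G = β(Y)`. Multiplication by `(K² + G²)^(-1/2)` would give the Reeb inequality, but
this factor blows up on the binding. Replace `K² + G²` by `q = K² + G² + ε b²` with `b = -dβ(X, Y)`,
which is `1` on the binding. The resulting error is `ε` times a quadratic form in `(K, G)` with
bounded coefficients, so by compactness a small `ε` works. The factor is built from `K`, `G` and
their derivatives along `X` and `Y`, hence is invariant (`exists_adapted_rescaling`).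

The orientation statements are pointwise linear algebra. The recurring device is to write `a ∧ Ω^m`
as the contraction with `∂_s` of a power of the single `2`-form `Ω + ds ∧ a` on `ℝ × T`
(`twoFormPower_coneForm`). -/

/-! ## Linear algebra of powers of `2`-forms -/

section LinearAlgebra

/-- The summand of `twoFormPower` attached to a permutation. -/
noncomputable def twoFormPowerTerm {T : Type*} (Ω : T → T → ℝ) (m : ℕ) (v : Fin (2 * m) → T)
    (σ : Equiv.Perm (Fin (2 * m))) : ℝ :=
  ((Equiv.Perm.sign σ : ℤ) : ℝ) *
    ∏ j : Fin m, Ω (v (σ ⟨2 * j, by omega⟩)) (v (σ ⟨2 * j + 1, by omega⟩))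

theorem twoFormPower_eq_sum_term {T : Type*} (Ω : T → T → ℝ) (m : ℕ) (v : Fin (2 * m) → T) :
    twoFormPower Ω m v = ∑ σ, twoFormPowerTerm Ω m v σ := rfl

/-- The transposition of the two positions in the pair `j`. -/
def swapWithin (m : ℕ) (j : Fin m) : Equiv.Perm (Fin (2 * m)) :=
  Equiv.swap ⟨2 * j, by omega⟩ ⟨2 * j + 1, by omega⟩

/-- The permutation that exchanges the pairs of positions `i` and `j`. -/
def swapPairs (m : ℕ) (i j : Fin m) : Equiv.Perm (Fin (2 * m)) :=
  Equiv.swap ⟨2 * i, by omega⟩ ⟨2 * j, by omega⟩ *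
    Equiv.swap ⟨2 * i + 1, by omega⟩ ⟨2 * j + 1, by omega⟩

theorem swapPairs_even (m : ℕ) (i j l : Fin m) :
    swapPairs m i j ⟨2 * l, by omega⟩ = ⟨2 * (Equiv.swap i j l : Fin m), by omega⟩ := by
  unfold swapPairs
  have : Equiv.swap (⟨2 * i + 1, by omega⟩ : Fin (2 * m)) ⟨2 * j + 1, by omega⟩
      ⟨2 * l, by omega⟩ = ⟨2 * l, by omega⟩ :=
    Equiv.swap_apply_of_ne_of_ne (by simp only [ne_eq, Fin.mk.injEq]; omega)
      (by simp only [ne_eq, Fin.mk.injEq]; omega)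
  rw [Equiv.Perm.mul_apply, this]
  simp only [Equiv.swap_apply_def, Fin.ext_iff]
  split_ifs <;> first | rfl | omega

theorem swapPairs_odd (m : ℕ) (i j l : Fin m) :
    swapPairs m i j ⟨2 * l + 1, by omega⟩ = ⟨2 * (Equiv.swap i j l : Fin m) + 1, by omega⟩ := by
  unfold swapPairs
  have : Equiv.swap (⟨2 * i + 1, by omega⟩ : Fin (2 * m)) ⟨2 * j + 1, by omega⟩
      ⟨2 * l + 1, by omega⟩ = ⟨2 * (Equiv.swap i j l : Fin m) + 1, by omega⟩ := by
    simp only [Equiv.swap_apply_def, Fin.ext_iff]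
    split_ifs <;> first | rfl | omega
  rw [Equiv.Perm.mul_apply, this, Equiv.swap_apply_of_ne_of_ne] <;>
    simp only [ne_eq, Fin.mk.injEq] <;> omega

theorem sign_swapPairs (m : ℕ) (i j : Fin m) : Equiv.Perm.sign (swapPairs m i j) = 1 := by
  unfold swapPairs
  rcases eq_or_ne i j with rfl | hij
  · rw [Equiv.swap_self, Equiv.swap_self]; exact Equiv.Perm.sign_one
  · rw [Equiv.Perm.sign_mul, Equiv.Perm.sign_swap (by simpa [Fin.ext_iff] using hij),
      Equiv.Perm.sign_swap (by simpa [Fin.ext_iff] using hij)]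
    rfl

/-- The odd sign of the transposition cancels against the sign that skew-symmetry produces in the
one factor it affects. -/
theorem twoFormPowerTerm_mul_swapWithin {T : Type*} {Ω : T → T → ℝ}
    (hΩ : ∀ u v, Ω u v = -Ω v u) (m : ℕ) (v : Fin (2 * m) → T) (j : Fin m)
    (σ : Equiv.Perm (Fin (2 * m))) :
    twoFormPowerTerm Ω m v (σ * swapWithin m j) = twoFormPowerTerm Ω m v σ := by
  have hne : (⟨2 * j, by omega⟩ : Fin (2 * m)) ≠ ⟨2 * j + 1, by omega⟩ := by
    simp [Fin.ext_iff]
  have h0 : swapWithin m j ⟨2 * j, by omega⟩ = ⟨2 * j + 1, by omega⟩ := Equiv.swap_apply_left _ _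
  have h1 : swapWithin m j ⟨2 * j + 1, by omega⟩ = ⟨2 * j, by omega⟩ := Equiv.swap_apply_right _ _
  unfold twoFormPowerTerm
  rw [Equiv.Perm.sign_mul,
    ← Finset.mul_prod_erase _ _ (Finset.mem_univ j), ← Finset.mul_prod_erase _ _ (Finset.mem_univ j)]
  have h2 : ∏ i ∈ Finset.univ.erase j,
      Ω (v ((σ * swapWithin m j) ⟨2 * i, by omega⟩))
        (v ((σ * swapWithin m j) ⟨2 * i + 1, by omega⟩)) =
      ∏ i ∈ Finset.univ.erase j,
        Ω (v (σ ⟨2 * i, by omega⟩)) (v (σ ⟨2 * i + 1, by omega⟩)) := by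
    refine Finset.prod_congr rfl fun i hi => ?_
    have hij : (i : ℕ) ≠ j := fun h => (Finset.mem_erase.1 hi).1 (Fin.ext h)
    unfold swapWithin
    rw [Equiv.Perm.mul_apply, Equiv.Perm.mul_apply, Equiv.swap_apply_of_ne_of_ne,
      Equiv.swap_apply_of_ne_of_ne] <;> simp only [ne_eq, Fin.mk.injEq] <;> omega
  rw [h2, Equiv.Perm.mul_apply, Equiv.Perm.mul_apply, h0, h1, hΩ, swapWithin,
    Equiv.Perm.sign_swap hne]
  push_cast
  ring

/-- Exchanging two pairs is an even permutation, and it only reorders the factors of the product. -/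
theorem twoFormPowerTerm_mul_swapPairs {T : Type*} (Ω : T → T → ℝ) (m : ℕ)
    (v : Fin (2 * m) → T) (i j : Fin m) (σ : Equiv.Perm (Fin (2 * m))) :
    twoFormPowerTerm Ω m v (σ * swapPairs m i j) = twoFormPowerTerm Ω m v σ := by
  unfold twoFormPowerTerm
  rw [Equiv.Perm.sign_mul, sign_swapPairs, mul_one]
  rw [← Equiv.prod_comp (Equiv.swap i j) (fun l : Fin m =>
    Ω (v (σ ⟨2 * l, by omega⟩)) (v (σ ⟨2 * l + 1, by omega⟩)))]
  congr 1
  refine Finset.prod_congr rfl fun l _ => ?_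
  rw [Equiv.Perm.mul_apply, Equiv.Perm.mul_apply, swapPairs_even, swapPairs_odd]

/-- Expansion of `Ω ^ (m + 1)` along its first argument. -/
theorem twoFormPower_cons {T : Type*} {Ω : T → T → ℝ} (hΩ : ∀ u v, Ω u v = -Ω v u) (m : ℕ)
    (v₀ : T) (v : Fin (2 * m + 1) → T) :
    twoFormPower Ω (m + 1) (Fin.cons v₀ v : Fin (2 * m + 1 + 1) → T) =
      2 * (m + 1) * oneFormWedgePower (Ω v₀) Ω m v := by
  set V : Fin (2 * (m + 1)) → T := (Fin.cons v₀ v : Fin (2 * m + 1 + 1) → T) with hV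
  set z : Fin (2 * (m + 1)) := ⟨0, by omega⟩ with hz
  -- Any position `i` is the image of the first one under a `τ` that leaves every term unchanged:
  -- exchange the pair `0` with the pair `i / 2` and, for odd `i`, swap inside the pair beforehand.
  have hτ : ∀ i : Fin (2 * (m + 1)), ∃ τ : Equiv.Perm (Fin (2 * (m + 1))), τ z = i ∧
      ∀ σ, twoFormPowerTerm Ω (m + 1) V (σ * τ) = twoFormPowerTerm Ω (m + 1) V σ := by
    intro i
    have hi := i.2
    set j : Fin (m + 1) := ⟨i / 2, by omega⟩ with hj
    have he : swapPairs (m + 1) 0 j z = ⟨2 * j, by omega⟩ :=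
      (swapPairs_even (m + 1) 0 j 0).trans (by simp)
    have ho : swapPairs (m + 1) 0 j ⟨1, by omega⟩ = ⟨2 * j + 1, by omega⟩ :=
      (swapPairs_odd (m + 1) 0 j 0).trans (by simp)
    rcases Nat.even_or_odd i with ⟨k, hk⟩ | ⟨k, hk⟩
    · refine ⟨_, ?_, fun σ => twoFormPowerTerm_mul_swapPairs Ω (m + 1) V 0 j σ⟩
      rw [he]
      ext; simp only [hj]; omega
    · refine ⟨swapPairs (m + 1) 0 j * swapWithin (m + 1) 0, ?_, fun σ => ?_⟩
      · have : swapWithin (m + 1) 0 z = ⟨1, by omega⟩ := Equiv.swap_apply_left _ _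
        rw [Equiv.Perm.mul_apply, this, ho]
        ext; simp only [hj]; omega
      · rw [← mul_assoc, twoFormPowerTerm_mul_swapWithin hΩ, twoFormPowerTerm_mul_swapPairs]
  -- Group the permutations by the position `i` that receives the first argument `v₀`; by `hτ` all
  -- `2 (m + 1)` groups contribute equally.
  have h1 : twoFormPower Ω (m + 1) V = ∑ i, ∑ σ,
      if σ i = z then twoFormPowerTerm Ω (m + 1) V σ else 0 := by
    rw [twoFormPower_eq_sum_term, Finset.sum_comm]
    refine Finset.sum_congr rfl fun σ _ => ?_
    rw [Finset.sum_eq_single (σ.symm z)]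
    · simp
    · intro i _ hi
      rw [if_neg]
      rintro h
      exact hi (by rw [← h, Equiv.symm_apply_apply])
    · simp
  have h2 : ∀ i, (∑ σ, if σ i = z then twoFormPowerTerm Ω (m + 1) V σ else 0) =
      ∑ σ, if σ z = z then twoFormPowerTerm Ω (m + 1) V σ else 0 := by
    intro i
    obtain ⟨τ, hτz, hτ⟩ := hτ i
    rw [← Equiv.sum_comp (Equiv.mulRight τ) (fun σ : Equiv.Perm (Fin (2 * (m + 1))) =>
      if σ z = z then twoFormPowerTerm Ω (m + 1) V σ else 0)]
    refine Finset.sum_congr rfl fun σ _ => ?_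
    simp [Equiv.Perm.mul_apply, hτz, hτ]
  have h3 : (∑ σ, if σ z = z then twoFormPowerTerm Ω (m + 1) V σ else 0) =
      oneFormWedgePower (Ω v₀) Ω m v := by
    refine (Equiv.sum_comp (Equiv.Perm.decomposeFin (n := 2 * m + 1)).symm
      (fun σ : Equiv.Perm (Fin (2 * (m + 1))) =>
        if σ z = z then twoFormPowerTerm Ω (m + 1) V σ else 0)).symm.trans ?_
    -- `decomposeFin` records the image of `0` and a permutation of the remaining indices, so only
    -- the pairs `(0, e)` survive and `e` runs through the terms of `a ∧ Ω^m`.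
    rw [Fintype.sum_prod_type, Finset.sum_eq_single 0]
    · refine Finset.sum_congr rfl fun e _ => ?_
      have hs : ∀ (k : ℕ) (hk : k < 2 * m + 1),
          V (Equiv.Perm.decomposeFin.symm (0, e) (⟨k + 1, by omega⟩ : Fin (2 * m + 1 + 1))) =
            v (e ⟨k, hk⟩) := by
        intro k hk
        have := Equiv.Perm.decomposeFin_symm_apply_succ e 0 ⟨k, hk⟩
        rw [Equiv.swap_self, Equiv.refl_apply] at this
        exact (congrArg V this).trans (by rw [hV, Fin.cons_succ])
      have h0 : V (Equiv.Perm.decomposeFin.symm (0, e) (0 : Fin (2 * m + 1 + 1))) = v₀ := by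
        rw [Equiv.Perm.decomposeFin_symm_apply_zero]; rfl
      refine (if_pos (Equiv.Perm.decomposeFin_symm_apply_zero 0 e)).trans ?_
      unfold twoFormPowerTerm
      have hsign : Equiv.Perm.sign (Equiv.Perm.decomposeFin.symm (0, e)) = Equiv.Perm.sign e := by
        rw [Equiv.Perm.decomposeFin.symm_sign]; simp
      rw [Fin.prod_univ_succ]
      refine congr_arg₂ (· * ·) ?_ (congr_arg₂ (· * ·) ?_ ?_)
      · exact congrArg (fun s : ℤˣ => ((s : ℤ) : ℝ)) hsign
      · exact congr_arg₂ Ω h0 (hs 0 (by omega))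
      · refine Finset.prod_congr rfl fun j _ => congr_arg₂ Ω ?_ ?_
        · exact hs (2 * j + 1) (by omega)
        · exact hs (2 * j + 2) (by omega)
    · intro p _ hp
      refine Finset.sum_eq_zero fun e _ => if_neg ?_
      intro h
      exact hp ((Equiv.Perm.decomposeFin_symm_apply_zero p e).symm.trans h)
    · simp
  rw [h1, Finset.sum_congr rfl fun i _ => h2 i, h3, Finset.sum_const, Finset.card_univ,
    Fintype.card_fin, nsmul_eq_mul]
  push_cast
  ring

/-- If the `2`-form `Ω` is arbitrary and `a` vanishes on all arguments but the first one. -/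
theorem oneFormWedgePower_cons {T : Type*} (a : T → ℝ) (Ω : T → T → ℝ) (m : ℕ)
    (v₀ : T) (v : Fin (2 * m) → T) (hv : ∀ i, a (v i) = 0) :
    oneFormWedgePower a Ω m (Fin.cons v₀ v) = a v₀ * twoFormPower Ω m v := by
  unfold oneFormWedgePower twoFormPower
  -- A permutation with `σ 0 ≠ 0` feeds some `v i` to `a`, so its term vanishes.
  rw [← Equiv.sum_comp (Equiv.Perm.decomposeFin (n := 2 * m)).symm, Fintype.sum_prod_type,
    Finset.sum_eq_single 0 _ (by simp), Finset.mul_sum]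
  · refine Finset.sum_congr rfl fun e _ => ?_
    have hs : ∀ (k : ℕ) (hk : k < 2 * m),
        (Fin.cons v₀ v : Fin (2 * m + 1) → T)
          (Equiv.Perm.decomposeFin.symm (0, e) (⟨k + 1, by omega⟩ : Fin (2 * m + 1))) =
            v (e ⟨k, hk⟩) := by
      intro k hk
      have := Equiv.Perm.decomposeFin_symm_apply_succ e 0 ⟨k, hk⟩
      rw [Equiv.swap_self, Equiv.refl_apply] at this
      exact (congrArg _ this).trans (by rw [Fin.cons_succ])
    rw [Equiv.Perm.decomposeFin.symm_sign, if_pos rfl, one_mul,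
      Equiv.Perm.decomposeFin_symm_apply_zero, Fin.cons_zero, mul_left_comm]
    congr 2
  · intro p _ hp
    refine Finset.sum_eq_zero fun e _ => ?_
    obtain ⟨q, rfl⟩ := Fin.exists_succ_eq.2 hp
    rw [Equiv.Perm.decomposeFin_symm_apply_zero, Fin.cons_succ, hv]
    simp

end LinearAlgebra

section LinearAlgebra

variable {T : Type*} [AddCommGroup T] [Module ℝ T]

/-- The multilinear map `v ↦ Ω (v 0, v 1) Ω (v 2, v 3) ⋯`. -/
noncomputable def pairProduct (Ω : T →ₗ[ℝ] T →ₗ[ℝ] ℝ) (m : ℕ) :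
    MultilinearMap ℝ (fun _ : Fin (2 * m) => T) ℝ where
  toFun v := ∏ j : Fin m, Ω (v ⟨2 * j, by omega⟩) (v ⟨2 * j + 1, by omega⟩)
  map_update_add' := by
    intro dec v i x y
    obtain rfl : dec = instDecidableEqFin _ := Subsingleton.elim _ _
    have hi := i.2
    -- Only the factor of the pair `i / 2` sees the updated argument, and that factor is linear in
    -- it.
    set j : Fin m := ⟨i / 2, by omega⟩ with hj
    have key : ∀ z : T, ∏ l ∈ Finset.univ.erase j, Ω (Function.update v i z ⟨2 * l, by omega⟩)
        (Function.update v i z ⟨2 * l + 1, by omega⟩) =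
        ∏ l ∈ Finset.univ.erase j, Ω (v ⟨2 * l, by omega⟩) (v ⟨2 * l + 1, by omega⟩) := by
      intro z
      refine Finset.prod_congr rfl fun l hl => ?_
      have hlj : (l : ℕ) ≠ i / 2 := fun h => (Finset.mem_erase.1 hl).1 (Fin.ext h)
      rw [Function.update_of_ne (by simp only [ne_eq, Fin.ext_iff]; omega),
        Function.update_of_ne (by simp only [ne_eq, Fin.ext_iff]; omega)]
    simp only [← Finset.mul_prod_erase _ _ (Finset.mem_univ j), key, ← add_mul]
    congr 1
    rcases Nat.even_or_odd (i : ℕ) with ⟨k, hk⟩ | ⟨k, hk⟩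
    · have h0 : (⟨2 * j, by omega⟩ : Fin (2 * m)) = i := Fin.ext (by simp only [hj]; omega)
      have h1 : (⟨2 * j + 1, by omega⟩ : Fin (2 * m)) ≠ i := by
        simp only [ne_eq, Fin.ext_iff, hj]; omega
      rw [h0]
      simp [Function.update_of_ne h1]
    · have h0 : (⟨2 * j + 1, by omega⟩ : Fin (2 * m)) = i := Fin.ext (by simp only [hj]; omega)
      have h1 : (⟨2 * j, by omega⟩ : Fin (2 * m)) ≠ i := by
        simp only [ne_eq, Fin.ext_iff, hj]; omega
      rw [h0]
      simp [Function.update_of_ne h1]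
  map_update_smul' := by
    intro dec v i c x
    obtain rfl : dec = instDecidableEqFin _ := Subsingleton.elim _ _
    have hi := i.2
    set j : Fin m := ⟨i / 2, by omega⟩ with hj
    have key : ∀ z : T, ∏ l ∈ Finset.univ.erase j, Ω (Function.update v i z ⟨2 * l, by omega⟩)
        (Function.update v i z ⟨2 * l + 1, by omega⟩) =
        ∏ l ∈ Finset.univ.erase j, Ω (v ⟨2 * l, by omega⟩) (v ⟨2 * l + 1, by omega⟩) := by
      intro z
      refine Finset.prod_congr rfl fun l hl => ?_
      have hlj : (l : ℕ) ≠ i / 2 := fun h => (Finset.mem_erase.1 hl).1 (Fin.ext h)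
      rw [Function.update_of_ne (by simp only [ne_eq, Fin.ext_iff]; omega),
        Function.update_of_ne (by simp only [ne_eq, Fin.ext_iff]; omega)]
    simp only [← Finset.mul_prod_erase _ _ (Finset.mem_univ j), key, smul_eq_mul, ← mul_assoc]
    congr 1
    rcases Nat.even_or_odd (i : ℕ) with ⟨k, hk⟩ | ⟨k, hk⟩
    · have h0 : (⟨2 * j, by omega⟩ : Fin (2 * m)) = i := Fin.ext (by simp only [hj]; omega)
      have h1 : (⟨2 * j + 1, by omega⟩ : Fin (2 * m)) ≠ i := by
        simp only [ne_eq, Fin.ext_iff, hj]; omega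
      rw [h0]
      simp [Function.update_of_ne h1]
    · have h0 : (⟨2 * j + 1, by omega⟩ : Fin (2 * m)) = i := Fin.ext (by simp only [hj]; omega)
      have h1 : (⟨2 * j, by omega⟩ : Fin (2 * m)) ≠ i := by
        simp only [ne_eq, Fin.ext_iff, hj]; omega
      rw [h0]
      simp [Function.update_of_ne h1]

/-- `Ω ^ m` as an alternating map. -/
noncomputable def twoFormPowerAlt (Ω : T →ₗ[ℝ] T →ₗ[ℝ] ℝ) (m : ℕ) : T [⋀^Fin (2 * m)]→ₗ[ℝ] ℝ :=
  MultilinearMap.alternatization (pairProduct Ω m)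

theorem twoFormPowerAlt_apply (Ω : T →ₗ[ℝ] T →ₗ[ℝ] ℝ) (m : ℕ) (v : Fin (2 * m) → T) :
    twoFormPowerAlt Ω m v = twoFormPower (fun x y => Ω x y) m v := by
  rw [twoFormPowerAlt, MultilinearMap.alternatization_apply]
  refine Finset.sum_congr rfl fun σ _ => ?_
  rw [Units.smul_def, zsmul_eq_mul]
  rfl

/-- The `2`-form `Ω + ds ∧ a` on `ℝ × T`. -/
noncomputable def coneForm (a : T →ₗ[ℝ] ℝ) (Ω : T →ₗ[ℝ] T →ₗ[ℝ] ℝ) :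
    ℝ × T →ₗ[ℝ] ℝ × T →ₗ[ℝ] ℝ :=
  LinearMap.mk₂ ℝ (fun x y => Ω x.2 y.2 + x.1 * a y.2 - y.1 * a x.2)
    (fun x x' y => by simp; ring) (fun c x y => by simp; ring)
    (fun x y y' => by simp; ring) (fun c x y => by simp; ring)

theorem coneForm_apply (a : T →ₗ[ℝ] ℝ) (Ω : T →ₗ[ℝ] T →ₗ[ℝ] ℝ) (x y : ℝ × T) :
    coneForm a Ω x y = Ω x.2 y.2 + x.1 * a y.2 - y.1 * a x.2 := rfl

theorem coneForm_skew (a : T →ₗ[ℝ] ℝ) {Ω : T →ₗ[ℝ] T →ₗ[ℝ] ℝ} (hΩ : ∀ u v, Ω u v = -Ω v u)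
    (x y : ℝ × T) : coneForm a Ω x y = -coneForm a Ω y x := by
  rw [coneForm_apply, coneForm_apply, hΩ]; ring

/-- `a ∧ Ω ^ m` as an alternating map. -/
noncomputable def oneFormWedgePowerAlt (a : T →ₗ[ℝ] ℝ) (Ω : T →ₗ[ℝ] T →ₗ[ℝ] ℝ) (m : ℕ) :
    T [⋀^Fin (2 * m + 1)]→ₗ[ℝ] ℝ :=
  -- Contract `(Ω + ds ∧ a)^(m + 1)` with `∂_s = (1, 0)` and restrict to `T`, so that alternation is
  -- inherited. The factor removes the `2 (m + 1)` positions that `∂_s` can occupy in the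
  -- unnormalised sum.
  (2 * (m + 1) : ℝ)⁻¹ • ((show (ℝ × T) [⋀^Fin (2 * m + 1 + 1)]→ₗ[ℝ] ℝ from
    twoFormPowerAlt (coneForm a Ω) (m + 1)).curryLeft ((1, 0) : ℝ × T)).compLinearMap
      (LinearMap.inr ℝ ℝ T)

/-- The contraction of `Ω + ds ∧ a` with `∂_s` is `a` on `T`, so expanding along the first argument
yields `a ∧ Ω^m`. Facts about powers of `2`-forms thereby transfer to `a ∧ Ω^m`. -/
theorem twoFormPower_coneForm (a : T →ₗ[ℝ] ℝ) {Ω : T →ₗ[ℝ] T →ₗ[ℝ] ℝ}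
    (hΩ : ∀ u v, Ω u v = -Ω v u) (m : ℕ) (v : Fin (2 * m + 1) → T) :
    twoFormPower (fun x y => coneForm a Ω x y) (m + 1)
      (Fin.cons ((1, 0) : ℝ × T) (fun i => ((0, v i) : ℝ × T)) : Fin (2 * m + 1 + 1) → ℝ × T) =
      2 * (m + 1) * oneFormWedgePower (fun u => a u) (fun u v => Ω u v) m v := by
  rw [twoFormPower_cons (coneForm_skew a hΩ)]
  congr 1
  unfold oneFormWedgePower
  simp [coneForm_apply]

theorem oneFormWedgePowerAlt_apply (a : T →ₗ[ℝ] ℝ) {Ω : T →ₗ[ℝ] T →ₗ[ℝ] ℝ}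
    (hΩ : ∀ u v, Ω u v = -Ω v u) (m : ℕ) (v : Fin (2 * m + 1) → T) :
    oneFormWedgePowerAlt a Ω m v = oneFormWedgePower (fun u => a u) (fun u v => Ω u v) m v := by
  have h : oneFormWedgePowerAlt a Ω m v = (2 * (m + 1) : ℝ)⁻¹ *
      twoFormPowerAlt (coneForm a Ω) (m + 1) (Fin.cons ((1, 0) : ℝ × T)
        (fun i => ((0, v i) : ℝ × T)) : Fin (2 * m + 1 + 1) → ℝ × T) := rfl
  rw [h, twoFormPowerAlt_apply, twoFormPower_coneForm a hΩ, inv_mul_cancel_left₀ (by positivity)]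

/-- An alternating map does not change if multiples of the first argument are added to the other
ones. -/
theorem AlternatingMap.map_cons_add_smul {n : ℕ} (f : T [⋀^Fin (n + 1)]→ₗ[ℝ] ℝ) (v₀ : T)
    (v : Fin n → T) (c : Fin n → ℝ) :
    f (Fin.cons v₀ (fun i => v i + c i • v₀)) = f (Fin.cons v₀ v) := by
  have h := (f.curryLeft v₀).toMultilinearMap.map_add_univ v (fun i => c i • v₀)
  have h' : ∀ w, (f.curryLeft v₀).toMultilinearMap w = f (Fin.cons v₀ w) := fun w => rfl
  simp only [h'] at h
  refine Eq.trans h ?_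
  -- Every summand of the multilinear expansion except the one for `univ` has a multiple of `v₀` in
  -- a second slot.
  rw [Finset.sum_eq_single Finset.univ]
  · simp
  · intro s _ hs
    obtain ⟨i, hi⟩ : ∃ i, i ∉ s := by
      by_contra! hcon
      exact hs (Finset.eq_univ_of_forall hcon)
    set w : Fin (n + 1) → T := Fin.cons v₀ (s.piecewise v fun i => c i • v₀) with hw
    have hwi : w = Function.update w i.succ (c i • v₀) := by
      refine (Function.update_eq_self_iff.2 ?_).symm
      simp [hw, hi]
    rw [hwi, f.map_update_smul, f.map_eq_zero_of_eq _ _ (Fin.succ_ne_zero i).symm, smul_zero]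
    rw [Function.update_self, Function.update_of_ne (Fin.succ_ne_zero i).symm]
    rfl
  · simp

/-- An alternating map vanishes if too many of its arguments lie in a subspace. -/
theorem AlternatingMap.map_eq_zero_of_mem {ι κ : Type*} [Fintype κ] (f : T [⋀^ι]→ₗ[ℝ] ℝ)
    (S : Submodule ℝ T) [FiniteDimensional ℝ S] (hS : Module.finrank ℝ S < Fintype.card κ)
    (v : ι → T) (e : κ → ι) (he : Function.Injective e) (hv : ∀ k, v (e k) ∈ S) : f v = 0 := by
  refine f.map_linearDependent v fun hli => ?_
  have h1 : LinearIndependent ℝ (fun k => (⟨v (e k), hv k⟩ : S)) :=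
    LinearIndependent.of_comp S.subtype (hli.comp e he)
  exact absurd h1.fintype_card_le_finrank (by omega)

/-- Adding to the first two arguments combinations of the other ones. -/
theorem AlternatingMap.map_cons_cons_add_of_mem {n : ℕ} (f : T [⋀^Fin (n + 2)]→ₗ[ℝ] ℝ)
    (S : Submodule ℝ T) [FiniteDimensional ℝ S] (hS : Module.finrank ℝ S ≤ n)
    (e₁ e₂ n₁ n₂ : T) (hn₁ : n₁ ∈ S) (hn₂ : n₂ ∈ S) (v : Fin n → T) (hv : ∀ i, v i ∈ S) :
    f (Fin.cons (e₁ + n₁) (Fin.cons (e₂ + n₂) v)) = f (Fin.cons e₁ (Fin.cons e₂ v)) := by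
  have h1 : ∀ x y z : T, ∀ w : Fin n → T, f (Fin.cons (x + y) (Fin.cons z w)) =
      f (Fin.cons x (Fin.cons z w)) + f (Fin.cons y (Fin.cons z w)) := fun x y z w =>
    f.map_vecCons_add _ x y
  have h2 : ∀ x y z : T, ∀ w : Fin n → T, f (Fin.cons z (Fin.cons (x + y) w)) =
      f (Fin.cons z (Fin.cons x w)) + f (Fin.cons z (Fin.cons y w)) := fun x y z w =>
    (f.curryLeft z).map_vecCons_add _ x y
  -- Here, and in `h4`, `n + 1` arguments lie in a space of dimension at most `n`.
  have h3 : ∀ x y : T, x ∈ S → f (Fin.cons x (Fin.cons y v)) = 0 := by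
    intro x y hx
    refine f.map_eq_zero_of_mem S (κ := Fin (n + 1)) (by simp; omega) _
      (Fin.succAbove 1) Fin.succAbove_right_injective ?_
    intro k
    refine Fin.cases ?_ (fun k => ?_) k
    · simpa using hx
    · have : (1 : Fin (n + 2)).succAbove k.succ = k.succ.succ :=
        Fin.succAbove_of_lt_succ _ _ (by simp [Fin.lt_def])
      rw [this]
      simpa using hv k
  have h4 : ∀ x y : T, y ∈ S → f (Fin.cons x (Fin.cons y v)) = 0 := by
    intro x y hx
    refine f.map_eq_zero_of_mem S (κ := Fin (n + 1)) (by simp; omega) _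
      Fin.succ (Fin.succ_injective _) ?_
    intro k
    refine Fin.cases ?_ (fun k => ?_) k
    · simpa using hx
    · simpa using hv k
  rw [h1, h2, h3 _ _ hn₁, h4 _ _ hn₂, add_zero, add_zero]

end LinearAlgebra

section LinearAlgebra

/-- If `e₁` is orthogonal to all arguments but `e₂`. -/
theorem twoFormPower_cons_cons {T : Type*} {Ω : T → T → ℝ} (hΩ : ∀ u v, Ω u v = -Ω v u) (m : ℕ)
    (e₁ e₂ : T) (v : Fin (2 * m) → T) (hv : ∀ i, Ω e₁ (v i) = 0) :
    twoFormPower Ω (m + 1) (Fin.cons e₁ (Fin.cons e₂ v : Fin (2 * m + 1) → T) :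
      Fin (2 * m + 1 + 1) → T) = 2 * (m + 1) * (Ω e₁ e₂ * twoFormPower Ω m v) := by
  rw [twoFormPower_cons hΩ, oneFormWedgePower_cons _ _ _ _ _ hv]

variable {T : Type*} [AddCommGroup T] [Module ℝ T]

theorem AlternatingMap.map_cons_cons_swap {n : ℕ} (f : T [⋀^Fin (n + 2)]→ₗ[ℝ] ℝ) (x y : T)
    (v : Fin n → T) : f (Fin.cons x (Fin.cons y v)) = -f (Fin.cons y (Fin.cons x v)) := by
  rw [← f.map_swap _ (i := 0) (j := 1) (by simp)]
  congr 1
  funext i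
  refine Fin.cases ?_ (fun i => Fin.cases ?_ (fun i => ?_) i) i
  · simp only [Function.comp_apply, Equiv.swap_apply_left]; rfl
  · change _ = (Fin.cons y (Fin.cons x v) : Fin (n + 2) → T) (Equiv.swap 0 1 1)
    rw [Equiv.swap_apply_right]; rfl
  · have : Equiv.swap (0 : Fin (n + 2)) 1 i.succ.succ = i.succ.succ :=
      Equiv.swap_apply_of_ne_of_ne (Fin.succ_ne_zero _)
        (fun h => Fin.succ_ne_zero i (Fin.succ_injective _ h))
    rw [Function.comp_apply, this]
    rfl

theorem AlternatingMap.map_cons_cons_cons_rotate {n : ℕ} (f : T [⋀^Fin (n + 3)]→ₗ[ℝ] ℝ)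
    (x y z : T) (v : Fin n → T) :
    f (Fin.cons x (Fin.cons y (Fin.cons z v))) = f (Fin.cons y (Fin.cons z (Fin.cons x v))) := by
  rw [f.map_cons_cons_swap x y]
  have := (f.curryLeft y).map_cons_cons_swap x z v
  exact neg_eq_iff_eq_neg.2 this

variable {a : T →ₗ[ℝ] ℝ} {Ω : T →ₗ[ℝ] T →ₗ[ℝ] ℝ}

/-- If `e₁` and `e₂` lie in `ker a` and `Ω e₁` is proportional to `a` on the other arguments. -/
theorem oneFormWedgePower_cons_cons (hΩ : ∀ u v, Ω u v = -Ω v u) (m : ℕ) (e₁ e₂ : T)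
    (h₁ : a e₁ = 0) (h₂ : a e₂ = 0) (c : ℝ) (v : Fin (2 * m + 1) → T)
    (hv : ∀ i, Ω e₁ (v i) = c * a (v i)) :
    oneFormWedgePower (fun u => a u) (fun u v => Ω u v) (m + 1)
        (Fin.cons e₁ (Fin.cons e₂ v : Fin (2 * m + 2) → T) : Fin (2 * m + 3) → T) =
      2 * (m + 1) * Ω e₁ e₂ * oneFormWedgePower (fun u => a u) (fun u v => Ω u v) m v := by
  set s : ℝ × T := (1, 0) with hs
  set w : Fin (2 * m + 1) → ℝ × T := fun i => (0, v i) with hw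
  let f : (ℝ × T) [⋀^Fin (2 * m + 1 + 3)]→ₗ[ℝ] ℝ := twoFormPowerAlt (coneForm a Ω) (m + 2)
  have hf : ∀ u, f u = twoFormPower (fun x y => coneForm a Ω x y) (m + 2) u := fun u =>
    twoFormPowerAlt_apply _ _ _
  have e1 : 2 * ((m + 1 : ℕ) + 1 : ℝ) * oneFormWedgePower (fun u => a u) (fun u v => Ω u v) (m + 1)
      (Fin.cons e₁ (Fin.cons e₂ v : Fin (2 * m + 2) → T) : Fin (2 * m + 3) → T) =
      f (Fin.cons s (Fin.cons (0, e₁) (Fin.cons (0, e₂) w))) := by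
    rw [← twoFormPower_coneForm a hΩ, hf]
    congr 1
    refine congrArg (fun u : Fin (2 * m + 3) → ℝ × T =>
      (Fin.cons s u : Fin (2 * m + 4) → ℝ × T)) ?_
    funext i
    refine Fin.cases rfl (fun i => Fin.cases rfl (fun i => rfl) i) i
  -- Since `s` is among the arguments, `e₁` may be replaced by `e₁ - c s`, which is orthogonal for
  -- the cone form to `s` and to all `v i`, because `a e₁ = 0` and `Ω e₁ = c a` on the `v i`.
  have e2 : f (Fin.cons s (Fin.cons (0, e₁) (Fin.cons (0, e₂) w))) =
      f (Fin.cons s (Fin.cons (-c, e₁) (Fin.cons (0, e₂) w))) := by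
    rw [← f.map_cons_add_smul s (Fin.cons (0, e₁) (Fin.cons (0, e₂) w))
      (Fin.cons (-c) 0)]
    congr 2
    funext i
    refine Fin.cases ?_ (fun i => Fin.cases ?_ (fun i => ?_) i) i <;> simp [hs]
  -- With `s` rotated behind `e₁` and `e₂`, the corrected `e₁` pairs only with `e₂`; what remains is
  -- the cone expression of `a ∧ Ω^m`.
  have e3 : f (Fin.cons (-c, e₁) (Fin.cons (0, e₂) (Fin.cons s w))) =
      2 * ((m + 1 : ℕ) + 1) * (Ω e₁ e₂ *
        (2 * (m + 1) * oneFormWedgePower (fun u => a u) (fun u v => Ω u v) m v)) := by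
    rw [hf, ← twoFormPower_coneForm a hΩ]
    refine (twoFormPower_cons_cons (coneForm_skew a hΩ) (m + 1) _ _
      (Fin.cons s w : Fin (2 * m + 1 + 1) → ℝ × T) ?_).trans ?_
    · intro i
      refine Fin.cases ?_ (fun i => ?_) (i : Fin (2 * m + 1 + 1))
      · simp [coneForm_apply, hs, h₁]
      · simp [coneForm_apply, hw, hv]
    · simp only [coneForm_apply, h₁, h₂]
      simp only [mul_zero, add_zero, sub_zero]
      rfl
  rw [e2, f.map_cons_cons_cons_rotate, e3] at e1
  have : (2 * ((m + 1 : ℕ) + 1) : ℝ) ≠ 0 := by positivity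
  rw [mul_left_cancel₀ this e1]
  ring

/-- `a ∧ Ω ^ m` only depends on `Ω` modulo `a`. -/
theorem oneFormWedgePower_add_wedge (hΩ : ∀ u v, Ω u v = -Ω v u) (γ : T →ₗ[ℝ] ℝ) (m : ℕ)
    (v : Fin (2 * m + 1) → T) :
    oneFormWedgePower (fun u => a u) (fun u v => Ω u v + (γ u * a v - γ v * a u)) m v =
      oneFormWedgePower (fun u => a u) (fun u v => Ω u v) m v := by
  let Ω' : T →ₗ[ℝ] T →ₗ[ℝ] ℝ := LinearMap.mk₂ ℝ (fun u v => Ω u v + (γ u * a v - γ v * a u))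
    (fun x x' y => by simp; ring) (fun c x y => by simp; ring)
    (fun x y y' => by simp; ring) (fun c x y => by simp; ring)
  have hΩ' : ∀ u v, Ω' u v = -Ω' v u := fun u v => by
    simp only [Ω', LinearMap.mk₂_apply]; rw [hΩ]; ring
  have h1 := twoFormPower_coneForm a hΩ' m v
  have h2 := twoFormPower_coneForm a hΩ m v
  -- The shear `s ↦ s + γ` pulls `Ω + ds ∧ a` back to `Ω + γ ∧ a + ds ∧ a`. It moves each argument
  -- by a multiple of `∂_s`, which is already the first argument.
  let S : ℝ × T → ℝ × T := fun x => (x.1 + γ x.2, x.2)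
  have h3 : (fun x y => coneForm a Ω' x y) = fun x y => coneForm a Ω (S x) (S y) := by
    funext x y
    simp only [coneForm_apply, S, Ω', LinearMap.mk₂_apply]
    ring
  rw [h3] at h1
  have h4 : twoFormPower (fun x y => coneForm a Ω (S x) (S y)) (m + 1)
      (Fin.cons ((1, 0) : ℝ × T) (fun i => ((0, v i) : ℝ × T)) : Fin (2 * m + 1 + 1) → ℝ × T) =
      twoFormPower (fun x y => coneForm a Ω x y) (m + 1)
      (Fin.cons ((1, 0) : ℝ × T) (fun i => ((0, v i) : ℝ × T) + γ (v i) • ((1, 0) : ℝ × T)) :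
        Fin (2 * m + 1 + 1) → ℝ × T) := by
    change twoFormPower (fun x y => coneForm a Ω x y) (m + 1) (S ∘ _) = _
    congr 1
    funext i
    refine Fin.cases ?_ (fun i => ?_) (i : Fin (2 * m + 1 + 1))
    · change S (1, 0) = (1, 0)
      simp [S]
    · change S (0, v i) = (0, v i) + γ (v i) • ((1, 0) : ℝ × T)
      simp [S]
  rw [h4] at h1
  let f : (ℝ × T) [⋀^Fin (2 * m + 1 + 1)]→ₗ[ℝ] ℝ := twoFormPowerAlt (coneForm a Ω) (m + 1)
  have hf : ∀ u, f u = twoFormPower (fun x y => coneForm a Ω x y) (m + 1) u := fun u =>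
    twoFormPowerAlt_apply _ _ _
  have h5 := f.map_cons_add_smul (1, 0) (fun i => ((0, v i) : ℝ × T)) (fun i => γ (v i))
  rw [hf, hf] at h5
  rw [h5, h2] at h1
  have : (2 * (m + 1) : ℝ) ≠ 0 := by positivity
  exact (mul_left_cancel₀ this h1).symm

theorem oneFormWedgePower_smul {T : Type*} (a : T → ℝ) (Ω : T → T → ℝ) (f : ℝ) (m : ℕ)
    (v : Fin (2 * m + 1) → T) :
    oneFormWedgePower (fun u => f * a u) (fun u v => f * Ω u v) m v =
      f ^ (m + 1) * oneFormWedgePower a Ω m v := by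
  unfold oneFormWedgePower
  rw [Finset.mul_sum]
  refine Finset.sum_congr rfl fun σ _ => ?_
  rw [Finset.prod_mul_distrib, Finset.prod_const, Finset.card_univ, Fintype.card_fin]
  ring

/-- The behaviour of `a ∧ Ω ^ m` under multiplication of the contact form `a` by a function with
value `f` and differential `γ`. -/
theorem oneFormWedgePower_rescale (hΩ : ∀ u v, Ω u v = -Ω v u) (γ : T →ₗ[ℝ] ℝ) {f : ℝ}
    (hf : f ≠ 0) (m : ℕ) (v : Fin (2 * m + 1) → T) :
    oneFormWedgePower (fun u => f * a u) (fun u v => f * Ω u v + (γ u * a v - γ v * a u)) m v =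
      f ^ (m + 1) * oneFormWedgePower (fun u => a u) (fun u v => Ω u v) m v := by
  rw [← oneFormWedgePower_add_wedge hΩ (f⁻¹ • γ), ← oneFormWedgePower_smul]
  congr 1
  funext u v
  simp only [LinearMap.smul_apply, smul_eq_mul]
  field_simp

/-- Whatever position a permutation gives to `v i`, either `a` or one of the factors `Ω` is
evaluated on it. -/
theorem oneFormWedgePower_eq_zero {T : Type*} {a : T → ℝ} {Ω : T → T → ℝ}
    (m : ℕ) (v : Fin (2 * m + 1) → T) (i : Fin (2 * m + 1)) (h : a (v i) = 0)
    (h' : ∀ u, Ω (v i) u = 0) (h'' : ∀ u, Ω u (v i) = 0) : oneFormWedgePower a Ω m v = 0 := by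
  refine Finset.sum_eq_zero fun σ _ => mul_eq_zero_of_right _ ?_
  obtain ⟨k, rfl⟩ := σ.surjective i
  have hk := k.2
  rcases Nat.eq_zero_or_pos (k : ℕ) with h0 | h0
  · have : k = 0 := Fin.ext h0
    rw [← this, h, zero_mul]
  · refine mul_eq_zero_of_right _
      (Finset.prod_eq_zero (Finset.mem_univ (⟨(k - 1) / 2, by omega⟩ : Fin m)) ?_)
    rcases Nat.even_or_odd (k : ℕ) with ⟨l, hl⟩ | ⟨l, hl⟩
    · have : (⟨2 * ((k - 1) / 2) + 2, by omega⟩ : Fin (2 * m + 1)) = k :=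
        Fin.ext (by simp only; omega)
      simp only [this, h'']
    · have : (⟨2 * ((k - 1) / 2) + 1, by omega⟩ : Fin (2 * m + 1)) = k :=
        Fin.ext (by simp only; omega)
      simp only [this, h']

/-- A form `a` with `a ∧ Ω ^ d ≠ 0` in dimension `2 d + 1` has a Reeb vector. -/
theorem exists_reebVector (hΩ : ∀ u v, Ω u v = -Ω v u) [FiniteDimensional ℝ T] {d : ℕ}
    (hT : Module.finrank ℝ T = 2 * d + 1) (v : Fin (2 * d + 1) → T)
    (hv : oneFormWedgePower (fun u => a u) (fun u v => Ω u v) d v ≠ 0) :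
    ∃ R, a R = 1 ∧ ∀ u, Ω R u = 0 := by
  have hQ := oneFormWedgePowerAlt_apply a hΩ d
  -- A skew-symmetric matrix of odd size has determinant zero, hence a nonzero kernel vector.
  obtain ⟨R, hR, hRΩ⟩ : ∃ R, R ≠ 0 ∧ ∀ u, Ω R u = 0 := by
    let b := Module.finBasisOfFinrankEq ℝ T hT
    let A : Matrix (Fin (2 * d + 1)) (Fin (2 * d + 1)) ℝ := fun i j => Ω (b i) (b j)
    have hA : A.transpose = -A := by
      ext i j; exact hΩ _ _
    have hdet : A.det = 0 := by
      have := A.det_transpose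
      rw [hA, Matrix.det_neg, Fintype.card_fin, pow_succ, pow_mul] at this
      norm_num at this
      linarith
    obtain ⟨w, hw, hwA⟩ := Matrix.exists_vecMul_eq_zero_iff.2 hdet
    refine ⟨∑ i, w i • b i, fun h => hw ?_, fun u => ?_⟩
    · have := Fintype.linearIndependent_iff.1 b.linearIndependent w h
      exact funext this
    · have : (Ω (∑ i, w i • b i)) = 0 := by
        refine b.ext fun j => ?_
        have := congrFun hwA j
        simpa [Matrix.vecMul, dotProduct, A] using this
      rw [this]; rfl
  have hli : LinearIndependent ℝ v := by
    by_contra h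
    exact hv (by rw [← hQ]; exact AlternatingMap.map_linearDependent _ _ h)
  -- Expand `R` in the basis `v`. If `a R = 0`, putting `R` in place of some `v i` with nonzero
  -- coefficient kills `a ∧ Ω^d`, although the result is that coefficient times the value on `v`.
  have haR : a R ≠ 0 := by
    intro h
    have hmem : R ∈ Submodule.span ℝ (range v) := by
      rw [hli.span_eq_top_of_card_eq_finrank (by simp [hT])]; trivial
    obtain ⟨c, hc⟩ := (Submodule.mem_span_range_iff_exists_fun ℝ).1 hmem
    obtain ⟨i, hi⟩ : ∃ i, c i ≠ 0 := by
      by_contra! hcon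
      exact hR (by rw [← hc]; simp [hcon])
    have h0 : oneFormWedgePowerAlt a Ω d (Function.update v i R) = 0 := by
      rw [hQ]
      refine oneFormWedgePower_eq_zero d _ i ?_ ?_ ?_ <;> simp only [Function.update_self]
      · exact h
      · exact hRΩ
      · intro u; rw [hΩ, hRΩ, neg_zero]
    rw [← hc, AlternatingMap.map_update_sum, Finset.sum_eq_single i] at h0
    · rw [AlternatingMap.map_update_smul, Function.update_eq_self, hQ] at h0
      exact (mul_ne_zero hi hv) h0
    · intro j _ hj
      rw [AlternatingMap.map_update_smul, AlternatingMap.map_update_self _ _ hj.symm, smul_zero]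
    · simp
  refine ⟨(a R)⁻¹ • R, ?_, fun u => ?_⟩
  · rw [map_smul, smul_eq_mul, inv_mul_cancel₀ haR]
  · rw [map_smul, LinearMap.smul_apply, hRΩ, smul_zero]

/-- On a hyperplane `ker l` that is positively transverse to the Reeb vector, `Ω ^ d` has the sign
of the induced orientation. -/
theorem oneFormWedgePower_pos_iff_of_reeb (hΩ : ∀ u v, Ω u v = -Ω v u) [FiniteDimensional ℝ T]
    {d : ℕ} (hT : Module.finrank ℝ T = 2 * d + 1) {R : T} (haR : a R = 1) (hR : ∀ u, Ω R u = 0)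
    (l : T →ₗ[ℝ] ℝ) (hl : 0 < l R) (N : T) (hN : 0 < l N) (w : Fin (2 * d) → T)
    (hw : ∀ i, l (w i) = 0) :
    0 < oneFormWedgePower (fun u => a u) (fun u v => Ω u v) d (Fin.cons N w) ↔
      0 < twoFormPower (fun u v => Ω u v) d w := by
  have hQ := oneFormWedgePowerAlt_apply a hΩ d
  have hl0 : l ≠ 0 := by rintro rfl; simp at hl
  have hker : Module.finrank ℝ (LinearMap.ker l) < Fintype.card (Fin (2 * d + 1)) := by
    have := Module.Dual.finrank_ker_add_one_of_ne_zero hl0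
    simp; omega
  -- `N` and `c R` agree modulo `ker l`, whose dimension `2 d` is too small for `2 d + 1` arguments.
  -- So `N` may be replaced by a positive multiple of `R`.
  set c := l N / l R with hc
  have hcpos : 0 < c := div_pos hN hl
  have h1 : oneFormWedgePowerAlt a Ω d (Fin.cons (N - c • R) w) = 0 := by
    refine AlternatingMap.map_eq_zero_of_mem _ (LinearMap.ker l) hker _ id Function.injective_id ?_
    intro i
    refine Fin.cases ?_ (fun i => ?_) i
    · simp [hc, hl.ne']
    · simpa using hw i
  -- In the cone form `R` pairs with `∂_s` to `-1` and with every `w i` to `0`; the sign is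
  -- compensated by swapping `R` and `∂_s`.
  have h2 : oneFormWedgePowerAlt a Ω d (Fin.cons R w) = twoFormPower (fun u v => Ω u v) d w := by
    have e1 := twoFormPower_coneForm a hΩ d (Fin.cons R w)
    let f : (ℝ × T) [⋀^Fin (2 * d + 2)]→ₗ[ℝ] ℝ := twoFormPowerAlt (coneForm a Ω) (d + 1)
    have hf : ∀ u, f u = twoFormPower (fun x y => coneForm a Ω x y) (d + 1) u := fun u =>
      twoFormPowerAlt_apply _ _ _
    have e2 : (fun i => ((0, (Fin.cons R w : Fin (2 * d + 1) → T) i) : ℝ × T)) =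
        Fin.cons (0, R) (fun i => (0, w i)) := by
      funext i
      exact Fin.cases rfl (fun i => rfl) i
    rw [e2, ← hf, f.map_cons_cons_swap, hf] at e1
    rw [hQ]
    have e3 := twoFormPower_cons_cons (coneForm_skew a hΩ) d ((0, R) : ℝ × T) (1, 0)
      (fun i => (0, w i)) (fun i => by simp [coneForm_apply, hR])
    rw [e3] at e1
    have e4 : coneForm a Ω (0, R) (1, 0) = -1 := by simp [coneForm_apply, haR]
    have e5 : twoFormPower (fun x y => coneForm a Ω x y) d (fun i => ((0, w i) : ℝ × T)) =
        twoFormPower (fun u v => Ω u v) d w := by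
      unfold twoFormPower
      simp [coneForm_apply]
    rw [e4, e5] at e1
    have : (2 * (d + 1) : ℝ) ≠ 0 := by positivity
    refine (mul_left_cancel₀ this ?_).symm
    linarith
  have h3 : oneFormWedgePowerAlt a Ω d (Fin.cons N w) =
      c * oneFormWedgePowerAlt a Ω d (Fin.cons R w) := by
    have e1 := (oneFormWedgePowerAlt a Ω d).map_vecCons_add w (N - c • R) (c • R)
    have e2 := (oneFormWedgePowerAlt a Ω d).map_vecCons_smul w c R
    rw [sub_add_cancel, e2] at e1
    exact e1.trans (by rw [Matrix.vecCons, h1, zero_add]; rfl)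
  rw [← hQ, h3, h2]
  exact mul_pos_iff_of_pos_left hcpos

/-- The sign of `a ∧ Ω ^ (m + 1)` on the total space and of `a ∧ Ω ^ m` on the codimension `2`
subspace `ker l`, if `ker l` has a basis `X`, `Y` of the orthogonal in `ker a` as complement. -/
theorem oneFormWedgePower_pos_iff_of_codim_two (hΩ : ∀ u v, Ω u v = -Ω v u)
    [FiniteDimensional ℝ T] {m : ℕ} (hT : Module.finrank ℝ T = 2 * m + 3) (l : T →ₗ[ℝ] ℝ × ℝ)
    {X Y : T} (hX : a X = 0) (hY : a Y = 0) {r : ℝ} (hr : 0 < r) (hlX : l X = (0, -r))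
    (hlY : l Y = (-r, 0)) (hXY : Ω X Y < 0) {c₁ c₂ : ℝ} (hX' : ∀ u, l u = 0 → Ω X u = c₁ * a u)
    (hY' : ∀ u, l u = 0 → Ω Y u = c₂ * a u) (N₁ N₂ : T) (w : Fin (2 * m + 1) → T)
    (hN : 0 < (l N₁).1 * (l N₂).2 - (l N₁).2 * (l N₂).1) (hw : ∀ i, l (w i) = 0) :
    0 < oneFormWedgePower (fun u => a u) (fun u v => Ω u v) (m + 1)
        (Fin.cons N₁ (Fin.cons N₂ w : Fin (2 * m + 2) → T) : Fin (2 * m + 3) → T) ↔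
      0 < oneFormWedgePower (fun u => a u) (fun u v => Ω u v) m w := by
  have hsurj : Function.Surjective l := by
    intro z
    refine ⟨(-r⁻¹ * z.2) • X + (-r⁻¹ * z.1) • Y, ?_⟩
    ext <;> simp [hlX, hlY] <;> field_simp
  have hker : Module.finrank ℝ (LinearMap.ker l) ≤ 2 * m + 1 := by
    have h1 := LinearMap.finrank_range_add_finrank_ker l
    rw [LinearMap.range_eq_top.2 hsurj, finrank_top] at h1
    simp at h1
    omega
  -- `E N` is the component of `N` in the span of `X` and `Y`, along `ker l`. Modulo `ker l` the
  -- vectors `N₁`, `N₂` can be replaced by these components, which lie in `ker a`.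
  set E : T → T := fun N => (-r⁻¹ * (l N).2) • X + (-r⁻¹ * (l N).1) • Y with hE
  have hE0 : ∀ N, a (E N) = 0 := fun N => by simp [hE, hX, hY]
  have hEl : ∀ N, N - E N ∈ LinearMap.ker l := fun N => by
    rw [LinearMap.mem_ker, map_sub, sub_eq_zero]
    ext <;> simp [hE, hlX, hlY] <;> field_simp
  have hEu : ∀ N i, Ω (E N) (w i) = (-r⁻¹ * (l N).2 * c₁ + -r⁻¹ * (l N).1 * c₂) * a (w i) := by
    intro N i
    simp only [hE, map_add, map_smul, LinearMap.add_apply, LinearMap.smul_apply, smul_eq_mul,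
      hX' _ (hw i), hY' _ (hw i)]
    ring
  have h1 : oneFormWedgePower (fun u => a u) (fun u v => Ω u v) (m + 1)
        (Fin.cons N₁ (Fin.cons N₂ w : Fin (2 * m + 2) → T) : Fin (2 * m + 3) → T) =
      oneFormWedgePower (fun u => a u) (fun u v => Ω u v) (m + 1)
        (Fin.cons (E N₁) (Fin.cons (E N₂) w : Fin (2 * m + 2) → T) : Fin (2 * m + 3) → T) := by
    let f : T [⋀^Fin (2 * m + 1 + 2)]→ₗ[ℝ] ℝ := oneFormWedgePowerAlt a Ω (m + 1)
    have hf : ∀ u, f u = oneFormWedgePower (fun u => a u) (fun u v => Ω u v) (m + 1) u := fun u =>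
      oneFormWedgePowerAlt_apply a hΩ _ _
    have := f.map_cons_cons_add_of_mem (LinearMap.ker l) hker (E N₁) (E N₂) _ _ (hEl N₁) (hEl N₂)
      w hw
    rw [add_sub_cancel, add_sub_cancel] at this
    rw [← hf, ← hf]
    exact this
  rw [h1, oneFormWedgePower_cons_cons hΩ m _ _ (hE0 _) (hE0 _) _ w (hEu N₁)]
  have hXX : ∀ u, Ω u u = 0 := fun u => by have := hΩ u u; linarith
  -- Both orders get reversed: `l` sends `(X, Y)` to a negatively oriented pair, and `Ω X Y < 0`.
  -- The two signs cancel.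
  have h2 : Ω (E N₁) (E N₂) =
      r⁻¹ ^ 2 * -Ω X Y * ((l N₁).1 * (l N₂).2 - (l N₁).2 * (l N₂).1) := by
    simp only [hE, map_add, map_smul, LinearMap.add_apply, LinearMap.smul_apply, smul_eq_mul, hXX,
      hΩ Y X]
    ring
  rw [h2]
  refine mul_pos_iff_of_pos_left ?_
  have : 0 < -Ω X Y := by linarith
  positivity

end LinearAlgebra

/-! ## Calculus of `1`-forms on manifolds -/

section VectorSpaceForms

variable {E E' : Type*} [NormedAddCommGroup E] [NormedSpace ℝ E] [NormedAddCommGroup E']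
  [NormedSpace ℝ E']

/-- The exterior derivative of a `1`-form on a normed space. -/
noncomputable def formD (θ : E → E →L[ℝ] ℝ) (y v w : E) : ℝ :=
  fderiv ℝ θ y v w - fderiv ℝ θ y w v

/-- Besides the expected term, the chain rule produces the second derivative of `ψ`, which is
symmetric and cancels in the antisymmetrisation. -/
theorem formD_pullback {θ : E' → E' →L[ℝ] ℝ} {ψ : E → E'} {y : E}
    (hθ : DifferentiableAt ℝ θ (ψ y)) (hψ : ContDiffAt ℝ ∞ ψ y) (v w : E) :
    formD (fun z => (θ (ψ z)).comp (fderiv ℝ ψ z)) y v w =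
      formD θ (ψ y) (fderiv ℝ ψ y v) (fderiv ℝ ψ y w) := by
  have h1 : DifferentiableAt ℝ ψ y := hψ.differentiableAt (by simp)
  have h2 : DifferentiableAt ℝ (fderiv ℝ ψ) y :=
    (hψ.fderiv_right (m := ∞) (by simp)).differentiableAt (by simp)
  have h3 : DifferentiableAt ℝ (fun z => θ (ψ z)) y := hθ.comp y h1
  have h4 : IsSymmSndFDerivAt ℝ ψ y := hψ.isSymmSndFDerivAt (by
    rw [minSmoothness_of_isRCLikeNormedField]; exact WithTop.coe_le_coe.2 le_top)
  have h5 : fderiv ℝ (fun z => θ (ψ z)) y = (fderiv ℝ θ (ψ y)).comp (fderiv ℝ ψ y) :=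
    fderiv_comp y hθ h1
  unfold formD
  rw [fderiv_clm_comp h3 h2, h5]
  simp [h4 v w]

end VectorSpaceForms

section Forms

variable {E H M : Type*} [NormedAddCommGroup E] [NormedSpace ℝ E] [TopologicalSpace H]
  {I : ModelWithCorners ℝ E H} [I.Boundaryless] [TopologicalSpace M] [ChartedSpace H M]
  [IsManifold I ∞ M]
  {E' H' N : Type*} [NormedAddCommGroup E'] [NormedSpace ℝ E'] [TopologicalSpace H']
  {I' : ModelWithCorners ℝ E' H'} [I'.Boundaryless] [TopologicalSpace N] [ChartedSpace H' N]
  [IsManifold I' ∞ N]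

/-- Under the identification of the tangent space at `p` with `E`, the preferred chart at `p` has
identity differential there. -/
theorem OneForm.d_eq_formD (α : OneForm I M) (p : M) (v w : TangentSpace I p) :
    α.d I p v w = formD (α.inChart I p) (extChartAt I p p) v w := by
  unfold OneForm.d formD
  rw [mfderiv_extChartAt_self]
  rfl

/-- The pullback of a `1`-form. -/
noncomputable def OneForm.pullback (F : M → N) (α : OneForm I' N) : OneForm I M :=
  fun p => (α (F p)).comp (mfderiv I I' F p)

theorem mdifferentiableAt_extChartAt_symm (p : M) {y : E} (hy : y ∈ (extChartAt I p).target) :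
    MDifferentiableAt 𝓘(ℝ, E) I (extChartAt I p).symm y := by
  have := (contMDiffOn_extChartAt_symm (I := I) (n := ∞) p).contMDiffAt
    ((isOpen_extChartAt_target p).mem_nhds hy)
  exact this.mdifferentiableAt (by simp)

/-- The expression of the pulled back form in charts. -/
theorem OneForm.inChart_pullback_eventuallyEq (F : M → N) (α : OneForm I' N) (p : M)
    (hF : ContMDiffAt I I' ∞ F p) :
    (α.pullback (I := I) F).inChart I p =ᶠ[𝓝 (extChartAt I p p)] fun y =>
      (α.inChart I' (F p) ((extChartAt I' (F p) ∘ F ∘ (extChartAt I p).symm) y)).comp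
        (fderiv ℝ (extChartAt I' (F p) ∘ F ∘ (extChartAt I p).symm) y) := by
  have hs : ContMDiffAt 𝓘(ℝ, E) I ∞ (extChartAt I p).symm (extChartAt I p p) :=
    (contMDiffOn_extChartAt_symm (I := I) (n := ∞) p).contMDiffAt
      (extChartAt_target_mem_nhds p)
  have hp : (extChartAt I p).symm (extChartAt I p p) = p := extChartAt_to_inv p
  have hF1 : ContMDiffAt I I' 1 F p := hF.of_le (by exact_mod_cast le_top)
  have hFev : ∀ᶠ q in 𝓝 p, ContMDiffAt I I' 1 F q :=
    contMDiffAt_iff_contMDiffAt_nhds (by simp) |>.1 hF1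
  have hsrc : ∀ᶠ q in 𝓝 p, F q ∈ (extChartAt I' (F p)).source :=
    hF.continuousAt.eventually (extChartAt_source_mem_nhds (F p))
  have hcont : Filter.Tendsto (extChartAt I p).symm (𝓝 (extChartAt I p p)) (𝓝 p) := by
    have := hs.continuousAt
    rwa [ContinuousAt, hp] at this
  filter_upwards [(isOpen_extChartAt_target (I := I) p).eventually_mem
    (mem_extChartAt_target p), hcont.eventually hFev,
    (hcont.eventually hsrc).eventually_nhds] with y hy h1 h2
  have hsy := mdifferentiableAt_extChartAt_symm p hy
  have hFy : MDifferentiableAt I I' F ((extChartAt I p).symm y) := h1.mdifferentiableAt (by simp)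
  have h3 := h2.self_of_nhds
  have hcy : MDifferentiableAt I' 𝓘(ℝ, E') (extChartAt I' (F p)) (F ((extChartAt I p).symm y)) :=
    mdifferentiableAt_extChartAt (by rwa [← extChartAt_source I'])
  set ψ := extChartAt I' (F p) ∘ F ∘ (extChartAt I p).symm with hψ
  have hψy : MDifferentiableAt 𝓘(ℝ, E) 𝓘(ℝ, E') ψ y :=
    hcy.comp y (hFy.comp y hsy)
  have hψt : ψ y ∈ (extChartAt I' (F p)).target := (extChartAt I' (F p)).map_source h3
  -- Differentiating this local identity relates the derivative of the coordinate expression `ψ` to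
  -- the differential of `F`.
  have h4 : (extChartAt I' (F p)).symm ∘ ψ =ᶠ[𝓝 y] F ∘ (extChartAt I p).symm := by
    filter_upwards [h2] with z hz
    exact (extChartAt I' (F p)).left_inv hz
  have h5 := h4.mfderiv_eq (I := 𝓘(ℝ, E)) (I' := I')
  rw [mfderiv_comp y (mdifferentiableAt_extChartAt_symm _ hψt) hψy, mfderiv_comp y hFy hsy,
    mfderiv_eq_fderiv] at h5
  have h6 : (extChartAt I' (F p)).symm (ψ y) = F ((extChartAt I p).symm y) := h4.self_of_nhds
  have h7 : (α ((extChartAt I' (F p)).symm (ψ y)) : E' →L[ℝ] ℝ) =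
    (α (F ((extChartAt I p).symm y)) : E' →L[ℝ] ℝ) := by rw [h6]
  have e1 : (α.pullback (I := I) F).inChart I p y = ((α (F ((extChartAt I p).symm y)) : E' →L[ℝ] ℝ)).comp
      ((mfderiv I I' F ((extChartAt I p).symm y) : E →L[ℝ] E').comp (mfderiv 𝓘(ℝ, E) I (extChartAt I p).symm y : E →L[ℝ] E)) := rfl
  have e2 : (α.inChart I' (F p) (ψ y)).comp (fderiv ℝ ψ y) = ((α ((extChartAt I' (F p)).symm (ψ y)) : E' →L[ℝ] ℝ)).comp
      ((mfderiv 𝓘(ℝ, E') I' (extChartAt I' (F p)).symm (ψ y) : E' →L[ℝ] E').comp (fderiv ℝ ψ y)) := rfl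
  rw [e1, e2, h7]
  exact congrArg _ h5.symm

/-- The exterior derivative commutes with pullbacks. -/
theorem OneForm.d_pullback {F : M → N} {α : OneForm I' N} {p : M}
    (hα : DifferentiableAt ℝ (α.inChart I' (F p)) (extChartAt I' (F p) (F p)))
    (hF : ContMDiffAt I I' ∞ F p) (v w : TangentSpace I p) :
    (α.pullback (I := I) F).d I p v w =
      α.d I' (F p) (mfderiv I I' F p v) (mfderiv I I' F p w) := by
  have hψ : ContDiffAt ℝ ∞ (extChartAt I' (F p) ∘ F ∘ (extChartAt I p).symm)
      (extChartAt I p p) := by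
    have := (contMDiffAt_iff.1 hF).2
    rwa [ModelWithCorners.Boundaryless.range_eq_univ, contDiffWithinAt_univ] at this
  have h0 : (extChartAt I' (F p) ∘ F ∘ (extChartAt I p).symm) (extChartAt I p p) =
      extChartAt I' (F p) (F p) := by simp
  have h1 : mfderiv I I' F p = fderiv ℝ (extChartAt I' (F p) ∘ F ∘ (extChartAt I p).symm)
      (extChartAt I p p) := by
    rw [(hF.mdifferentiableAt (by simp)).mfderiv, ModelWithCorners.Boundaryless.range_eq_univ,
      fderivWithin_univ]
    rfl
  rw [OneForm.d_eq_formD, OneForm.d_eq_formD, h1, ← h0]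
  have h2 := (OneForm.inChart_pullback_eventuallyEq F α p hF).fderiv_eq (𝕜 := ℝ)
  have h3 : ∀ v w : E, formD ((α.pullback (I := I) F).inChart I p) (extChartAt I p p) v w =
      formD (fun y => (α.inChart I' (F p) ((extChartAt I' (F p) ∘ F ∘ (extChartAt I p).symm) y)).comp
        (fderiv ℝ (extChartAt I' (F p) ∘ F ∘ (extChartAt I p).symm) y)) (extChartAt I p p) v w :=
    fun v w => by unfold formD; rw [h2]
  refine (h3 v w).trans ?_
  exact formD_pullback (by rw [h0]; exact hα) hψ v w

/-- A smooth `1`-form is smooth in charts. -/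
theorem IsSmoothOneForm.contDiffOn_inChart [FiniteDimensional ℝ E] {α : OneForm I M}
    (hα : IsSmoothOneForm I α) (p : M) :
    ContDiffOn ℝ ∞ (α.inChart I p) (extChartAt I p).target := by
  have ho : IsOpen (extChartAt I p).target := isOpen_extChartAt_target p
  rw [contDiffOn_clm_apply]
  intro v
  rw [← contMDiffOn_iff_contDiffOn]
  have h1 : ContMDiffOn 𝓘(ℝ, E).tangent I.tangent ∞
      (tangentMapWithin 𝓘(ℝ, E) I (extChartAt I p).symm (extChartAt I p).target) _ :=
    (contMDiffOn_extChartAt_symm (I := I) (n := ∞) p).contMDiffOn_tangentMapWithin (m := ∞)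
      (by simp) ho.uniqueMDiffOn
  have h2 : ContMDiff 𝓘(ℝ, E) 𝓘(ℝ, E).tangent ∞
      (fun y : E => (⟨y, v⟩ : TangentBundle 𝓘(ℝ, E) E)) := fun y =>
    contMDiffAt_vectorSpace_iff_contDiffAt.2 contDiffAt_const
  have h3 := (hα.contMDiffOn (s := univ)).comp
    (h1.comp h2.contMDiffOn (fun y hy => hy)) (fun _ _ => mem_univ _)
  refine h3.congr fun y hy => ?_
  have h4 : mfderivWithin 𝓘(ℝ, E) I (extChartAt I p).symm (extChartAt I p).target y =
      mfderiv 𝓘(ℝ, E) I (extChartAt I p).symm y :=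
    mfderivWithin_of_isOpen ho hy
  change _ = α ((extChartAt I p).symm y)
    (mfderivWithin 𝓘(ℝ, E) I (extChartAt I p).symm (extChartAt I p).target y v)
  rw [h4]
  rfl

theorem IsSmoothOneForm.differentiableAt_inChart [FiniteDimensional ℝ E] {α : OneForm I M}
    (hα : IsSmoothOneForm I α) (p : M) :
    DifferentiableAt ℝ (α.inChart I p) (extChartAt I p p) :=
  ((hα.contDiffOn_inChart p).contDiffAt (extChartAt_target_mem_nhds p)).differentiableAt (by simp)

end Forms

/-! ### Differentials of functions; sums and multiples of forms. -/

section Forms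

variable {E H M : Type*} [NormedAddCommGroup E] [NormedSpace ℝ E] [TopologicalSpace H]
  {I : ModelWithCorners ℝ E H} [TopologicalSpace M] [ChartedSpace H M]

/-- The differential of a function, as a `1`-form. -/
noncomputable def dFun (I : ModelWithCorners ℝ E H) (f : M → ℝ) : OneForm I M :=
  fun p => mfderiv I 𝓘(ℝ, ℝ) f p

theorem HasMFDerivAt.dFun_eq {f : M → ℝ} {p : M} {f' : TangentSpace I p →L[ℝ] ℝ}
    (h : HasMFDerivAt I 𝓘(ℝ, ℝ) f p f') : dFun I f p = f' := h.mfderiv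

theorem dFun_mul {f g : M → ℝ} {p : M} (hf : MDifferentiableAt I 𝓘(ℝ, ℝ) f p)
    (hg : MDifferentiableAt I 𝓘(ℝ, ℝ) g p) (v : TangentSpace I p) :
    dFun I (fun q => f q * g q) p v = f p * dFun I g p v + g p * dFun I f p v := by
  have := (hf.hasMFDerivAt.mul hg.hasMFDerivAt).mfderiv
  exact congrArg (fun L : TangentSpace I p →L[ℝ] ℝ => L v) this

theorem dFun_add {f g : M → ℝ} {p : M} (hf : MDifferentiableAt I 𝓘(ℝ, ℝ) f p)
    (hg : MDifferentiableAt I 𝓘(ℝ, ℝ) g p) (v : TangentSpace I p) :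
    dFun I (fun q => f q + g q) p v = dFun I f p v + dFun I g p v := by
  have := (hf.hasMFDerivAt.add hg.hasMFDerivAt).mfderiv
  exact congrArg (fun L : TangentSpace I p →L[ℝ] ℝ => L v) this

theorem dFun_sub {f g : M → ℝ} {p : M} (hf : MDifferentiableAt I 𝓘(ℝ, ℝ) f p)
    (hg : MDifferentiableAt I 𝓘(ℝ, ℝ) g p) (v : TangentSpace I p) :
    dFun I (fun q => f q - g q) p v = dFun I f p v - dFun I g p v := by
  have := (hf.hasMFDerivAt.sub hg.hasMFDerivAt).mfderiv
  exact congrArg (fun L : TangentSpace I p →L[ℝ] ℝ => L v) this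

theorem dFun_neg (f : M → ℝ) (p : M) (v : TangentSpace I p) :
    dFun I (fun q => -f q) p v = -dFun I f p v := by
  have := mfderiv_neg (I := I) (f := f) (x := p)
  exact congrArg (fun L : TangentSpace I p →L[ℝ] ℝ => L v) this

theorem dFun_const (c : ℝ) (p : M) (v : TangentSpace I p) :
    dFun I (fun _ => c) p v = 0 := by
  have := mfderiv_const (I := I) (I' := 𝓘(ℝ, ℝ)) (c := c) (x := p)
  exact congrArg (fun L : TangentSpace I p →L[ℝ] ℝ => L v) this

theorem dFun_comp {f : M → ℝ} {p : M} {g : ℝ → ℝ} {g' : ℝ} (hg : HasDerivAt g g' (f p))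
    (hf : MDifferentiableAt I 𝓘(ℝ, ℝ) f p) (v : TangentSpace I p) :
    dFun I (fun q => g (f q)) p v = g' * dFun I f p v := by
  have := (hg.hasFDerivAt.hasMFDerivAt.comp p hf.hasMFDerivAt).mfderiv
  refine (congrArg (fun L : TangentSpace I p →L[ℝ] ℝ => L v) this).trans ?_
  change (ContinuousLinearMap.toSpanSingleton ℝ g') (dFun I f p v) = _
  rw [ContinuousLinearMap.toSpanSingleton_apply, smul_eq_mul, mul_comm]

variable [IsManifold I ∞ M]
  {E' H' N : Type*} [NormedAddCommGroup E'] [NormedSpace ℝ E'] [TopologicalSpace H']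
  {I' : ModelWithCorners ℝ E' H'} [TopologicalSpace N] [ChartedSpace H' N]
  [IsManifold I' ∞ N]

theorem isSmoothOneForm_dFun {f : M → ℝ} (hf : ContMDiff I 𝓘(ℝ, ℝ) ∞ f) :
    IsSmoothOneForm I (dFun I f) :=
  (contMDiff_snd_tangentBundle_modelSpace ℝ 𝓘(ℝ, ℝ)).comp (hf.contMDiff_tangentMap (by simp))

theorem IsSmoothOneForm.apply {α : OneForm I M} (hα : IsSmoothOneForm I α)
    {X : (p : M) → TangentSpace I p} (hX : IsSmoothVectorField I X) :
    ContMDiff I 𝓘(ℝ, ℝ) ∞ (fun p => α p (X p)) :=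
  ContMDiff.comp hα hX

theorem IsSmoothOneForm.pullback {α : OneForm I' N} (hα : IsSmoothOneForm I' α) {F : M → N}
    (hF : ContMDiff I I' ∞ F) : IsSmoothOneForm I (α.pullback (I := I) F) :=
  ContMDiff.comp hα (hF.contMDiff_tangentMap (by simp))

theorem IsSmoothOneForm.smul {α : OneForm I M} (hα : IsSmoothOneForm I α) {f : M → ℝ}
    (hf : ContMDiff I 𝓘(ℝ, ℝ) ∞ f) : IsSmoothOneForm I (fun p => f p • α p) :=
  ContMDiff.mul (hf.comp (Bundle.contMDiff_proj (TangentSpace I))) hα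

theorem IsSmoothOneForm.add {α β : OneForm I M} (hα : IsSmoothOneForm I α)
    (hβ : IsSmoothOneForm I β) : IsSmoothOneForm I (fun p => α p + β p) :=
  ContMDiff.add hα hβ

theorem contMDiff_dFun_apply {f : M → ℝ} (hf : ContMDiff I 𝓘(ℝ, ℝ) ∞ f)
    {X : (p : M) → TangentSpace I p} (hX : IsSmoothVectorField I X) :
    ContMDiff I 𝓘(ℝ, ℝ) ∞ (fun p => dFun I f p (X p)) :=
  (isSmoothOneForm_dFun hf).apply hX

section

omit [IsManifold I ∞ M]

theorem OneForm.d_add_left (α : OneForm I M) (p : M) (v v' w : TangentSpace I p) :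
    α.d I p (v + v') w = α.d I p v w + α.d I p v' w := by
  have h : ∀ (A : E →L[ℝ] E →L[ℝ] ℝ) (L : E →L[ℝ] E) (v v' w : E),
      A (L (v + v')) (L w) - A (L w) (L (v + v')) =
        (A (L v) (L w) - A (L w) (L v)) + (A (L v') (L w) - A (L w) (L v')) := by
    intro A L v v' w; simp; ring
  exact h _ (mfderiv I 𝓘(ℝ, E) (extChartAt I p) p) v v' w

theorem OneForm.d_smul_left (α : OneForm I M) (p : M) (c : ℝ) (v w : TangentSpace I p) :
    α.d I p (c • v) w = c * α.d I p v w := by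
  have h : ∀ (A : E →L[ℝ] E →L[ℝ] ℝ) (L : E →L[ℝ] E) (v w : E),
      A (L (c • v)) (L w) - A (L w) (L (c • v)) = c * (A (L v) (L w) - A (L w) (L v)) := by
    intro A L v w; simp; ring
  exact h _ (mfderiv I 𝓘(ℝ, E) (extChartAt I p) p) v w

theorem OneForm.d_skew (α : OneForm I M) (p : M) (v w : TangentSpace I p) :
    α.d I p v w = -α.d I p w v := by
  simp only [OneForm.d]; ring

theorem OneForm.d_add_right (α : OneForm I M) (p : M) (v w w' : TangentSpace I p) :
    α.d I p v (w + w') = α.d I p v w + α.d I p v w' := by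
  rw [α.d_skew, α.d_add_left, α.d_skew p w, α.d_skew p w']; ring

theorem OneForm.d_smul_right (α : OneForm I M) (p : M) (c : ℝ) (v w : TangentSpace I p) :
    α.d I p v (c • w) = c * α.d I p v w := by
  rw [α.d_skew, α.d_smul_left, α.d_skew p w]; ring

/-- The exterior derivative at a point as a bilinear map. -/
noncomputable def OneForm.dLin (α : OneForm I M) (p : M) :
    TangentSpace I p →ₗ[ℝ] TangentSpace I p →ₗ[ℝ] ℝ :=
  LinearMap.mk₂ ℝ (α.d I p) (α.d_add_left p) (α.d_smul_left p) (α.d_add_right p)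
    (α.d_smul_right p)

end

variable [I.Boundaryless]

theorem OneForm.inChart_self (α : OneForm I M) (p : M) :
    α.inChart I p (extChartAt I p p) = α p := by
  have h1 : mfderiv 𝓘(ℝ, E) I (extChartAt I p).symm (extChartAt I p p) =
      ContinuousLinearMap.id ℝ _ := by
    rw [← mfderivWithin_range_extChartAt_symm, ModelWithCorners.Boundaryless.range_eq_univ,
      mfderivWithin_univ]
  have h2 : (α ((extChartAt I p).symm (extChartAt I p p)) : E →L[ℝ] ℝ) = (α p : E →L[ℝ] ℝ) := by
    rw [extChartAt_to_inv]
  unfold OneForm.inChart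
  rw [h1]
  exact h2

omit [IsManifold I ∞ M] in
theorem differentiableAt_comp_extChartAt_symm {f : M → ℝ} {p : M}
    (hf : MDifferentiableAt I 𝓘(ℝ, ℝ) f p) :
    DifferentiableAt ℝ (f ∘ (extChartAt I p).symm) (extChartAt I p p) := by
  have := hf.differentiableWithinAt_writtenInExtChartAt
  rw [ModelWithCorners.Boundaryless.range_eq_univ, differentiableWithinAt_univ] at this
  exact this

omit [IsManifold I ∞ M] in
theorem dFun_eq_fderiv {f : M → ℝ} {p : M} (hf : MDifferentiableAt I 𝓘(ℝ, ℝ) f p) :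
    dFun I f p = fderiv ℝ (f ∘ (extChartAt I p).symm) (extChartAt I p p) := by
  unfold dFun
  rw [hf.mfderiv, ModelWithCorners.Boundaryless.range_eq_univ, fderivWithin_univ]
  rfl

theorem OneForm.d_smul {α : OneForm I M} {f : M → ℝ} {p : M}
    (hα : DifferentiableAt ℝ (α.inChart I p) (extChartAt I p p))
    (hf : MDifferentiableAt I 𝓘(ℝ, ℝ) f p) (v w : TangentSpace I p) :
    OneForm.d I (fun q => f q • α q : OneForm I M) p v w =
      f p * α.d I p v w + (dFun I f p v * α p w - dFun I f p w * α p v) := by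
  have h1 : OneForm.inChart I (fun q => f q • α q : OneForm I M) p =
      fun y => (f ∘ (extChartAt I p).symm) y • α.inChart I p y := by
    funext y
    exact ContinuousLinearMap.smul_comp _ _ _
  have h2 := differentiableAt_comp_extChartAt_symm hf
  rw [OneForm.d_eq_formD, OneForm.d_eq_formD, h1, dFun_eq_fderiv hf, ← α.inChart_self]
  unfold formD
  rw [fderiv_fun_smul h2 hα]
  have h6 : (f ∘ (extChartAt I p).symm) (extChartAt I p p) = f p := by simp
  rw [h6]
  have h : ∀ (A : E →L[ℝ] E →L[ℝ] ℝ) (g θ : E →L[ℝ] ℝ) (v w : E),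
      (f p • A + g.smulRight θ) v w - (f p • A + g.smulRight θ) w v =
        f p * (A v w - A w v) + (g v * θ w - g w * θ v) := by
    intro A g θ v w; simp; ring
  exact h _ _ _ v w

theorem OneForm.d_add {α β : OneForm I M} {p : M}
    (hα : DifferentiableAt ℝ (α.inChart I p) (extChartAt I p p))
    (hβ : DifferentiableAt ℝ (β.inChart I p) (extChartAt I p p)) (v w : TangentSpace I p) :
    OneForm.d I (fun q => α q + β q : OneForm I M) p v w = α.d I p v w + β.d I p v w := by
  have h1 : OneForm.inChart I (fun q => α q + β q : OneForm I M) p =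
      fun y => α.inChart I p y + β.inChart I p y := by
    funext y
    exact ContinuousLinearMap.add_comp _ _ _
  rw [OneForm.d_eq_formD, OneForm.d_eq_formD, OneForm.d_eq_formD, h1]
  unfold formD
  rw [fderiv_fun_add hα hβ]
  have h : ∀ (A B : E →L[ℝ] E →L[ℝ] ℝ) (v w : E),
      (A + B) v w - (A + B) w v = (A v w - A w v) + (B v w - B w v) := by
    intro A B v w; simp; ring
  exact h _ _ v w

theorem OneForm.inChart_modelSpace {F : Type*} [NormedAddCommGroup F] [NormedSpace ℝ F]
    (α : OneForm 𝓘(ℝ, F) F) (p y : F) : α.inChart 𝓘(ℝ, F) p y = α y := by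
  have h : ∀ e : PartialEquiv F F, e = PartialEquiv.refl F →
      ((α (e.symm y)).comp (mfderiv 𝓘(ℝ, F) 𝓘(ℝ, F) e.symm y) : F →L[ℝ] ℝ) = α y := by
    rintro _ rfl
    have h1 : mfderiv 𝓘(ℝ, F) 𝓘(ℝ, F) (PartialEquiv.refl F).symm y =
        ContinuousLinearMap.id ℝ _ := mfderiv_id
    have h2 : (mfderiv 𝓘(ℝ, F) 𝓘(ℝ, F) (PartialEquiv.refl F).symm y : F →L[ℝ] F) =
      ContinuousLinearMap.id ℝ F := h1
    ext v
    exact congrArg (α y) (congrArg (fun L : F →L[ℝ] F => L v) h2)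
  exact h _ (extChartAt_model_space_eq_id ℝ p)

/-- `df` is the pullback under `f` of the form `dt` on the line, whose coefficient is constant. -/
theorem OneForm.d_dFun {f : M → ℝ} {p : M} (hf : ContMDiffAt I 𝓘(ℝ, ℝ) ∞ f p)
    (v w : TangentSpace I p) : (dFun I f).d I p v w = 0 := by
  let α : OneForm 𝓘(ℝ, ℝ) ℝ := fun _ => ContinuousLinearMap.id ℝ ℝ
  have h1 : α.inChart 𝓘(ℝ, ℝ) (f p) = fun _ => ContinuousLinearMap.id ℝ ℝ := by
    funext y
    exact OneForm.inChart_modelSpace α (f p) y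
  have h2 : dFun I f = α.pullback (I := I) f := rfl
  rw [h2, OneForm.d_pullback (by rw [h1]; exact differentiableAt_const _) hf,
    OneForm.d_eq_formD, h1]
  unfold formD
  have h3 : fderiv ℝ (fun _ : ℝ => ContinuousLinearMap.id ℝ ℝ)
    (extChartAt 𝓘(ℝ, ℝ) (f p) (f p)) = 0 := fderiv_const_apply _
  rw [h3]
  exact sub_self _

/-- The exterior derivative computed in the preferred chart of a nearby point. -/
theorem OneForm.d_eq_formD_of_mem [FiniteDimensional ℝ E] {α : OneForm I M}
    (hα : IsSmoothOneForm I α) (p₀ p : M) (hp : p ∈ (extChartAt I p₀).source)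
    (v w : TangentSpace I p) :
    α.d I p v w = formD (α.inChart I p₀) (extChartAt I p₀ p)
      (mfderiv I 𝓘(ℝ, E) (extChartAt I p₀) p v) (mfderiv I 𝓘(ℝ, E) (extChartAt I p₀) p w) := by
  have hy : extChartAt I p₀ p ∈ (extChartAt I p₀).target := (extChartAt I p₀).map_source hp
  have hsm : ContMDiffAt 𝓘(ℝ, E) I ∞ (extChartAt I p₀).symm (extChartAt I p₀ p) :=
    (contMDiffOn_extChartAt_symm (I := I) (n := ∞) p₀).contMDiffAt
      ((isOpen_extChartAt_target p₀).mem_nhds hy)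
  have hinv : (extChartAt I p₀).symm (extChartAt I p₀ p) = p := (extChartAt I p₀).left_inv hp
  -- Pull back by the inverse of the chart at `p₀`; on the model space `d` is computed in the
  -- identity chart, so the result is the coordinate formula at any point of the chart.
  have key := OneForm.d_pullback (I := 𝓘(ℝ, E)) (α := α) (hα.differentiableAt_inChart _) hsm
    (mfderiv I 𝓘(ℝ, E) (extChartAt I p₀) p v) (mfderiv I 𝓘(ℝ, E) (extChartAt I p₀) p w)
  have h1 : OneForm.d 𝓘(ℝ, E) (α.pullback (I := 𝓘(ℝ, E)) (extChartAt I p₀).symm)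
      (extChartAt I p₀ p) = formD (α.inChart I p₀) (extChartAt I p₀ p) := by
    funext a b
    rw [OneForm.d_eq_formD]
    have e1 : OneForm.inChart 𝓘(ℝ, E) (α.pullback (I := 𝓘(ℝ, E)) (extChartAt I p₀).symm)
        (extChartAt I p₀ p) = α.inChart I p₀ := by
      funext y
      exact OneForm.inChart_modelSpace _ _ y
    rw [e1]
    simp only [extChartAt_model_space_eq_id, PartialEquiv.refl_coe, id]
  rw [h1] at key
  refine Eq.trans ?_ key.symm
  have h2 : ∀ u : TangentSpace I p, (mfderiv 𝓘(ℝ, E) I (extChartAt I p₀).symm (extChartAt I p₀ p)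
      (mfderiv I 𝓘(ℝ, E) (extChartAt I p₀) p u) : E) = u := by
    intro u
    have h3 := mfderivWithin_extChartAt_symm_comp_mfderiv_extChartAt' (I := I) (x := p₀) hp
    rw [ModelWithCorners.Boundaryless.range_eq_univ, mfderivWithin_univ] at h3
    exact congrArg (fun L : E →L[ℝ] E => L u) h3
  have h4 : ∀ q, q = p → ∀ a b : E, (a : TangentSpace I p) = v → (b : TangentSpace I p) = w →
      α.d I p v w = α.d I q a b := by
    rintro q rfl a b rfl rfl; rfl
  exact h4 _ hinv _ _ (h2 v) (h2 w)

end Forms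

/-! ### Smooth coefficients, and forms defining the same hyperplane field. -/

section Forms

variable {E H M : Type*} [NormedAddCommGroup E] [NormedSpace ℝ E] [TopologicalSpace H]
  {I : ModelWithCorners ℝ E H} [TopologicalSpace M] [ChartedSpace H M] [IsManifold I ∞ M]
  [I.Boundaryless]

/-- The coordinate vector fields of a chart are smooth. -/
theorem contMDiffOn_extChartAt_symm_vector (p : M) (z : E) :
    ContMDiffOn 𝓘(ℝ, E) I.tangent ∞ (fun y => (⟨(extChartAt I p).symm y,
      mfderiv 𝓘(ℝ, E) I (extChartAt I p).symm y z⟩ : TangentBundle I M))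
      (extChartAt I p).target := by
  have ho : IsOpen (extChartAt I p).target := isOpen_extChartAt_target p
  have h1 : ContMDiffOn 𝓘(ℝ, E).tangent I.tangent ∞
      (tangentMapWithin 𝓘(ℝ, E) I (extChartAt I p).symm (extChartAt I p).target) _ :=
    (contMDiffOn_extChartAt_symm (I := I) (n := ∞) p).contMDiffOn_tangentMapWithin (m := ∞)
      (by simp) ho.uniqueMDiffOn
  have h2 : ContMDiff 𝓘(ℝ, E) 𝓘(ℝ, E).tangent ∞
      (fun y : E => (⟨y, z⟩ : TangentBundle 𝓘(ℝ, E) E)) := fun y =>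
    contMDiffAt_vectorSpace_iff_contDiffAt.2 contDiffAt_const
  refine (h1.comp h2.contMDiffOn (fun y hy => hy)).congr fun y hy => ?_
  have h4 : mfderivWithin 𝓘(ℝ, E) I (extChartAt I p).symm (extChartAt I p).target y =
      mfderiv 𝓘(ℝ, E) I (extChartAt I p).symm y :=
    mfderivWithin_of_isOpen ho hy
  change _ = (⟨(extChartAt I p).symm y,
    mfderivWithin 𝓘(ℝ, E) I (extChartAt I p).symm (extChartAt I p).target y z⟩ : TangentBundle I M)
  rw [h4]

omit [I.Boundaryless] in
/-- The differential of a chart is smooth. -/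
theorem contMDiffAt_mfderiv_extChartAt (p : M) (V : TangentBundle I M) (hV : V.1 = p) :
    ContMDiffAt I.tangent 𝓘(ℝ, E) ∞ (fun W : TangentBundle I M =>
      (mfderiv I 𝓘(ℝ, E) (extChartAt I p) W.1 W.2 : E)) V := by
  have ho : IsOpen (chartAt H p).source := (chartAt H p).open_source
  have h1 : ContMDiffOn I.tangent 𝓘(ℝ, E).tangent ∞
      (tangentMapWithin I 𝓘(ℝ, E) (extChartAt I p) (chartAt H p).source) _ :=
    (contMDiffOn_extChartAt (I := I) (n := ∞) (x := p)).contMDiffOn_tangentMapWithin (m := ∞)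
      (by simp) ho.uniqueMDiffOn
  have hmem : (Bundle.TotalSpace.proj : TangentBundle I M → M) ⁻¹' (chartAt H p).source ∈ 𝓝 V := by
    refine (Bundle.contMDiff_proj (n := ∞) (IB := I) (TangentSpace I (M := M))).continuous.continuousAt
      (ho.mem_nhds ?_)
    rw [hV]; exact mem_chart_source H p
  have h2 := (contMDiff_snd_tangentBundle_modelSpace (n := ∞) E 𝓘(ℝ, E)).contMDiffAt.comp V
    (h1.contMDiffAt hmem)
  refine h2.congr_of_eventuallyEq ?_
  filter_upwards [hmem] with W hW
  have h4 : mfderivWithin I 𝓘(ℝ, E) (extChartAt I p) (chartAt H p).source W.1 =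
      mfderiv I 𝓘(ℝ, E) (extChartAt I p) W.1 := mfderivWithin_of_isOpen ho hW
  change _ = mfderivWithin I 𝓘(ℝ, E) (extChartAt I p) (chartAt H p).source W.1 W.2
  rw [h4]

/-- The coefficient of proportionality of two smooth forms is smooth. -/
theorem contMDiff_of_eq_mul {β : OneForm I M} (hβ : IsSmoothOneForm I β) (hβ0 : ∀ p, β p ≠ 0)
    {θ : (p : M) → TangentSpace I p → ℝ}
    (hθ : ContMDiff I.tangent 𝓘(ℝ, ℝ) ∞ (fun V : TangentBundle I M => θ V.1 V.2)) {k : M → ℝ}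
    (hk : ∀ p v, θ p v = k p * β p v) : ContMDiff I 𝓘(ℝ, ℝ) ∞ k := by
  intro p
  have hy : extChartAt I p p ∈ (extChartAt I p).target := mem_extChartAt_target p
  have hmem := extChartAt_target_mem_nhds (I := I) p
  -- A coordinate vector field not annihilated by `β` at `p` stays so nearby, and there `k` is a
  -- quotient of two smooth functions.
  obtain ⟨z, hz⟩ : ∃ z : E, β.inChart I p (extChartAt I p p) z ≠ 0 := by
    by_contra! hcon
    refine hβ0 p ?_
    rw [← β.inChart_self]
    exact ContinuousLinearMap.ext hcon
  have hs := (contMDiffOn_extChartAt_symm_vector p z).contMDiffAt hmem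
  have h1 : ContMDiffAt 𝓘(ℝ, E) 𝓘(ℝ, ℝ) ∞ (fun y => θ ((extChartAt I p).symm y)
      (mfderiv 𝓘(ℝ, E) I (extChartAt I p).symm y z)) (extChartAt I p p) :=
    ContMDiffAt.comp _ hθ.contMDiffAt hs
  have h2 : ContMDiffAt 𝓘(ℝ, E) 𝓘(ℝ, ℝ) ∞ (fun y => β.inChart I p y z) (extChartAt I p p) :=
    ContMDiffAt.comp _ (ContMDiff.contMDiffAt hβ) hs
  have h3 : ContDiffAt ℝ ∞ (k ∘ (extChartAt I p).symm) (extChartAt I p p) := by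
    refine (h1.contDiffAt.div h2.contDiffAt hz).congr_of_eventuallyEq ?_
    filter_upwards [h2.continuousAt.eventually_ne hz] with y hy
    refine (mul_div_cancel_right₀ (k ((extChartAt I p).symm y)) hy).symm.trans ?_
    exact congrArg (· / β.inChart I p y z) (hk _ _).symm
  have h4 : ContMDiffAt I 𝓘(ℝ, E) ∞ (extChartAt I p) p := contMDiffAt_extChartAt
  have h5 := h3.contMDiffAt.comp p h4
  refine h5.congr_of_eventuallyEq ?_
  filter_upwards [extChartAt_source_mem_nhds (I := I) p] with q hq
  simp only [Function.comp_apply]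
  rw [(extChartAt I p).left_inv hq]

/-- The contraction of the exterior derivative of a smooth form with a smooth vector field is
smooth. -/
theorem IsSmoothOneForm.contMDiff_contract_d [FiniteDimensional ℝ E] {α : OneForm I M}
    (hα : IsSmoothOneForm I α) {X : (p : M) → TangentSpace I p} (hX : IsSmoothVectorField I X) :
    ContMDiff I.tangent 𝓘(ℝ, ℝ) ∞ (fun V : TangentBundle I M => α.d I V.1 (X V.1) V.2) := by
  intro V
  set p := V.1 with hp
  have hπ : ContMDiffAt I.tangent I ∞ (Bundle.TotalSpace.proj : TangentBundle I M → M) V :=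
    (Bundle.contMDiff_proj (TangentSpace I (M := M))).contMDiffAt
  have h1 := contMDiffAt_mfderiv_extChartAt p V rfl
  have h2 : ContMDiffAt I 𝓘(ℝ, E) ∞
      (fun q => (mfderiv I 𝓘(ℝ, E) (extChartAt I p) q (X q) : E)) p :=
    ContMDiffAt.comp p (contMDiffAt_mfderiv_extChartAt p ⟨p, X p⟩ rfl) hX.contMDiffAt
  have h3 := ContMDiffAt.comp V (h2 : ContMDiffAt I 𝓘(ℝ, E) ∞ _ (Bundle.TotalSpace.proj V)) hπ
  have h4 : ContDiffAt ℝ ∞ (fderiv ℝ (α.inChart I p)) (extChartAt I p p) :=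
    ((hα.contDiffOn_inChart p).contDiffAt (extChartAt_target_mem_nhds p)).fderiv_right (by simp)
  have h5 : ContMDiffAt I 𝓘(ℝ, E) ∞ (extChartAt I p) p := contMDiffAt_extChartAt
  have h6 := ContMDiffAt.comp p h4.contMDiffAt h5
  have h7 := ContMDiffAt.comp V (h6 : ContMDiffAt I 𝓘(ℝ, E →L[ℝ] E →L[ℝ] ℝ) ∞ _ (Bundle.TotalSpace.proj V)) hπ
  have h8 := ((h7.clm_apply h3).clm_apply h1).sub ((h7.clm_apply h1).clm_apply h3)
  refine h8.congr_of_eventuallyEq ?_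
  -- The definition of `d` changes chart with the base point; smoothness becomes visible once all
  -- nearby points use the chart at `p`.
  filter_upwards [hπ.continuousAt (extChartAt_source_mem_nhds (I := I) p)] with W hW
  exact OneForm.d_eq_formD_of_mem hα p W.1 hW _ _

/-- Two functionals with comparable kernels are proportional. -/
theorem ContinuousLinearMap.exists_eq_mul_of_ker_le {T : Type*} [AddCommGroup T] [Module ℝ T]
    [TopologicalSpace T] {a : T →L[ℝ] ℝ} (ha : a ≠ 0) {θ : T →ₗ[ℝ] ℝ}
    (h : ∀ v, a v = 0 → θ v = 0) : ∃ k : ℝ, ∀ v, θ v = k * a v := by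
  obtain ⟨z, hz⟩ : ∃ z, a z ≠ 0 := by
    by_contra! hcon
    exact ha (ContinuousLinearMap.ext hcon)
  refine ⟨θ z / a z, fun v => ?_⟩
  have h1 := h (v - (a v / a z) • z) (by simp [hz])
  rw [map_sub, map_smul, sub_eq_zero, smul_eq_mul] at h1
  rw [h1]; ring

/-- Two forms that define the same cooriented hyperplane field differ by a positive smooth
factor. -/
theorem CoorientedHyperplaneField.DefinedBy.exists_eq_smul {η : CoorientedHyperplaneField I M}
    {α α' : OneForm I M} (hα : η.DefinedBy α) (hα' : η.DefinedBy α') :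
    ∃ f : M → ℝ, ContMDiff I 𝓘(ℝ, ℝ) ∞ f ∧ (∀ p, 0 < f p) ∧ ∀ p, α' p = f p • α p := by
  have h : ∀ p, ∃ k : ℝ, ∀ v, α' p v = k * α p v := fun p =>
    ContinuousLinearMap.exists_eq_mul_of_ker_le (θ := (α' p : TangentSpace I p →ₗ[ℝ] ℝ))
      (hα.2 p).1 fun v hv => ((hα'.2 p).2.1 v).1 (((hα.2 p).2.1 v).2 hv)
  choose f hf using h
  refine ⟨f, contMDiff_of_eq_mul hα.1 (fun p => (hα.2 p).1)
    (θ := fun p v => α' p v) hα'.1 hf, fun p => ?_,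
    fun p => ContinuousLinearMap.ext (hf p)⟩
  obtain ⟨z, hz⟩ : ∃ z, 0 < α p z := by
    by_contra! hcon
    refine (hα.2 p).1 (ContinuousLinearMap.ext fun v => le_antisymm (hcon v) ?_)
    have := hcon (-v)
    rw [map_neg] at this
    simpa using this
  have h1 := ((hα'.2 p).2.2 z).1 (((hα.2 p).2.2 z).2 hz)
  rw [hf] at h1
  exact pos_of_mul_pos_left h1 hz.le

omit [I.Boundaryless] in
theorem CoorientedHyperplaneField.DefinedBy.smul {η : CoorientedHyperplaneField I M}
    {α : OneForm I M} (hα : η.DefinedBy α) {f : M → ℝ} (hf : ContMDiff I 𝓘(ℝ, ℝ) ∞ f)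
    (hpos : ∀ p, 0 < f p) : η.DefinedBy (fun p => f p • α p) := by
  refine ⟨hα.1.smul hf, fun p => ⟨?_, fun v => ?_, fun v => ?_⟩⟩
  · exact smul_ne_zero (hpos p).ne' (hα.2 p).1
  · rw [(hα.2 p).2.1]
    exact (mul_eq_zero_iff_left (hpos p).ne').symm
  · rw [(hα.2 p).2.2]
    exact (mul_pos_iff_of_pos_left (hpos p)).symm

/-- How `α ∧ (dα) ^ m` changes if `α` is multiplied by a function. -/
theorem OneForm.contactVolume_smul [FiniteDimensional ℝ E] {α : OneForm I M}
    (hα : IsSmoothOneForm I α) {f : M → ℝ} (hf : ContMDiff I 𝓘(ℝ, ℝ) ∞ f) (m : ℕ) {p : M}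
    (hp : f p ≠ 0) (v : Fin (2 * m + 1) → TangentSpace I p) :
    OneForm.contactVolume I (fun q => f q • α q : OneForm I M) m p v =
      f p ^ (m + 1) * α.contactVolume I m p v := by
  have h := oneFormWedgePower_rescale (a := (α p : TangentSpace I p →ₗ[ℝ] ℝ)) (Ω := α.dLin p)
    (α.d_skew p) (dFun I f p : TangentSpace I p →ₗ[ℝ] ℝ) hp m v
  refine Eq.trans ?_ h
  unfold OneForm.contactVolume
  congr 1
  funext u v
  exact OneForm.d_smul (hα.differentiableAt_inChart p)
    (hf.mdifferentiable (by simp) p) u v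

/-- Another defining form differs by a positive factor `f`, which multiplies the volume by `f ^ (d +
1) > 0`. The orientation can thus be tested on any one form. -/
theorem CoorientedHyperplaneField.DefinedBy.isPositiveBasis_iff [FiniteDimensional ℝ E]
    {ξ : CoorientedHyperplaneField I M} {β : OneForm I M} (hβ : ξ.DefinedBy β) (d : ℕ) (p : M)
    (v : Fin (2 * d + 1) → TangentSpace I p) :
    ξ.IsPositiveBasis d p v ↔ 0 < β.contactVolume I d p v := by
  refine ⟨?_, fun h => ⟨β, hβ, h⟩⟩
  rintro ⟨α, hα, h⟩
  obtain ⟨f, hf, hpos, hfα⟩ := hα.exists_eq_smul hβ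
  obtain rfl : β = fun q => f q • α q := funext hfα
  rw [OneForm.contactVolume_smul hα.1 hf d (hpos p).ne']
  exact mul_pos (pow_pos (hpos p) _) h

end Forms

/-! ## Contact vector fields -/

section ContactVectorFields

variable {E H M : Type*} [NormedAddCommGroup E] [NormedSpace ℝ E] [TopologicalSpace H]
  {I : ModelWithCorners ℝ E H} [TopologicalSpace M] [ChartedSpace H M]

/-- The Lie derivative `L_X β = dβ (X, ·) + d (β (X))`. -/
noncomputable def lieForm (β : OneForm I M) (X : (p : M) → TangentSpace I p) (p : M)
    (u : TangentSpace I p) : ℝ :=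
  β.d I p (X p) u + dFun I (fun q => β q (X q)) p u

/-- The function `-β ([X, Y])`. -/
noncomputable def bracketTerm (β : OneForm I M) (X Y : (p : M) → TangentSpace I p) (p : M) : ℝ :=
  β.d I p (X p) (Y p) + dFun I (fun q => β q (X q)) p (Y p) - dFun I (fun q => β q (Y q)) p (X p)

theorem lieForm_self (β : OneForm I M) (X : (p : M) → TangentSpace I p) (p : M) :
    lieForm β X p (X p) = dFun I (fun q => β q (X q)) p (X p) := by
  have := β.d_skew p (X p) (X p)
  unfold lieForm
  linarith

variable [IsManifold I ∞ M] [I.Boundaryless] [FiniteDimensional ℝ E]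

/-- In `d(fβ)(X, u)` the term `-df(u) β(X)` cancels against the one from differentiating `f β(X)`.
Hence rescaling changes the conformal factor `k` of `X` into `k + X(f)/f`. -/
theorem lieForm_smul {β : OneForm I M} (hβ : IsSmoothOneForm I β)
    {X : (p : M) → TangentSpace I p} (hX : IsSmoothVectorField I X) {f : M → ℝ}
    (hf : ContMDiff I 𝓘(ℝ, ℝ) ∞ f) (p : M) (u : TangentSpace I p) :
    lieForm (fun q => f q • β q) X p u = f p * lieForm β X p u + dFun I f p (X p) * β p u := by
  have h1 := dFun_mul (hf.mdifferentiable (by simp) p)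
    ((hβ.apply hX).mdifferentiable (by simp) p) u
  have h2 : dFun I (fun q => (f q • β q) (X q)) p u = dFun I (fun q => f q * β q (X q)) p u := rfl
  unfold lieForm
  rw [h2, h1, OneForm.d_smul (hβ.differentiableAt_inChart p) (hf.mdifferentiable (by simp) p)]
  ring

/-- All derivatives of `f` cancel, as they must for `-β([X, Y])`. This homogeneity is what lets the
bracket single out one contact form. -/
theorem bracketTerm_smul {β : OneForm I M} (hβ : IsSmoothOneForm I β)
    {X Y : (p : M) → TangentSpace I p} (hX : IsSmoothVectorField I X)
    (hY : IsSmoothVectorField I Y) {f : M → ℝ} (hf : ContMDiff I 𝓘(ℝ, ℝ) ∞ f) (p : M) :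
    bracketTerm (fun q => f q • β q) X Y p = f p * bracketTerm β X Y p := by
  have h1 := dFun_mul (hf.mdifferentiable (by simp) p)
    ((hβ.apply hX).mdifferentiable (by simp) p) (Y p)
  have h2 := dFun_mul (hf.mdifferentiable (by simp) p)
    ((hβ.apply hY).mdifferentiable (by simp) p) (X p)
  have h3 : dFun I (fun q => (f q • β q) (X q)) p (Y p) =
    dFun I (fun q => f q * β q (X q)) p (Y p) := rfl
  have h4 : dFun I (fun q => (f q • β q) (Y q)) p (X p) =
    dFun I (fun q => f q * β q (Y q)) p (X p) := rfl
  unfold bracketTerm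
  rw [h3, h4, h1, h2, OneForm.d_smul (hβ.differentiableAt_inChart p)
    (hf.mdifferentiable (by simp) p)]
  ring

theorem contMDiff_bracketTerm {β : OneForm I M} (hβ : IsSmoothOneForm I β)
    {X Y : (p : M) → TangentSpace I p} (hX : IsSmoothVectorField I X)
    (hY : IsSmoothVectorField I Y) : ContMDiff I 𝓘(ℝ, ℝ) ∞ (bracketTerm β X Y) :=
  ((ContMDiff.comp (hβ.contMDiff_contract_d hX) hY).add
    (contMDiff_dFun_apply (hβ.apply hX) hY)).sub (contMDiff_dFun_apply (hβ.apply hY) hX)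

/-- A vector field `X` preserving `ker β` satisfies `L_X β = k β` for a smooth function `k`. -/
theorem exists_lieForm_eq_mul {β : OneForm I M} (hβ : IsSmoothOneForm I β) (hβ0 : ∀ p, β p ≠ 0)
    {X : (p : M) → TangentSpace I p} (hX : IsSmoothVectorField I X)
    (h : ∀ p u, β p u = 0 → lieForm β X p u = 0) :
    ∃ k : M → ℝ, ContMDiff I 𝓘(ℝ, ℝ) ∞ k ∧ ∀ p u, lieForm β X p u = k p * β p u := by
  have h1 : ∀ p, ∃ k : ℝ, ∀ u, lieForm β X p u = k * β p u := fun p =>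
    ContinuousLinearMap.exists_eq_mul_of_ker_le (hβ0 p)
      (θ := β.dLin p (X p) + (dFun I (fun q => β q (X q)) p : TangentSpace I p →ₗ[ℝ] ℝ)) (h p)
  choose k hk using h1
  refine ⟨k, contMDiff_of_eq_mul hβ hβ0 (θ := lieForm β X) ?_ hk, hk⟩
  exact (hβ.contMDiff_contract_d hX).add (isSmoothOneForm_dFun (hβ.apply hX))

end ContactVectorFields

/-! ### Behaviour under diffeomorphisms preserving the fields. -/

section Naturality

variable {E M : Type*} [NormedAddCommGroup E] [NormedSpace ℝ E]
  [TopologicalSpace M] [ChartedSpace E M] [IsManifold 𝓘(ℝ, E) ∞ M]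

omit [IsManifold 𝓘(ℝ, E) ∞ M] in
theorem dFun_comp_map {f : M → ℝ} (hf : ContMDiff 𝓘(ℝ, E) 𝓘(ℝ, ℝ) ∞ f)
    (F : M ≃ₘ⟮𝓘(ℝ, E), 𝓘(ℝ, E)⟯ M) (p : M) (u : TangentSpace 𝓘(ℝ, E) p) :
    dFun 𝓘(ℝ, E) (fun q => f (F q)) p u =
      dFun 𝓘(ℝ, E) f (F p) (mfderiv 𝓘(ℝ, E) 𝓘(ℝ, E) F p u) := by
  have h := mfderiv_comp p (hf.mdifferentiable (by simp) (F p)) (F.mdifferentiable (by simp) p)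
  exact congrArg (fun L : TangentSpace 𝓘(ℝ, E) p →L[ℝ] ℝ => L u) h

omit [IsManifold 𝓘(ℝ, E) ∞ M] in
/-- Derivatives along invariant vector fields of an invariant function are invariant. -/
theorem dFun_apply_invariant {f : M → ℝ} (hf : ContMDiff 𝓘(ℝ, E) 𝓘(ℝ, ℝ) ∞ f)
    {F : M ≃ₘ⟮𝓘(ℝ, E), 𝓘(ℝ, E)⟯ M} {X : (p : M) → TangentSpace 𝓘(ℝ, E) p}
    (hX : ∀ p, mfderiv 𝓘(ℝ, E) 𝓘(ℝ, E) F p (X p) = X (F p)) (hfF : ∀ p, f (F p) = f p) (p : M) :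
    dFun 𝓘(ℝ, E) f (F p) (X (F p)) = dFun 𝓘(ℝ, E) f p (X p) := by
  rw [← hX, ← dFun_comp_map hf]
  simp only [hfF]

variable [FiniteDimensional ℝ E]

/-- Exterior derivatives and differentials of functions commute with pullback, and `F` carries `X`
and `Y` to themselves. -/
theorem bracketTerm_pullback {β : OneForm 𝓘(ℝ, E) M} (hβ : IsSmoothOneForm 𝓘(ℝ, E) β)
    {X Y : (p : M) → TangentSpace 𝓘(ℝ, E) p} (hX : IsSmoothVectorField 𝓘(ℝ, E) X)
    (hY : IsSmoothVectorField 𝓘(ℝ, E) Y) {F : M ≃ₘ⟮𝓘(ℝ, E), 𝓘(ℝ, E)⟯ M}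
    (hXF : ∀ p, mfderiv 𝓘(ℝ, E) 𝓘(ℝ, E) F p (X p) = X (F p))
    (hYF : ∀ p, mfderiv 𝓘(ℝ, E) 𝓘(ℝ, E) F p (Y p) = Y (F p)) (p : M) :
    bracketTerm (β.pullback (I := 𝓘(ℝ, E)) F) X Y p = bracketTerm β X Y (F p) := by
  have h1 : (fun q => β.pullback (I := 𝓘(ℝ, E)) F q (X q)) = fun q => β (F q) (X (F q)) := by
    funext q
    exact congrArg (β (F q)) (hXF q)
  have h2 : (fun q => β.pullback (I := 𝓘(ℝ, E)) F q (Y q)) = fun q => β (F q) (Y (F q)) := by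
    funext q
    exact congrArg (β (F q)) (hYF q)
  unfold bracketTerm
  rw [h1, h2, OneForm.d_pullback (hβ.differentiableAt_inChart _) F.contMDiff.contMDiffAt,
    dFun_comp_map (hβ.apply hX), dFun_comp_map (hβ.apply hY), hXF, hYF]

/-- A contact form with `β ([X, Y]) = -1` is invariant under the contactomorphisms that preserve
`X` and `Y`. -/
theorem invariant_of_bracketTerm_eq_one {ξ : CoorientedHyperplaneField 𝓘(ℝ, E) M}
    {β : OneForm 𝓘(ℝ, E) M} (hβ : ξ.DefinedBy β)
    {X Y : (p : M) → TangentSpace 𝓘(ℝ, E) p} (hX : IsSmoothVectorField 𝓘(ℝ, E) X)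
    (hY : IsSmoothVectorField 𝓘(ℝ, E) Y) (h : ∀ p, bracketTerm β X Y p = 1)
    {F : M ≃ₘ⟮𝓘(ℝ, E), 𝓘(ℝ, E)⟯ M} (hF : ξ.IsContactomorphism F)
    (hXF : ∀ p, mfderiv 𝓘(ℝ, E) 𝓘(ℝ, E) F p (X p) = X (F p))
    (hYF : ∀ p, mfderiv 𝓘(ℝ, E) 𝓘(ℝ, E) F p (Y p) = Y (F p)) (p : M)
    (v : TangentSpace 𝓘(ℝ, E) p) : β (F p) (mfderiv 𝓘(ℝ, E) 𝓘(ℝ, E) F p v) = β p v := by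
  have hpb : ξ.DefinedBy (β.pullback (I := 𝓘(ℝ, E)) F) := by
    refine ⟨hβ.1.pullback F.contMDiff, fun q => ?_⟩
    have h1 : ∀ v, v ∈ ξ.plane q ↔ β.pullback (I := 𝓘(ℝ, E)) F q v = 0 := fun v =>
      (hF q v).1.symm.trans ((hβ.2 (F q)).2.1 _)
    have h2 : ∀ v, v ∈ ξ.pos q ↔ 0 < β.pullback (I := 𝓘(ℝ, E)) F q v := fun v =>
      (hF q v).2.symm.trans ((hβ.2 (F q)).2.2 _)
    refine ⟨fun h0 => (hβ.2 q).1 (ContinuousLinearMap.ext fun v => ?_), h1, h2⟩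
    exact ((hβ.2 q).2.1 v).1 ((h1 v).2 (by rw [h0]; rfl))
  obtain ⟨f, hf, -, hfβ⟩ := hβ.exists_eq_smul hpb
  -- If `F^*β = f β`, homogeneity makes the bracket term of `F^*β` equal to `f`, while naturality
  -- makes it `1`.
  have h1 := bracketTerm_pullback hβ.1 hX hY hXF hYF p
  rw [funext hfβ, bracketTerm_smul hβ.1 hX hY hf, h, h, mul_one] at h1
  have h2 := congrArg (fun L : TangentSpace 𝓘(ℝ, E) p →L[ℝ] ℝ => L v) (hfβ p)
  rw [h1, one_smul] at h2
  exact h2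

end Naturality

/-! ## Open books defined by pairs of contact vector fields -/

section OpenBook

variable {E M : Type*} [NormedAddCommGroup E] [NormedSpace ℝ E]
  [TopologicalSpace M] [ChartedSpace E M]

theorem mfderiv_prodMk_real {f g : M → ℝ} (hf : ContMDiff 𝓘(ℝ, E) 𝓘(ℝ, ℝ) ∞ f)
    (hg : ContMDiff 𝓘(ℝ, E) 𝓘(ℝ, ℝ) ∞ g) (p : M) (u : TangentSpace 𝓘(ℝ, E) p) :
    (mfderiv 𝓘(ℝ, E) 𝓘(ℝ, ℝ × ℝ) (fun q => (f q, g q)) p u : ℝ × ℝ) =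
      (dFun 𝓘(ℝ, E) f p u, dFun 𝓘(ℝ, E) g p u) := by
  have hφ : MDifferentiableAt 𝓘(ℝ, E) 𝓘(ℝ, ℝ × ℝ) (fun q => (f q, g q)) p :=
    (hf.prodMk_space hg).mdifferentiable (by simp) p
  have h1 := ((ContinuousLinearMap.fst ℝ ℝ ℝ).hasMFDerivAt.comp p hφ.hasMFDerivAt).mfderiv
  have h2 := ((ContinuousLinearMap.snd ℝ ℝ ℝ).hasMFDerivAt.comp p hφ.hasMFDerivAt).mfderiv
  exact Prod.ext (congrArg (fun L : TangentSpace 𝓘(ℝ, E) p →L[ℝ] ℝ => L u) h1).symm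
    (congrArg (fun L : TangentSpace 𝓘(ℝ, E) p →L[ℝ] ℝ => L u) h2).symm

variable [IsManifold 𝓘(ℝ, E) ∞ M] [FiniteDimensional ℝ E]

/-- Two contact vector fields `X`, `Y` of `ξ = ker β` with `β ([X, Y]) < 0` define an open book for
which `β` is adapted, as soon as the Reeb field of `β` is positively transverse to the pages. -/
theorem isAdaptedForm_of_lieForm {d : ℕ} (hE : Module.finrank ℝ E = 2 * d + 1)
    {ξ : CoorientedHyperplaneField 𝓘(ℝ, E) M} {β : OneForm 𝓘(ℝ, E) M} (hβ : ξ.DefinedBy β)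
    (hvol : ∀ p, ∃ v, β.contactVolume 𝓘(ℝ, E) d p v ≠ 0)
    {X Y : (p : M) → TangentSpace 𝓘(ℝ, E) p} (hX : IsSmoothVectorField 𝓘(ℝ, E) X)
    (hY : IsSmoothVectorField 𝓘(ℝ, E) Y) {k g : M → ℝ}
    (hk : ∀ p u, lieForm β X p u = k p * β p u) (hg : ∀ p u, lieForm β Y p u = g p * β p u)
    (hpos : ∀ p, 0 < bracketTerm β X Y p)
    (hreeb : ∀ p, ((-β p (X p), β p (Y p)) : ℝ × ℝ) ≠ 0 →
      0 < β p (Y p) * k p - β p (X p) * g p) :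
    DefinesOpenBook (E := E) (fun p => ((-β p (X p), β p (Y p)) : ℝ × ℝ)) ∧
      IsAdaptedForm d ξ (fun p => ((-β p (X p), β p (Y p)) : ℝ × ℝ)) β := by
  set K : M → ℝ := fun p => β p (X p) with hK
  set G : M → ℝ := fun p => β p (Y p) with hG
  have hKs : ContMDiff 𝓘(ℝ, E) 𝓘(ℝ, ℝ) ∞ K := hβ.1.apply hX
  have hGs : ContMDiff 𝓘(ℝ, E) 𝓘(ℝ, ℝ) ∞ G := hβ.1.apply hY
  set φ : M → ℝ × ℝ := fun p => (-K p, G p) with hφ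
  have hφs : ContMDiff 𝓘(ℝ, E) 𝓘(ℝ, ℝ × ℝ) ∞ φ := hKs.neg.prodMk_space hGs
  have hdφ : ∀ p u, (mfderiv 𝓘(ℝ, E) 𝓘(ℝ, ℝ × ℝ) φ p u : ℝ × ℝ) =
      (-dFun 𝓘(ℝ, E) K p u, dFun 𝓘(ℝ, E) G p u) := by
    intro p u
    rw [mfderiv_prodMk_real hKs.neg hGs p u, ← dFun_neg]
  have hT : ∀ p : M, Module.finrank ℝ (TangentSpace 𝓘(ℝ, E) p) = 2 * d + 1 := fun p => hE
  have hfin : ∀ p : M, FiniteDimensional ℝ (TangentSpace 𝓘(ℝ, E) p) := fun p =>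
    inferInstanceAs (FiniteDimensional ℝ E)
  have hdX : ∀ p u, β.dLin p (X p) u = k p * β p u - dFun 𝓘(ℝ, E) K p u := fun p u => by
    rw [← hk]; exact (add_sub_cancel_right _ _).symm
  have hdY : ∀ p u, β.dLin p (Y p) u = g p * β p u - dFun 𝓘(ℝ, E) G p u := fun p u => by
    rw [← hg]; exact (add_sub_cancel_right _ _).symm
  have hskew : ∀ p (u v : TangentSpace 𝓘(ℝ, E) p), β.dLin p u v = -β.dLin p v u := fun p u v =>
    β.d_skew p u v
  have hreebV : ∀ p, ∃ R : TangentSpace 𝓘(ℝ, E) p, β p R = 1 ∧ ∀ u, β.dLin p R u = 0 := by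
    intro p
    obtain ⟨v, hv⟩ := hvol p
    have := hfin p
    exact exists_reebVector (a := (β p : TangentSpace 𝓘(ℝ, E) p →ₗ[ℝ] ℝ)) (Ω := β.dLin p)
      (hskew p) (hT p) v hv
  have hdArg : ∀ p u, dArg φ p u = (G p * dFun 𝓘(ℝ, E) K p u - K p * dFun 𝓘(ℝ, E) G p u) /
      (K p ^ 2 + G p ^ 2) := by
    intro p u
    unfold dArg
    rw [hdφ]
    simp only [hφ]
    ring
  have hsq : ∀ p, φ p ≠ 0 → 0 < K p ^ 2 + G p ^ 2 := by
    intro p hp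
    by_contra hcon
    have h1 : K p = 0 := by nlinarith [sq_nonneg (K p), sq_nonneg (G p)]
    have h2 : G p = 0 := by nlinarith [sq_nonneg (K p), sq_nonneg (G p)]
    exact hp (by simp [hφ, h1, h2])
  -- Inserting `R` into `L_X β = k β` and `L_Y β = g β` gives `dK(R) = k` and `dG(R) = g`, so
  -- `hreeb` says that the argument of `φ` increases along `R`.
  have hRpos : ∀ p, φ p ≠ 0 → ∀ R : TangentSpace 𝓘(ℝ, E) p, β p R = 1 →
      (∀ u, β.dLin p R u = 0) → 0 < dArg φ p R := by
    intro p hp R hR hRu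
    have h1 := hdX p R
    have h2 := hdY p R
    rw [hskew, hRu, hR] at h1 h2
    have h3 : dFun 𝓘(ℝ, E) K p R = k p := by linarith
    have h4 : dFun 𝓘(ℝ, E) G p R = g p := by linarith
    rw [hdArg, h3, h4]
    exact div_pos (hreeb p hp) (hsq p hp)
  -- At a zero of `φ` the right-hand sides `k β` and `g β` vanish on `X` and `Y`. The two Lie
  -- derivative identities and the bracket then determine all these values by the single number `r =
  -- -β([X, Y])`.
  have hbind : ∀ p, φ p = 0 → ∃ r, 0 < r ∧ K p = 0 ∧ G p = 0 ∧
      dFun 𝓘(ℝ, E) K p (X p) = 0 ∧ dFun 𝓘(ℝ, E) G p (Y p) = 0 ∧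
      dFun 𝓘(ℝ, E) K p (Y p) = r ∧ dFun 𝓘(ℝ, E) G p (X p) = -r ∧ β.dLin p (X p) (Y p) = -r := by
    intro p hp
    have hK0 : K p = 0 := by simpa [hφ] using congrArg Prod.fst hp
    have hG0 : G p = 0 := by simpa [hφ] using congrArg Prod.snd hp
    have e1 := hdX p (X p)
    have e2 := hdX p (Y p)
    have e3 := hdY p (X p)
    have e4 := hdY p (Y p)
    have e5 := hskew p (X p) (X p)
    have e6 := hskew p (Y p) (Y p)
    have e7 := hskew p (X p) (Y p)
    have e8 : bracketTerm β X Y p = β.dLin p (X p) (Y p) + dFun 𝓘(ℝ, E) K p (Y p) -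
      dFun 𝓘(ℝ, E) G p (X p) := rfl
    have e9 : β p (X p) = 0 := hK0
    have e10 : β p (Y p) = 0 := hG0
    rw [e9, mul_zero] at e1 e3
    rw [e10, mul_zero] at e2 e4
    exact ⟨bracketTerm β X Y p, hpos p, hK0, hG0, by linarith, by linarith, by linarith,
      by linarith, by linarith⟩
  refine ⟨⟨hφs, ?_, ?_⟩, hβ, ?_, ?_⟩
  · intro p hp z
    obtain ⟨r, hr, -, -, h1, h2, h3, h4, -⟩ := hbind p hp
    -- By `hbind`, `dφ` sends `X` to `(0, -r)` and `Y` to `(-r, 0)`; this combination inverts it.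
    refine ⟨(-r⁻¹ * (z : ℝ × ℝ).2) • X p + (-r⁻¹ * (z : ℝ × ℝ).1) • Y p, ?_⟩
    refine (hdφ p _).trans ?_
    rw [map_add, map_add, map_smul, map_smul, map_smul, map_smul, h1, h2, h3, h4]
    refine Prod.ext ?_ ?_ <;> simp <;> field_simp
  · intro p hp
    obtain ⟨R, hR, hRu⟩ := hreebV p
    exact ⟨R, (hRpos p hp R hR hRu).ne'⟩
  · rintro m rfl p hp N₁ N₂ w hN hw
    obtain ⟨r, hr, hK0, hG0, h1, h2, h3, h4, h5⟩ := hbind p hp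
    have := hfin p
    rw [hβ.isPositiveBasis_iff]
    let L : TangentSpace 𝓘(ℝ, E) p →L[ℝ] ℝ × ℝ := mfderiv 𝓘(ℝ, E) 𝓘(ℝ, ℝ × ℝ) φ p
    -- On the kernel of `dφ` the identities reduce to `dβ(X, ·) = k β` and `dβ(Y, ·) = g β`, so `X`
    -- and `Y` span a normal plane that is `dβ`-orthogonal to the contact hyperplane of the binding.
    refine oneFormWedgePower_pos_iff_of_codim_two
      (a := (β p : TangentSpace 𝓘(ℝ, E) p →ₗ[ℝ] ℝ)) (Ω := β.dLin p) (hskew p) (m := m)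
      ((hT p).trans (by ring))
      L.toLinearMap (X := X p)
      (Y := Y p) hK0 hG0 hr ?_ ?_ (by rw [h5]; linarith) (c₁ := k p) (c₂ := g p) ?_ ?_ N₁ N₂ w hN hw
    · refine (hdφ p _).trans ?_
      rw [h1, h4, neg_zero]
    · refine (hdφ p _).trans ?_
      rw [h2, h3]
    · intro u hu
      have h6 := congrArg Prod.fst ((hdφ p u).symm.trans hu)
      rw [hdX]
      have h7 : dFun 𝓘(ℝ, E) K p u = 0 := neg_eq_zero.1 h6
      rw [h7, sub_zero]; rfl
    · intro u hu
      have h7 : dFun 𝓘(ℝ, E) G p u = 0 := congrArg Prod.snd ((hdφ p u).symm.trans hu)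
      rw [hdY, h7, sub_zero]; rfl
  · intro p hp N w hN hw
    obtain ⟨R, hR, hRu⟩ := hreebV p
    have := hfin p
    rw [hβ.isPositiveBasis_iff]
    let l : TangentSpace 𝓘(ℝ, E) p →ₗ[ℝ] ℝ :=
      (K p ^ 2 + G p ^ 2)⁻¹ • (G p • (dFun 𝓘(ℝ, E) K p : TangentSpace 𝓘(ℝ, E) p →ₗ[ℝ] ℝ) -
        K p • (dFun 𝓘(ℝ, E) G p : TangentSpace 𝓘(ℝ, E) p →ₗ[ℝ] ℝ))
    have hl : ∀ u, l u = dArg φ p u := fun u => by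
      rw [hdArg, div_eq_inv_mul]; rfl
    exact oneFormWedgePower_pos_iff_of_reeb (a := (β p : TangentSpace 𝓘(ℝ, E) p →ₗ[ℝ] ℝ))
      (Ω := β.dLin p) (hskew p) (hT p) hR hRu l (by rw [hl]; exact hRpos p hp R hR hRu) N
      (by rw [hl]; exact hN) w (fun i => by rw [hl]; exact hw i)

end OpenBook

/-! ### An invariant rescaling that makes the Reeb field transverse to the pages. -/

section OpenBook

variable {E M : Type*} [NormedAddCommGroup E] [NormedSpace ℝ E]
  [TopologicalSpace M] [ChartedSpace E M] [IsManifold 𝓘(ℝ, E) ∞ M] [FiniteDimensional ℝ E]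

/-- The derivative is written so that `f = q^(-1/2)` satisfies `df / f = -dq / (2 q)`. -/
theorem hasDerivAt_inv_sqrt {x : ℝ} (hx : 0 < x) :
    HasDerivAt (fun y => (√y)⁻¹) (-((√x)⁻¹ / (2 * x))) x := by
  have h1 := (Real.hasDerivAt_sqrt hx.ne').inv (Real.sqrt_ne_zero'.2 hx)
  have h2 : -(1 / (2 * √x)) / √x ^ 2 = -((√x)⁻¹ / (2 * x)) := by
    rw [Real.sq_sqrt hx.le]
    field_simp
  rw [h2] at h1
  exact h1

/-- If `X`, `Y` are contact vector fields of `ξ = ker β` with `β ([X, Y]) = -1`, a multiple of `β`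
by an invariant function is adapted to the open book defined by `X` and `Y`. -/
theorem exists_adapted_rescaling [CompactSpace M] {d : ℕ} (hE : Module.finrank ℝ E = 2 * d + 1)
    {ξ : CoorientedHyperplaneField 𝓘(ℝ, E) M} {β : OneForm 𝓘(ℝ, E) M} (hβ : ξ.DefinedBy β)
    (hvol : ∀ p, ∃ v, β.contactVolume 𝓘(ℝ, E) d p v ≠ 0)
    {X Y : (p : M) → TangentSpace 𝓘(ℝ, E) p} (hX : IsSmoothVectorField 𝓘(ℝ, E) X)
    (hY : IsSmoothVectorField 𝓘(ℝ, E) Y) {k g : M → ℝ} (hks : ContMDiff 𝓘(ℝ, E) 𝓘(ℝ, ℝ) ∞ k)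
    (hgs : ContMDiff 𝓘(ℝ, E) 𝓘(ℝ, ℝ) ∞ g)
    (hk : ∀ p u, lieForm β X p u = k p * β p u) (hg : ∀ p u, lieForm β Y p u = g p * β p u)
    (h1 : ∀ p, bracketTerm β X Y p = 1) :
    ∃ f : M → ℝ, ContMDiff 𝓘(ℝ, E) 𝓘(ℝ, ℝ) ∞ f ∧ (∀ p, 0 < f p) ∧
      (∀ F : M ≃ₘ⟮𝓘(ℝ, E), 𝓘(ℝ, E)⟯ M,
        (∀ p v, β (F p) (mfderiv 𝓘(ℝ, E) 𝓘(ℝ, E) F p v) = β p v) →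
        (∀ p, mfderiv 𝓘(ℝ, E) 𝓘(ℝ, E) F p (X p) = X (F p)) →
        (∀ p, mfderiv 𝓘(ℝ, E) 𝓘(ℝ, E) F p (Y p) = Y (F p)) → ∀ p, f (F p) = f p) ∧
      DefinesOpenBook (E := E)
        (fun p => ((-(f p * β p (X p)), f p * β p (Y p)) : ℝ × ℝ)) ∧
      IsAdaptedForm d ξ (fun p => ((-(f p * β p (X p)), f p * β p (Y p)) : ℝ × ℝ))
        (fun p => f p • β p) := by
  set K : M → ℝ := fun p => β p (X p) with hK
  set G : M → ℝ := fun p => β p (Y p) with hG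
  have hKs : ContMDiff 𝓘(ℝ, E) 𝓘(ℝ, ℝ) ∞ K := hβ.1.apply hX
  have hGs : ContMDiff 𝓘(ℝ, E) 𝓘(ℝ, ℝ) ∞ G := hβ.1.apply hY
  set DX : (M → ℝ) → M → ℝ := fun f p => dFun 𝓘(ℝ, E) f p (X p) with hDX
  set DY : (M → ℝ) → M → ℝ := fun f p => dFun 𝓘(ℝ, E) f p (Y p) with hDY
  have hDXs : ∀ f, ContMDiff 𝓘(ℝ, E) 𝓘(ℝ, ℝ) ∞ f → ContMDiff 𝓘(ℝ, E) 𝓘(ℝ, ℝ) ∞ (DX f) :=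
    fun f hf => contMDiff_dFun_apply hf hX
  have hDYs : ∀ f, ContMDiff 𝓘(ℝ, E) 𝓘(ℝ, ℝ) ∞ f → ContMDiff 𝓘(ℝ, E) 𝓘(ℝ, ℝ) ∞ (DY f) :=
    fun f hf => contMDiff_dFun_apply hf hY
  have hmd : ∀ {f : M → ℝ}, ContMDiff 𝓘(ℝ, E) 𝓘(ℝ, ℝ) ∞ f →
      ∀ p, MDifferentiableAt 𝓘(ℝ, E) 𝓘(ℝ, ℝ) f p := fun hf => hf.mdifferentiable (by simp)
  have hXK : ∀ p, DX K p = k p * K p := fun p => by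
    rw [← hk p (X p), lieForm_self]
  have hYG : ∀ p, DY G p = g p * G p := fun p => by
    rw [← hg p (Y p), lieForm_self]
  have e1 : ∀ p, β.d 𝓘(ℝ, E) p (X p) (Y p) + DY K p = k p * G p := fun p => hk p (Y p)
  have e2 : ∀ p, β.d 𝓘(ℝ, E) p (Y p) (X p) + DX G p = g p * K p := fun p => hg p (X p)
  have e3 : ∀ p, β.d 𝓘(ℝ, E) p (X p) (Y p) + DY K p - DX G p = 1 := h1
  -- Evaluating `L_X β = k β` on `Y` and `L_Y β = g β` on `X`, and using that the bracket term is
  -- `1`, gives the mixed derivatives.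
  have hXG : ∀ p, DX G p = k p * G p - 1 := fun p => by
    have := e1 p; have := e3 p; linarith
  have hYK : ∀ p, DY K p = 1 + g p * K p := fun p => by
    have := e2 p; have := e3 p; have := β.d_skew p (X p) (Y p); linarith
  -- This is `-dβ(X, Y)`, written through derivatives of `K` and `G` along `X` and `Y` so that its
  -- invariance is visible. By `hbeq` it equals `1` where `K = G = 0`.
  set b : M → ℝ := fun p => DY K p - DX G p - 1 with hb
  have hbs : ContMDiff 𝓘(ℝ, E) 𝓘(ℝ, ℝ) ∞ b := ((hDYs K hKs).sub (hDXs G hGs)).sub contMDiff_const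
  have hbeq : b = fun p => 1 + (g p * K p - k p * G p) := by
    funext p; simp only [hb, hXG, hYK]; ring
  have hmul : ∀ {f h : M → ℝ}, ContMDiff 𝓘(ℝ, E) 𝓘(ℝ, ℝ) ∞ f → ContMDiff 𝓘(ℝ, E) 𝓘(ℝ, ℝ) ∞ h →
      ContMDiff 𝓘(ℝ, E) 𝓘(ℝ, ℝ) ∞ (fun p => f p * h p) := fun hf hh => hf.mul hh
  have hadd : ∀ {f h : M → ℝ}, ContMDiff 𝓘(ℝ, E) 𝓘(ℝ, ℝ) ∞ f → ContMDiff 𝓘(ℝ, E) 𝓘(ℝ, ℝ) ∞ h →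
      ContMDiff 𝓘(ℝ, E) 𝓘(ℝ, ℝ) ∞ (fun p => f p + h p) := fun hf hh => hf.add hh
  have hsub : ∀ {f h : M → ℝ}, ContMDiff 𝓘(ℝ, E) 𝓘(ℝ, ℝ) ∞ f → ContMDiff 𝓘(ℝ, E) 𝓘(ℝ, ℝ) ∞ h →
      ContMDiff 𝓘(ℝ, E) 𝓘(ℝ, ℝ) ∞ (fun p => f p - h p) := fun hf hh => hf.sub hh
  have hXb : ∀ p, DX b p = g p * (k p * K p) + K p * DX g p -
      (k p * (k p * G p - 1) + G p * DX k p) := fun p => by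
    rw [← hXK, ← hXG, hbeq]
    simp only [hDX]
    rw [dFun_add (hmd contMDiff_const p) (hmd (hsub (hmul hgs hKs) (hmul hks hGs)) p), dFun_const,
      dFun_sub (hmd (hmul hgs hKs) p) (hmd (hmul hks hGs) p), dFun_mul (hmd hgs p) (hmd hKs p),
      dFun_mul (hmd hks p) (hmd hGs p), zero_add]
  have hYb : ∀ p, DY b p = g p * (1 + g p * K p) + K p * DY g p -
      (k p * (g p * G p) + G p * DY k p) := fun p => by
    rw [← hYK, ← hYG, hbeq]
    simp only [hDY]
    rw [dFun_add (hmd contMDiff_const p) (hmd (hsub (hmul hgs hKs) (hmul hks hGs)) p), dFun_const,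
      dFun_sub (hmd (hmul hgs hKs) p) (hmd (hmul hks hGs) p), dFun_mul (hmd hgs p) (hmd hKs p),
      dFun_mul (hmd hks p) (hmd hGs p), zero_add]
  -- Compactness of `M` is used here: `C` bounds the coefficients of the quadratic error term in
  -- `h3` below.
  obtain ⟨C, hC⟩ : ∃ C, ∀ p, ‖b p‖ * (‖DX k p‖ + ‖DY g p‖ + ‖DY k p‖ + ‖DX g p‖) ≤ C := by
    have hcont : Continuous
        fun p => ‖b p‖ * (‖DX k p‖ + ‖DY g p‖ + ‖DY k p‖ + ‖DX g p‖) :=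
      hbs.continuous.norm.mul ((((hDXs k hks).continuous.norm.add (hDYs g hgs).continuous.norm).add
        (hDYs k hks).continuous.norm).add (hDXs g hgs).continuous.norm)
    obtain ⟨C, hC⟩ := isCompact_univ.exists_bound_of_continuousOn hcont.continuousOn
    exact ⟨C, fun p => (le_abs_self _).trans (hC p (mem_univ p))⟩
  set ε : ℝ := (|C| + 1)⁻¹ with hε
  have hε0 : 0 < ε := by positivity
  have hεC : ε * C < 1 := by
    have h2 : ε * (|C| + 1) = 1 := inv_mul_cancel₀ (by positivity)
    nlinarith [le_abs_self C]
  -- With `ε = 0` the factor `q^(-1/2)` would normalise `(K, G)` to length one; the term `ε b²`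
  -- keeps `q` positive on the binding.
  set q : M → ℝ := fun p => K p * K p + G p * G p + ε * (b p * b p) with hq
  have hqs : ContMDiff 𝓘(ℝ, E) 𝓘(ℝ, ℝ) ∞ q :=
    ((hKs.mul hKs).add (hGs.mul hGs)).add (contMDiff_const.mul (hbs.mul hbs))
  have hqpos : ∀ p, 0 < q p := by
    intro p
    by_cases h : K p = 0 ∧ G p = 0
    · have hb1 : b p = 1 := by rw [hbeq]; simp [h.1, h.2]
      simp only [hq, hb1, h.1, h.2]
      linarith
    · have h2 : 0 < K p * K p + G p * G p := by
        rcases not_and_or.1 h with h | h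
        · nlinarith [mul_self_pos.2 h, mul_self_nonneg (G p)]
        · nlinarith [mul_self_pos.2 h, mul_self_nonneg (K p)]
      have h3 : 0 ≤ ε * (b p * b p) := mul_nonneg hε0.le (mul_self_nonneg _)
      simp only [hq]; linarith
  have hDq : ∀ p (u : TangentSpace 𝓘(ℝ, E) p), dFun 𝓘(ℝ, E) q p u =
      2 * K p * dFun 𝓘(ℝ, E) K p u + 2 * G p * dFun 𝓘(ℝ, E) G p u +
        ε * (2 * b p * dFun 𝓘(ℝ, E) b p u) := by
    intro p u
    simp only [hq]
    rw [dFun_add (hmd (hadd (hmul hKs hKs) (hmul hGs hGs)) p)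
      (hmd (hmul contMDiff_const (hmul hbs hbs)) p), dFun_add (hmd (hmul hKs hKs) p)
      (hmd (hmul hGs hGs) p), dFun_mul (hmd hKs p) (hmd hKs p), dFun_mul (hmd hGs p) (hmd hGs p),
      dFun_mul (hmd contMDiff_const p) (hmd (hmul hbs hbs) p), dFun_const,
      dFun_mul (hmd hbs p) (hmd hbs p)]
    ring
  set f : M → ℝ := fun p => (√(q p))⁻¹ with hf
  have hfpos : ∀ p, 0 < f p := fun p => inv_pos.2 (Real.sqrt_pos.2 (hqpos p))
  have hfs : ContMDiff 𝓘(ℝ, E) 𝓘(ℝ, ℝ) ∞ f := by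
    intro p
    have h2 : ContDiffAt ℝ ∞ (fun y => (√y)⁻¹) (q p) :=
      (Real.contDiffAt_sqrt (hqpos p).ne').inv (Real.sqrt_ne_zero'.2 (hqpos p))
    exact h2.contMDiffAt.comp p (hqs p)
  have hDf : ∀ p (u : TangentSpace 𝓘(ℝ, E) p), dFun 𝓘(ℝ, E) f p u =
      -(f p / (2 * q p)) * dFun 𝓘(ℝ, E) q p u := fun p u =>
    dFun_comp (hasDerivAt_inv_sqrt (hqpos p)) (hmd hqs p) u
  -- This is the Reeb inequality for `f β`, divided by `f` and with the logarithmic derivatives of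
  -- `f` replaced by those of `q`.
  have key : ∀ p, (K p ≠ 0 ∨ G p ≠ 0) →
      0 < G p * k p - K p * g p + (K p * DY q p - G p * DX q p) / (2 * q p) := by
    intro p hp
    have h2 : 0 < K p * K p + G p * G p := by
      rcases hp with h | h
      · nlinarith [mul_self_pos.2 h, mul_self_nonneg (G p)]
      · nlinarith [mul_self_pos.2 h, mul_self_nonneg (K p)]
    have hb1 : b p = 1 + (g p * K p - k p * G p) := congrFun hbeq p
    -- The terms containing `k` and `g` undifferentiated cancel, in the `ε` part thanks to `b = 1 +
    -- gK - kG`. What is left is `K² + G²` plus `ε b` times a quadratic form in `(K, G)`.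
    have h3 : (G p * k p - K p * g p) * (2 * q p) + (K p * DY q p - G p * DX q p) =
        2 * ((K p * K p + G p * G p) + ε * (b p * (G p * G p * DX k p + K p * K p * DY g p -
          K p * G p * (DY k p + DX g p)))) := by
      have e4 : DX q p = 2 * K p * DX K p + 2 * G p * DX G p + ε * (2 * b p * DX b p) := hDq p _
      have e5 : DY q p = 2 * K p * DY K p + 2 * G p * DY G p + ε * (2 * b p * DY b p) := hDq p _
      rw [e4, e5, hXK, hXG, hYK, hYG, hXb, hYb]
      simp only [hq]
      rw [hb1]
      ring
    have h4 : |b p * (G p * G p * DX k p + K p * K p * DY g p -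
        K p * G p * (DY k p + DX g p))| ≤ C * (K p * K p + G p * G p) := by
      refine le_trans ?_ (mul_le_mul_of_nonneg_right (hC p) h2.le)
      rw [abs_mul, Real.norm_eq_abs, mul_assoc |b p|]
      refine mul_le_mul_of_nonneg_left ?_ (abs_nonneg _)
      simp only [Real.norm_eq_abs]
      have a1 : |G p * G p * DX k p| ≤ |DX k p| * (K p * K p + G p * G p) := by
        rw [abs_mul, abs_mul_self]
        nlinarith [mul_self_nonneg (K p), abs_nonneg (DX k p), mul_self_nonneg (G p),
          mul_nonneg (abs_nonneg (DX k p)) (mul_self_nonneg (K p))]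
      have a2 : |K p * K p * DY g p| ≤ |DY g p| * (K p * K p + G p * G p) := by
        rw [abs_mul, abs_mul_self]
        nlinarith [mul_nonneg (abs_nonneg (DY g p)) (mul_self_nonneg (G p))]
      have a3 : |K p * G p * (DY k p + DX g p)| ≤
          (|DY k p| + |DX g p|) * (K p * K p + G p * G p) := by
        rw [abs_mul, mul_comm]
        refine mul_le_mul (abs_add_le _ _) ?_ (abs_nonneg _) (by positivity)
        rw [abs_le]
        constructor <;> nlinarith [mul_self_nonneg (K p + G p), mul_self_nonneg (K p - G p)]
      calc _ ≤ |G p * G p * DX k p + K p * K p * DY g p| + |K p * G p * (DY k p + DX g p)| :=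
            abs_sub _ _
        _ ≤ |G p * G p * DX k p| + |K p * K p * DY g p| + |K p * G p * (DY k p + DX g p)| := by
            gcongr; exact abs_add_le _ _
        _ ≤ _ := by linarith
    have h5 : 0 < (G p * k p - K p * g p) * (2 * q p) + (K p * DY q p - G p * DX q p) := by
      rw [h3]
      have h6 := neg_abs_le (b p * (G p * G p * DX k p + K p * K p * DY g p -
        K p * G p * (DY k p + DX g p)))
      have h7 : -(ε * C * (K p * K p + G p * G p)) ≤ ε * (b p * (G p * G p * DX k p +
          K p * K p * DY g p - K p * G p * (DY k p + DX g p))) := by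
        have := mul_le_mul_of_nonneg_left (le_trans (neg_le_neg h4) h6) hε0.le
        linarith
      nlinarith
    have h6 : 0 < 2 * q p := by linarith [hqpos p]
    have h7 := div_pos h5 h6
    rwa [add_div, mul_div_cancel_right₀ _ h6.ne'] at h7
  refine ⟨f, hfs, hfpos, ?_, ?_⟩
  · intro F hFβ hFX hFY p
    have hKF : ∀ p, K (F p) = K p := fun p => by
      simp only [hK]; rw [← hFX, hFβ]
    have hGF : ∀ p, G (F p) = G p := fun p => by
      simp only [hG]; rw [← hFY, hFβ]
    -- `F` preserves `K`, `G`, `X` and `Y`, hence also the derivatives that define `b`.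
    have hbF : b (F p) = b p := by
      have e4 : DY K (F p) = DY K p := dFun_apply_invariant hKs hFY hKF p
      have e5 : DX G (F p) = DX G p := dFun_apply_invariant hGs hFX hGF p
      simp only [hb, e4, e5]
    simp only [hf, hq, hKF, hGF, hbF]
  -- The conformal factors of `X` and `Y` for `f β` are those for `β` plus the logarithmic
  -- derivatives of `f`.
  · refine isAdaptedForm_of_lieForm hE (hβ.smul hfs hfpos) ?_ hX hY
      (k := fun p => k p + DX f p / f p) (g := fun p => g p + DY f p / f p) ?_ ?_ ?_ ?_
    · intro p
      obtain ⟨v, hv⟩ := hvol p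
      refine ⟨v, ?_⟩
      rw [OneForm.contactVolume_smul hβ.1 hfs d (hfpos p).ne']
      exact mul_ne_zero (pow_ne_zero _ (hfpos p).ne') hv
    · intro p u
      rw [lieForm_smul hβ.1 hX hfs, hk]
      change _ = (k p + DX f p / f p) * (f p * β p u)
      have := (hfpos p).ne'
      field_simp
      rfl
    · intro p u
      rw [lieForm_smul hβ.1 hY hfs, hg]
      change _ = (g p + DY f p / f p) * (f p * β p u)
      have := (hfpos p).ne'
      field_simp
      rfl
    · intro p
      rw [bracketTerm_smul hβ.1 hX hY hfs, h1, mul_one]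
      exact hfpos p
    · intro p hp
      change 0 < f p * G p * (k p + DX f p / f p) - f p * K p * (g p + DY f p / f p)
      have hf0 := (hfpos p).ne'
      have hq0 := (hqpos p).ne'
      have e4 : DX f p = -(f p / (2 * q p)) * DX q p := hDf p _
      have e5 : DY f p = -(f p / (2 * q p)) * DY q p := hDf p _
      have h2 : K p ≠ 0 ∨ G p ≠ 0 := by
        by_contra! hcon
        refine hp ?_
        change (-(f p * K p), f p * G p) = (0 : ℝ × ℝ)
        simp [hcon.1, hcon.2]
      have h3 : f p * G p * (k p + DX f p / f p) - f p * K p * (g p + DY f p / f p) =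
          f p * (G p * k p - K p * g p + (K p * DY q p - G p * DX q p) / (2 * q p)) := by
        rw [e4, e5]
        field_simp
        ring
      rw [h3]
      exact mul_pos (hfpos p) (key p h2)

end OpenBook

section OpenBook

variable {E M : Type*} [NormedAddCommGroup E] [NormedSpace ℝ E]
  [TopologicalSpace M] [ChartedSpace E M] [IsManifold 𝓘(ℝ, E) ∞ M] [FiniteDimensional ℝ E]

/-- Two contact vector fields `X`, `Y` of `ξ = ker α` with `α ([X, Y]) < 0` define an open book
supporting `ξ`, which is adapted to a form invariant under the contactomorphisms preserving `X`
and `Y`. -/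
theorem exists_adapted_of_contactFields [CompactSpace M] {d : ℕ}
    (hE : Module.finrank ℝ E = 2 * d + 1)
    {ξ : CoorientedHyperplaneField 𝓘(ℝ, E) M} {α : OneForm 𝓘(ℝ, E) M} (hα : ξ.DefinedBy α)
    (hvol : ∀ p, ∃ v, α.contactVolume 𝓘(ℝ, E) d p v ≠ 0)
    {X Y : (p : M) → TangentSpace 𝓘(ℝ, E) p} (hX : IsSmoothVectorField 𝓘(ℝ, E) X)
    (hY : IsSmoothVectorField 𝓘(ℝ, E) Y)
    (hXξ : ∀ p u, α p u = 0 → lieForm α X p u = 0) (hYξ : ∀ p u, α p u = 0 → lieForm α Y p u = 0)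
    (hpos : ∀ p, 0 < bracketTerm α X Y p) :
    ∃ f : M → ℝ, (∀ p, 0 < f p) ∧
      (∀ F : M ≃ₘ⟮𝓘(ℝ, E), 𝓘(ℝ, E)⟯ M, ξ.IsContactomorphism F →
        (∀ p, mfderiv 𝓘(ℝ, E) 𝓘(ℝ, E) F p (X p) = X (F p)) →
        (∀ p, mfderiv 𝓘(ℝ, E) 𝓘(ℝ, E) F p (Y p) = Y (F p)) →
        ∀ p v, f (F p) * α (F p) (mfderiv 𝓘(ℝ, E) 𝓘(ℝ, E) F p v) = f p * α p v) ∧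
      DefinesOpenBook (E := E)
        (fun p => ((-(f p * α p (X p)), f p * α p (Y p)) : ℝ × ℝ)) ∧
      IsAdaptedForm d ξ (fun p => ((-(f p * α p (X p)), f p * α p (Y p)) : ℝ × ℝ))
        (fun p => f p • α p) := by
  have hbs := contMDiff_bracketTerm hα.1 hX hY
  -- Dividing `α` by `-α([X, Y])` normalises the bracket term to `1`, which pins down an invariant
  -- form.
  set h : M → ℝ := fun p => (bracketTerm α X Y p)⁻¹ with hh
  have hh0 : ∀ p, 0 < h p := fun p => inv_pos.2 (hpos p)
  have hhs : ContMDiff 𝓘(ℝ, E) 𝓘(ℝ, ℝ) ∞ h := hbs.inv₀ fun p => (hpos p).ne'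
  set β : OneForm 𝓘(ℝ, E) M := fun p => h p • α p with hβdef
  have hβ : ξ.DefinedBy β := hα.smul hhs hh0
  have hker : ∀ p u, β p u = 0 → α p u = 0 := fun p u hu =>
    (mul_eq_zero_iff_left (hh0 p).ne').1 hu
  have hlie : ∀ {Z : (p : M) → TangentSpace 𝓘(ℝ, E) p}, IsSmoothVectorField 𝓘(ℝ, E) Z →
      (∀ p u, α p u = 0 → lieForm α Z p u = 0) → ∀ p u, β p u = 0 → lieForm β Z p u = 0 := by
    intro Z hZ hZξ p u hu
    rw [hβdef, lieForm_smul hα.1 hZ hhs, hZξ p u (hker p u hu), hker p u hu]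
    simp
  have h1 : ∀ p, bracketTerm β X Y p = 1 := fun p => by
    rw [hβdef, bracketTerm_smul hα.1 hX hY hhs]
    exact inv_mul_cancel₀ (hpos p).ne'
  obtain ⟨k, hks, hk⟩ := exists_lieForm_eq_mul hβ.1 (fun p => (hβ.2 p).1) hX (hlie hX hXξ)
  obtain ⟨g, hgs, hg⟩ := exists_lieForm_eq_mul hβ.1 (fun p => (hβ.2 p).1) hY (hlie hY hYξ)
  have hvolβ : ∀ p, ∃ v, β.contactVolume 𝓘(ℝ, E) d p v ≠ 0 := by
    intro p
    obtain ⟨v, hv⟩ := hvol p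
    refine ⟨v, ?_⟩
    rw [hβdef, OneForm.contactVolume_smul hα.1 hhs d (hh0 p).ne']
    exact mul_ne_zero (pow_ne_zero _ (hh0 p).ne') hv
  obtain ⟨f, -, hf0, hfinv, hbook, hadapt⟩ :=
    exists_adapted_rescaling hE hβ hvolβ hX hY hks hgs hk hg h1
  have e1 : ∀ p v, f p * β p v = f p * h p * α p v := fun p v => (mul_assoc _ _ _).symm
  have e2 : (fun p => ((-(f p * β p (X p)), f p * β p (Y p)) : ℝ × ℝ)) =
      fun p => ((-(f p * h p * α p (X p)), f p * h p * α p (Y p)) : ℝ × ℝ) := by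
    funext p
    rw [e1, e1]
  have e3 : (fun p => f p • β p : OneForm 𝓘(ℝ, E) M) = fun p => (f p * h p) • α p := by
    funext p
    exact smul_smul _ _ _
  rw [e2] at hbook
  rw [e2, e3] at hadapt
  refine ⟨fun p => f p * h p, fun p => mul_pos (hf0 p) (hh0 p), fun F hF hFX hFY p v => ?_,
    hbook, hadapt⟩
  have h2 := invariant_of_bracketTerm_eq_one hβ hX hY h1 hF hFX hFY
  have h3 := hfinv F h2 hFX hFY p
  rw [← e1, ← e1, h3, h2]

end OpenBook

/-! ### Local diffeomorphisms onto quotients. -/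

section Quotients

/-- The projection to the quotient by a free, properly discontinuous, smooth action is a local
diffeomorphism. -/
theorem isLocalDiffeomorph_quotientMk {E H M G : Type*} [NormedAddCommGroup E] [NormedSpace ℝ E]
    [TopologicalSpace H] (I : ModelWithCorners ℝ E H) [TopologicalSpace M] [ChartedSpace H M]
    [IsManifold I ∞ M] [Group G] [MulAction G M] [ProperlyDiscontinuousSMul G M]
    [ContinuousConstSMul G M] [IsCancelSMul G M] [T2Space M] [LocallyCompactSpace M]
    (hG : ∀ g : G, ContMDiff I I ∞ (fun x : M => g • x)) :
    IsLocalDiffeomorph I I ∞ (fun x : M => (Quotient.mk _ x : MulAction.orbitRel.Quotient G M)) := by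
  have := isManifold_orbitQuotient I hG
  have hQ : IsLocalHomeomorph (Quotient.mk (MulAction.orbitRel G M)) :=
    isQuotientCoveringMap_quotientMk_of_properlyDiscontinuousSMul.isCoveringMap.isLocalHomeomorph
  intro x
  set q : MulAction.orbitRel.Quotient G M := Quotient.mk _ x with hq
  -- The chart at `q` is the chart of one chosen preimage `x'`. At `x'` the projection is therefore
  -- the identity in charts, and the group element carrying `x` to `x'` transports the conclusion.
  obtain ⟨x', hx', hc⟩ : ∃ x' : M, (Quotient.mk _ x' : MulAction.orbitRel.Quotient G M) = q ∧
      chartAt H q = (hQ.localInverseAt x').trans (chartAt H x') :=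
    ⟨_, Quotient.mk_surjective.hasRightInverse.choose_spec q, rfl⟩
  obtain ⟨g, hg⟩ : ∃ g : G, g • x = x' := Quotient.exact (hx'.trans hq)
  have h1 : IsLocalDiffeomorphAt I I ∞
      (fun y : M => (Quotient.mk _ y : MulAction.orbitRel.Quotient G M)) (g • x) := by
    rw [hg]
    refine ⟨{ toPartialEquiv := ((chartAt H x').trans (chartAt H q).symm).toPartialEquiv
              open_source := ((chartAt H x').trans (chartAt H q).symm).open_source
              open_target := ((chartAt H x').trans (chartAt H q).symm).open_target
              contMDiffOn_toFun := contMDiffOn_chart_symm.comp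
                (contMDiffOn_chart.mono inter_subset_left) inter_subset_right
              contMDiffOn_invFun := contMDiffOn_chart_symm.comp
                (contMDiffOn_chart.mono inter_subset_left) inter_subset_right }, ?_, ?_⟩
    · refine ⟨mem_chart_source H x', ?_⟩
      change chartAt H x' x' ∈ (chartAt H q).target
      rw [hc]
      simp
    · rintro y ⟨hy, -⟩
      change _ = (chartAt H q).symm (chartAt H x' y)
      rw [hc]
      simp only [OpenPartialHomeomorph.coe_trans_symm, Function.comp_apply,
        IsLocalHomeomorph.localInverseAt_symm]
      rw [(chartAt H x').left_inv hy]
  have h3 : IsLocalDiffeomorphAt I I ∞ (fun y : M => g • y) x := by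
    let Φ : M ≃ₘ⟮I, I⟯ M :=
      { toFun := fun y => g • y
        invFun := fun y => g⁻¹ • y
        left_inv := inv_smul_smul g
        right_inv := smul_inv_smul g
        contMDiff_toFun := hG g
        contMDiff_invFun := hG g⁻¹ }
    exact Φ.isLocalDiffeomorph x
  have h4 := h3.comp I _ h1
  have h5 : (fun y : M => (Quotient.mk _ y : MulAction.orbitRel.Quotient G M)) ∘
      (fun y : M => g • y) = fun y : M => (Quotient.mk _ y : MulAction.orbitRel.Quotient G M) := by
    funext y
    exact Quotient.sound ⟨g, rfl⟩
  rwa [h5] at h4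

theorem IsLocalDiffeomorphAt.isInvertible_mfderiv {E F H H' M N : Type*} [NormedAddCommGroup E]
    [NormedSpace ℝ E] [NormedAddCommGroup F] [NormedSpace ℝ F] [TopologicalSpace H]
    [TopologicalSpace H'] {I : ModelWithCorners ℝ E H} {J : ModelWithCorners ℝ F H'}
    [TopologicalSpace M] [ChartedSpace H M] [TopologicalSpace N] [ChartedSpace H' N]
    {f : M → N} {x : M} (hf : IsLocalDiffeomorphAt I J ∞ f x) :
    (mfderiv I J f x).IsInvertible :=
  ⟨hf.mfderivToContinuousLinearEquiv (by simp), hf.mfderivToContinuousLinearEquiv_coe (by simp)⟩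

/-- A vector field which lifts to a smooth vector field under a surjective local diffeomorphism is
smooth. -/
theorem IsSmoothVectorField.of_lift {E H H' M N : Type*} [NormedAddCommGroup E]
    [NormedSpace ℝ E] [TopologicalSpace H] [TopologicalSpace H'] {I : ModelWithCorners ℝ E H}
    {J : ModelWithCorners ℝ E H'}
    [TopologicalSpace M] [ChartedSpace H M] [TopologicalSpace N] [ChartedSpace H' N]
    [IsManifold I ∞ M] [IsManifold J ∞ N]
    {f : M → N} (hf : IsLocalDiffeomorph I J ∞ f) (hsurj : Function.Surjective f)
    {Z : (p : M) → TangentSpace I p} (hZ : IsSmoothVectorField I Z)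
    {Z' : (p : N) → TangentSpace J p} (h : ∀ p, mfderiv I J f p (Z p) = Z' (f p)) :
    IsSmoothVectorField J Z' := by
  intro y
  obtain ⟨x, rfl⟩ := hsurj y
  have h1 := (hf x).localInverse_contMDiffAt
  have hx : (hf x).localInverse (f x) = x :=
    (hf x).localInverse_left_inv (hf x).localInverse_mem_target
  have h2 : ContMDiffAt J I.tangent ∞ (fun y => (⟨(hf x).localInverse y,
      Z ((hf x).localInverse y)⟩ : TangentBundle I M)) (f x) :=
    ContMDiffAt.comp (f x) (hZ _) h1
  have h3 : ContMDiff I.tangent J.tangent ∞ (tangentMap I J f) :=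
    hf.contMDiff.contMDiff_tangentMap (by simp)
  refine (h3.contMDiffAt.comp (f x) h2).congr_of_eventuallyEq ?_
  filter_upwards [(hf x).localInverse_eventuallyEq_right] with y hy
  have hy' : f ((hf x).localInverse y) = y := hy
  change (⟨y, Z' y⟩ : TangentBundle J N) =
    ⟨f ((hf x).localInverse y), mfderiv I J f _ (Z ((hf x).localInverse y))⟩
  rw [h, hy']

end Quotients

/-! ### Lie brackets with constant fields on a product. -/

section ProductBracket

variable {E F M : Type*} [NormedAddCommGroup E] [NormedSpace ℝ E] [NormedAddCommGroup F]
  [NormedSpace ℝ F] [TopologicalSpace M] [ChartedSpace E M] [IsManifold 𝓘(ℝ, E) ∞ M]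

/-- The vector field `(w, s)` on `M × F`, where `s` is constant. -/
def prodField (w : M × F → E) (s : F) (z : M × F) : TangentSpace (𝓘(ℝ, E).prod 𝓘(ℝ, F)) z :=
  (w z, s)

/-- The chart of `M × F` is the chart of `M` times the identity, so passing to coordinates affects
only the `M`-component of the field. -/
theorem mpullbackWithin_extChartAt_symm_prod (w : M × F → E) (s : F) (x : M × F) {y : E × F}
    (hy : y.1 ∈ (extChartAt 𝓘(ℝ, E) x.1).target) :
    VectorField.mpullbackWithin 𝓘(ℝ, E × F) (𝓘(ℝ, E).prod 𝓘(ℝ, F))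
        (extChartAt (𝓘(ℝ, E).prod 𝓘(ℝ, F)) x).symm (prodField w s)
        (range (𝓘(ℝ, E).prod 𝓘(ℝ, F))) y =
      (((mfderiv 𝓘(ℝ, E) 𝓘(ℝ, E) (extChartAt 𝓘(ℝ, E) x.1).symm y.1).inverse
        (w ((extChartAt 𝓘(ℝ, E) x.1).symm y.1, y.2)), s) : E × F) := by
  have hr : range (𝓘(ℝ, E).prod 𝓘(ℝ, F)) = univ := ModelWithCorners.Boundaryless.range_eq_univ
  have hr1 : range 𝓘(ℝ, E) = univ := ModelWithCorners.Boundaryless.range_eq_univ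
  have hyx : y ∈ (extChartAt (𝓘(ℝ, E).prod 𝓘(ℝ, F)) x).target := by
    rw [extChartAt_prod, extChartAt_model_space_eq_id]
    exact ⟨hy, mem_univ _⟩
  have : IsManifold 𝓘(ℝ, E) 1 M := IsManifold.of_le (n := ∞) (by simp)
  have : IsManifold (𝓘(ℝ, E).prod 𝓘(ℝ, F)) 1 (M × F) := inferInstance
  have hinv := isInvertible_mfderivWithin_extChartAt_symm hyx
  have hinv1 := isInvertible_mfderivWithin_extChartAt_symm hy
  have hd1 := mdifferentiableWithinAt_extChartAt_symm hy
  rw [hr1, mdifferentiableWithinAt_univ] at hd1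
  rw [hr1, mfderivWithin_univ] at hinv1
  have hfun : ((extChartAt (𝓘(ℝ, E).prod 𝓘(ℝ, F)) x).symm : E × F → M × F) =
      Prod.map (extChartAt 𝓘(ℝ, E) x.1).symm id := by
    rw [extChartAt_prod, extChartAt_model_space_eq_id]
    rfl
  have hD : mfderiv 𝓘(ℝ, E × F) (𝓘(ℝ, E).prod 𝓘(ℝ, F))
      (extChartAt (𝓘(ℝ, E).prod 𝓘(ℝ, F)) x).symm y =
      (mfderiv 𝓘(ℝ, E) 𝓘(ℝ, E) (extChartAt 𝓘(ℝ, E) x.1).symm y.1).prodMap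
        (ContinuousLinearMap.id ℝ F) := by
    rw [hfun, modelWithCornersSelf_prod, ← chartedSpaceSelf_prod]
    refine (mfderiv_prodMap hd1 mdifferentiableAt_id).trans ?_
    rw [mfderiv_id]
    rfl
  rw [VectorField.mpullbackWithin_apply, hr, mfderivWithin_univ]
  rw [hr, mfderivWithin_univ] at hinv
  refine hinv.inverse_apply_eq.2 ?_
  rw [hD]
  set L : E →L[ℝ] E := mfderiv 𝓘(ℝ, E) 𝓘(ℝ, E) (extChartAt 𝓘(ℝ, E) x.1).symm y.1
  have h2 : w ((extChartAt 𝓘(ℝ, E) x.1).symm y.1, y.2) =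
      L (L.inverse (w ((extChartAt 𝓘(ℝ, E) x.1).symm y.1, y.2))) :=
    (ContinuousLinearMap.IsInvertible.inverse_apply_eq (f := L) hinv1).1 rfl
  have h3 : (extChartAt (𝓘(ℝ, E).prod 𝓘(ℝ, F)) x).symm y =
    ((extChartAt 𝓘(ℝ, E) x.1).symm y.1, y.2) := congrFun hfun y
  rw [h3]
  exact Prod.ext h2 rfl

/-- A field tangent to the first factor of `M × F` which commutes with a constant field `s` of the
second factor is invariant under the translation by `s`. -/
theorem apply_add_of_mlieBracket_eq_zero [FiniteDimensional ℝ E] [FiniteDimensional ℝ F]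
    {w : M × F → E}
    (hw : IsSmoothVectorField (𝓘(ℝ, E).prod 𝓘(ℝ, F)) (prodField w 0))
    {s : F}
    (h : ∀ x, VectorField.mlieBracket (𝓘(ℝ, E).prod 𝓘(ℝ, F))
      (prodField 0 s) (prodField w 0) x = 0) (p : M) (t : F) :
    w (p, t + s) = w (p, t) := by
  have : CompleteSpace E := FiniteDimensional.complete ℝ E
  have : CompleteSpace F := FiniteDimensional.complete ℝ F
  have : IsManifold 𝓘(ℝ, E) 1 M := IsManifold.of_le (n := ∞) (by simp)
  have : IsManifold (𝓘(ℝ, E).prod 𝓘(ℝ, F)) 1 (M × F) := inferInstance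
  have : IsManifold 𝓘(ℝ, E) 2 M := inferInstance
  have : IsManifold (𝓘(ℝ, E).prod 𝓘(ℝ, F)) 2 (M × F) := inferInstance
  have hr : range (𝓘(ℝ, E).prod 𝓘(ℝ, F)) = univ := ModelWithCorners.Boundaryless.range_eq_univ
  have hr1 : range 𝓘(ℝ, E) = univ := ModelWithCorners.Boundaryless.range_eq_univ
  -- All points `(p, t + r • s)` lie over the same `p`, so `w` takes values in the fixed space `T_p
  -- M` along this line and its derivative makes sense.
  have key : ∀ t : F, HasDerivAt (fun r : ℝ => w (p, t + r • s)) 0 0 := by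
    intro t
    have h1 := h (p, t)
    rw [← VectorField.mlieBracketWithin_univ, VectorField.mlieBracketWithin_apply] at h1
    replace h1 :=
      (isInvertible_mfderiv_extChartAt (mem_extChartAt_source _)).inverse_apply_eq.1 h1
    rw [map_zero, preimage_univ, hr, univ_inter] at h1
    set y₀ : E × F := extChartAt (𝓘(ℝ, E).prod 𝓘(ℝ, F)) (p, t) (p, t) with hy₀
    have hy₀' : y₀ = (extChartAt 𝓘(ℝ, E) p p, t) := by
      rw [hy₀, extChartAt_prod, extChartAt_model_space_eq_id]
      rfl
    set V : E × F → E × F := VectorField.mpullbackWithin 𝓘(ℝ, E × F) (𝓘(ℝ, E).prod 𝓘(ℝ, F))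
        (extChartAt (𝓘(ℝ, E).prod 𝓘(ℝ, F)) (p, t)).symm (prodField 0 s) univ with hV
    set W : E × F → E × F := VectorField.mpullbackWithin 𝓘(ℝ, E × F) (𝓘(ℝ, E).prod 𝓘(ℝ, F))
        (extChartAt (𝓘(ℝ, E).prod 𝓘(ℝ, F)) (p, t)).symm (prodField w 0) univ with hW
    have hWd : DifferentiableAt ℝ W y₀ := by
      have h2 := MDifferentiableWithinAt.differentiableWithinAt_mpullbackWithin_vectorField
        (s := univ) ((hw.mdifferentiable (by simp) (p, t)).mdifferentiableWithinAt)
      rw [preimage_univ, hr, univ_inter] at h2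
      exact h2.differentiableAt Filter.univ_mem
    have hVeq : V =ᶠ[𝓝 y₀] fun _ => (0, s) := by
      have h2 : ∀ᶠ y : E × F in 𝓝 y₀, y.1 ∈ (extChartAt 𝓘(ℝ, E) p).target := by
        have h3 : y₀.1 ∈ (extChartAt 𝓘(ℝ, E) p).target := by
          rw [hy₀']; exact mem_extChartAt_target p
        exact continuous_fst.continuousAt.eventually
          ((isOpen_extChartAt_target p).mem_nhds h3)
      filter_upwards [h2] with y hy
      have h3 := mpullbackWithin_extChartAt_symm_prod 0 s (p, t) hy
      rw [hr] at h3
      exact h3.trans (Prod.ext (map_zero (mfderiv 𝓘(ℝ, E) 𝓘(ℝ, E) (extChartAt 𝓘(ℝ, E) p).symm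
        y.1).inverse) rfl)
    -- In the chart the field `s` is constant, so the bracket is just the derivative of `W` in the
    -- direction `(0, s)`.
    have h2 : fderiv ℝ W y₀ (0, s) = 0 := by
      have h3 : fderivWithin ℝ W univ y₀ (V y₀) - fderivWithin ℝ V univ y₀ (W y₀) = 0 := h1
      rw [fderivWithin_univ, fderivWithin_univ, hVeq.fderiv_eq, hVeq.self_of_nhds, fderiv_const_apply] at h3
      simpa using h3
    set L : E →L[ℝ] E := mfderiv 𝓘(ℝ, E) 𝓘(ℝ, E) (extChartAt 𝓘(ℝ, E) p).symm
      (extChartAt 𝓘(ℝ, E) p p) with hL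
    have hLinv : L.IsInvertible := by
      have h3 := isInvertible_mfderivWithin_extChartAt_symm
        (mem_extChartAt_target (I := 𝓘(ℝ, E)) p)
      rw [hr1, mfderivWithin_univ] at h3
      exact h3
    have h4 : ∀ r : ℝ, W (y₀ + r • (0, s)) = (L.inverse (w (p, t + r • s)), 0) := by
      intro r
      have h5 : y₀ + r • ((0, s) : E × F) = (extChartAt 𝓘(ℝ, E) p p, t + r • s) := by
        rw [hy₀']; simp
      rw [h5]
      have h3 := mpullbackWithin_extChartAt_symm_prod w 0 (p, t)
        (y := (extChartAt 𝓘(ℝ, E) p p, t + r • s)) (mem_extChartAt_target p)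
      rw [hr, extChartAt_to_inv] at h3
      exact h3
    have h5 : HasDerivAt (fun r : ℝ => W (y₀ + r • (0, s))) (fderiv ℝ W y₀ (0, s)) 0 := by
      have h6 : HasDerivAt (fun r : ℝ => y₀ + r • ((0, s) : E × F)) (0, s) 0 := by
        simpa using ((hasDerivAt_id (0 : ℝ)).smul_const ((0, s) : E × F)).const_add y₀
      have h7 : HasFDerivAt W (fderiv ℝ W y₀) (y₀ + (0 : ℝ) • ((0, s) : E × F)) := by
        simpa using hWd.hasFDerivAt
      exact h7.comp_hasDerivAt 0 h6
    rw [h2] at h5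
    have h6 := (L.hasFDerivAt.comp_hasDerivAt (0 : ℝ)
      ((ContinuousLinearMap.fst ℝ E F).hasFDerivAt.comp_hasDerivAt (0 : ℝ) h5))
    have h7 : (L ∘ (ContinuousLinearMap.fst ℝ E F) ∘ fun r : ℝ => W (y₀ + r • (0, s))) =
        fun r : ℝ => w (p, t + r • s) := by
      funext r
      change L (W (y₀ + r • (0, s))).1 = _
      rw [h4]
      exact ((hLinv.inverse_apply_eq (y := w (p, t + r • s))).1 rfl).symm
    rw [h7] at h6
    simpa using h6
  -- `key` concerns only the parameter `0`; recentring at `(p, t + r • s)` gives all other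
  -- parameters.
  have key2 : ∀ r : ℝ, HasDerivAt (fun r : ℝ => w (p, t + r • s)) 0 r := by
    intro r
    have h1 := key (t + r • s)
    have h2 : HasDerivAt (fun a : ℝ => a - r) 1 r := (hasDerivAt_id r).sub_const r
    have h1' : HasDerivAt (fun a : ℝ => w (p, t + r • s + a • s)) 0 (r - r) := by
      rw [sub_self]; exact h1
    have h3 := HasDerivAt.scomp (h := fun a : ℝ => a - r) r h1' h2
    have h4 : ((fun a : ℝ => w (p, t + r • s + a • s)) ∘ fun a : ℝ => a - r) =
        fun a : ℝ => w (p, t + a • s) := by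
      funext a
      simp only [Function.comp_apply, sub_smul]
      congr 2
      abel
    rw [h4, smul_zero] at h3
    exact h3
  have h1 := is_const_of_deriv_eq_zero (fun r => (key2 r).differentiableAt)
    (fun r => (key2 r).deriv) 1 0
  simpa using h1

end ProductBracket

/-! ### Constant vector fields on the torus. -/

section TorusCover

theorem isLocalDiffeomorph_torusCover :
    IsLocalDiffeomorph 𝓘(ℝ, ℝ × ℝ) 𝓘(ℝ, ℝ × ℝ) ∞ torusCover :=
  isLocalDiffeomorph_quotientMk _ contMDiff_plane_smul

theorem torusCover_surjective : Function.Surjective torusCover := Quotient.mk_surjective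

theorem mfderiv_plane_smul (c : TorusGroup) (t : ℝ × ℝ) :
    mfderiv 𝓘(ℝ, ℝ × ℝ) 𝓘(ℝ, ℝ × ℝ) (fun t : ℝ × ℝ => c • t) t = ContinuousLinearMap.id ℝ (ℝ × ℝ) := by
  rw [mfderiv_eq_fderiv]
  exact (fderiv_add_const (latticeVector c)).trans fderiv_id

/-- Differentiate `q ∘ c = q`, where the translation `c` has identity differential. The equality is
in the tangent bundle because the two base points are equal but not definitionally so. -/
theorem mfderiv_torusCover_smul (c : TorusGroup) (t s : ℝ × ℝ) :
    (⟨torusCover (c • t), mfderiv 𝓘(ℝ, ℝ × ℝ) 𝓘(ℝ, ℝ × ℝ) torusCover (c • t) s⟩ :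
      TangentBundle 𝓘(ℝ, ℝ × ℝ) Torus) =
      ⟨torusCover t, mfderiv 𝓘(ℝ, ℝ × ℝ) 𝓘(ℝ, ℝ × ℝ) torusCover t s⟩ := by
  have h1 : torusCover ∘ (fun t : ℝ × ℝ => c • t) = torusCover := by
    funext t
    exact Quotient.sound ⟨c, rfl⟩
  have h2 := congrFun (tangentMap_comp
    (isLocalDiffeomorph_torusCover.mdifferentiable (by simp))
    ((contMDiff_plane_smul c).mdifferentiable (by simp))) ⟨t, s⟩
  rw [h1] at h2
  refine Eq.trans ?_ h2.symm
  change _ = (⟨torusCover (c • t), mfderiv 𝓘(ℝ, ℝ × ℝ) 𝓘(ℝ, ℝ × ℝ) torusCover (c • t)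
    (mfderiv 𝓘(ℝ, ℝ × ℝ) 𝓘(ℝ, ℝ × ℝ) (fun t : ℝ × ℝ => c • t) t s)⟩ :
    TangentBundle 𝓘(ℝ, ℝ × ℝ) Torus)
  rw [mfderiv_plane_smul]
  rfl

/-- The vector field on the torus with constant lift `s` to the plane. -/
noncomputable def torusField (s : ℝ × ℝ) (b : Torus) : TangentSpace 𝓘(ℝ, ℝ × ℝ) b :=
  (mfderiv 𝓘(ℝ, ℝ × ℝ) 𝓘(ℝ, ℝ × ℝ) torusCover (Quotient.out b) s : ℝ × ℝ)

theorem torusField_torusCover (s t : ℝ × ℝ) :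
    torusField s (torusCover t) = mfderiv 𝓘(ℝ, ℝ × ℝ) 𝓘(ℝ, ℝ × ℝ) torusCover t s := by
  obtain ⟨c, hc⟩ : ∃ c : TorusGroup, c • t = Quotient.out (torusCover t) :=
    Quotient.exact (Quotient.out_eq (torusCover t))
  have h1 := mfderiv_torusCover_smul c t s
  rw [hc] at h1
  exact eq_of_heq (Bundle.TotalSpace.mk.inj h1).2

theorem isSmoothVectorField_torusField (s : ℝ × ℝ) :
    IsSmoothVectorField 𝓘(ℝ, ℝ × ℝ) (torusField s) := by
  refine IsSmoothVectorField.of_lift isLocalDiffeomorph_torusCover torusCover_surjective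
    (Z := fun _ => s) ?_ fun t => (torusField_torusCover s t).symm
  exact contMDiff_vectorSpace_iff_contDiff.2 contDiff_const

theorem liftToPlane_torusField (s : ℝ × ℝ) : liftToPlane (torusField s) = fun _ => s := by
  funext t
  unfold liftToPlane
  rw [torusField_torusCover]
  exact (isLocalDiffeomorph_torusCover t).isInvertible_mfderiv.inverse_apply_eq.2 rfl

/-- The lift to the plane is constant. These fields turn parallelism of `A` into the vanishing of
Lie brackets. -/
theorem torusNabla_torusField (s s' t : ℝ × ℝ) :
    torusNabla (torusField s) (torusField s') t = 0 := by
  unfold torusNabla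
  rw [liftToPlane_torusField, liftToPlane_torusField, fderiv_const_apply]
  exact map_zero _

end TorusCover

/-! ### The differential of the covering of the flat bundle. -/

section BundleCover

variable {E M : Type*} [NormedAddCommGroup E] [NormedSpace ℝ E] [TopologicalSpace M]
  [ChartedSpace E M] (ρ : TorusGroup →* (M ≃ₘ⟮𝓘(ℝ, E), 𝓘(ℝ, E)⟯ M))

theorem bundleCover_surjective : Function.Surjective (bundleCover ρ) := Quotient.mk_surjective

variable [IsManifold 𝓘(ℝ, E) ∞ M] [T2Space M] [LocallyCompactSpace M]

theorem isLocalDiffeomorph_bundleCover :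
    IsLocalDiffeomorph (bundleModel E) (bundleModel E) ∞ (bundleCover ρ) :=
  isLocalDiffeomorph_quotientMk _ (Cover.contMDiff_smul ρ)

theorem isInvertible_mfderiv_bundleCover (x : Cover ρ) :
    (mfderiv (bundleModel E) (bundleModel E) (bundleCover ρ) x).IsInvertible :=
  (isLocalDiffeomorph_bundleCover ρ x).isInvertible_mfderiv

/-- Differentiate `Q ∘ c = Q`; the diagonal action has differential `dρ(c)` on `M` and the identity
on `ℝ²`. -/
theorem dCover_smul (c : TorusGroup) (x : Cover ρ) (u : TangentSpace 𝓘(ℝ, E) x.1) (s : ℝ × ℝ) :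
    (⟨bundleCover ρ (c • x), dCover ρ (c • x) (mfderiv 𝓘(ℝ, E) 𝓘(ℝ, E) (ρ c) x.1 u) s⟩ :
      TangentBundle (bundleModel E) (FlatBundle ρ)) = ⟨bundleCover ρ x, dCover ρ x u s⟩ := by
  have h1 : bundleCover ρ ∘ (fun x : Cover ρ => c • x) = bundleCover ρ := by
    funext x
    exact Quotient.sound ⟨c, rfl⟩
  have h2 := congrFun (tangentMap_comp
    ((isLocalDiffeomorph_bundleCover ρ).mdifferentiable (by simp))
    ((Cover.contMDiff_smul ρ c).mdifferentiable (by simp))) ⟨x, (u, s)⟩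
  rw [h1] at h2
  refine Eq.trans ?_ h2.symm
  have h3 : mfderiv (bundleModel E) (bundleModel E) (fun x : Cover ρ => c • x) x =
      (mfderiv 𝓘(ℝ, E) 𝓘(ℝ, E) (ρ c) x.1).prodMap (ContinuousLinearMap.id ℝ (ℝ × ℝ)) := by
    have h4 := mfderiv_prodMap (p := (x : M × (ℝ × ℝ))) (f := ρ c)
      (g := fun t : ℝ × ℝ => c • t) ((ρ c).mdifferentiable (by simp) x.1)
      ((contMDiff_plane_smul c).mdifferentiable (by simp) x.2)
    rw [mfderiv_plane_smul] at h4
    exact h4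
  have h5 : mfderiv (bundleModel E) (bundleModel E) (fun x : Cover ρ => c • x) x (u, s) =
      (mfderiv 𝓘(ℝ, E) 𝓘(ℝ, E) (ρ c) x.1 u, s) := by
    rw [h3]; rfl
  change _ = (⟨bundleCover ρ (c • x), mfderiv (bundleModel E) (bundleModel E) (bundleCover ρ)
    (c • x) (mfderiv (bundleModel E) (bundleModel E) (fun x : Cover ρ => c • x) x (u, s))⟩ :
    TangentBundle (bundleModel E) (FlatBundle ρ))
  rw [h5]
  rfl

theorem dCover_injective (x : Cover ρ) {u u' : TangentSpace 𝓘(ℝ, E) x.1} {s s' : ℝ × ℝ}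
    (h : dCover ρ x u s = dCover ρ x u' s') : u = u' ∧ s = s' := by
  obtain ⟨e, he⟩ := isInvertible_mfderiv_bundleCover ρ x
  have h2 : ∀ z, mfderiv (bundleModel E) (bundleModel E) (bundleCover ρ) x z = e z := fun z => by
    rw [← he]; rfl
  have h1 : e (u, s) = e (u', s') := (h2 _).symm.trans (h.trans (h2 _))
  exact Prod.mk.inj (e.injective h1)

theorem exists_dCover_eq (x : Cover ρ) (w : TangentSpace (bundleModel E) (bundleCover ρ x)) :
    ∃ (u : TangentSpace 𝓘(ℝ, E) x.1) (s : ℝ × ℝ), w = dCover ρ x u s := by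
  obtain ⟨e, he⟩ := isInvertible_mfderiv_bundleCover ρ x
  obtain ⟨⟨u, s⟩, h⟩ := e.surjective w
  refine ⟨u, s, h.symm.trans ?_⟩
  unfold dCover
  rw [← he]
  rfl

theorem dCover_add (x : Cover ρ) (u u' : TangentSpace 𝓘(ℝ, E) x.1) (s s' : ℝ × ℝ) :
    dCover ρ x (u + u') (s + s') = dCover ρ x u s + dCover ρ x u' s' :=
  map_add (mfderiv (bundleModel E) (bundleModel E) (bundleCover ρ) x) (u, s) (u', s')

/-- Near a point, `π` is a local inverse of `Q` followed by the projection to `ℝ²` and the covering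
of the torus. -/
theorem mdifferentiableAt_bundleProj (x : Cover ρ) :
    MDifferentiableAt (bundleModel E) 𝓘(ℝ, ℝ × ℝ) (bundleProj ρ) (bundleCover ρ x) := by
  have hf := isLocalDiffeomorph_bundleCover ρ x
  have h1 : MDifferentiableAt (bundleModel E) 𝓘(ℝ, ℝ × ℝ) (fun y : Cover ρ => y.2)
      (hf.localInverse (bundleCover ρ x)) :=
    mdifferentiableAt_snd (M := M) (M' := ℝ × ℝ)
  have h2 := ((isLocalDiffeomorph_torusCover.mdifferentiable (by simp) _).comp _ h1).comp
    (bundleCover ρ x) (hf.localInverse_mdifferentiableAt (by simp))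
  refine h2.congr_of_eventuallyEq ?_
  filter_upwards [hf.localInverse_eventuallyEq_right] with y hy
  have hy' : bundleCover ρ (hf.localInverse y) = y := hy
  change bundleProj ρ y = torusCover (hf.localInverse y).2
  rw [← bundleProj_bundleCover, hy']

theorem dProj_dCover (x : Cover ρ) (u : TangentSpace 𝓘(ℝ, E) x.1) (s : ℝ × ℝ) :
    dProj ρ (bundleCover ρ x) (dCover ρ x u s) =
      mfderiv 𝓘(ℝ, ℝ × ℝ) 𝓘(ℝ, ℝ × ℝ) torusCover x.2 s := by
  have h1 := mfderiv_comp x (mdifferentiableAt_bundleProj ρ x)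
    ((isLocalDiffeomorph_bundleCover ρ).mdifferentiable (by simp) x)
  have h2 := mfderiv_comp (I := bundleModel E) x (f := fun y : Cover ρ => y.2)
    (isLocalDiffeomorph_torusCover.mdifferentiable (by simp) x.2)
    (mdifferentiableAt_snd (M := M) (M' := ℝ × ℝ))
  have h3 : mfderiv (bundleModel E) 𝓘(ℝ, ℝ × ℝ) (fun y : Cover ρ => y.2) x =
      ContinuousLinearMap.snd ℝ E (ℝ × ℝ) := mfderiv_snd (M := M) (M' := ℝ × ℝ)
  rw [h3] at h2
  exact congrArg (fun L : E × (ℝ × ℝ) →L[ℝ] ℝ × ℝ => L (u, s)) (h1.symm.trans h2)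

theorem dProj_dCover_eq_zero_iff (x : Cover ρ) (u : TangentSpace 𝓘(ℝ, E) x.1) (s : ℝ × ℝ) :
    dProj ρ (bundleCover ρ x) (dCover ρ x u s) = 0 ↔ s = 0 := by
  rw [dProj_dCover]
  obtain ⟨e, he⟩ := (isLocalDiffeomorph_torusCover x.2).isInvertible_mfderiv
  have h2 : mfderiv 𝓘(ℝ, ℝ × ℝ) 𝓘(ℝ, ℝ × ℝ) torusCover x.2 s = e s := by
    rw [← he]; rfl
  rw [h2]
  exact e.map_eq_zero_iff

/-- The horizontal lift of `torusField s` for the flat connection. -/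
noncomputable def flatField (s : ℝ × ℝ) (v : FlatBundle ρ) : TangentSpace (bundleModel E) v :=
  (dCover ρ (Quotient.out v) 0 s : E × (ℝ × ℝ))

theorem flatField_bundleCover (s : ℝ × ℝ) (x : Cover ρ) :
    flatField ρ s (bundleCover ρ x) = dCover ρ x 0 s := by
  obtain ⟨c, hc⟩ : ∃ c : TorusGroup, c • x = Quotient.out (bundleCover ρ x) :=
    Quotient.exact (Quotient.out_eq (bundleCover ρ x))
  have h1 := dCover_smul ρ c x 0 s
  rw [map_zero, hc] at h1
  exact eq_of_heq (Bundle.TotalSpace.mk.inj h1).2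

/-- The vector field `(w, s)` on `M × ℝ²`, where `s` is constant. -/
def coverField (w : Cover ρ → E) (s : ℝ × ℝ) (x : Cover ρ) : TangentSpace (bundleModel E) x :=
  (w x, s)

theorem isSmoothVectorField_coverField_const (s : ℝ × ℝ) :
    IsSmoothVectorField (bundleModel E) (coverField ρ 0 s) := by
  have h1 : ContMDiff (bundleModel E) ((𝓘(ℝ, E).tangent).prod (𝓘(ℝ, ℝ × ℝ).tangent)) ∞
      (fun x : M × (ℝ × ℝ) => ((⟨x.1, 0⟩, ⟨x.2, s⟩) :
        TangentBundle 𝓘(ℝ, E) M × TangentBundle 𝓘(ℝ, ℝ × ℝ) (ℝ × ℝ))) := by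
    refine ContMDiff.prodMk ?_ ?_
    · exact (Bundle.contMDiff_zeroSection ℝ (TangentSpace 𝓘(ℝ, E) (M := M))).comp contMDiff_fst
    · exact (contMDiff_vectorSpace_iff_contDiff.2 contDiff_const).comp contMDiff_snd
  exact contMDiff_equivTangentBundleProd_symm.comp h1

theorem isSmoothVectorField_flatField (s : ℝ × ℝ) :
    IsSmoothVectorField (bundleModel E) (flatField ρ s) :=
  IsSmoothVectorField.of_lift (isLocalDiffeomorph_bundleCover ρ) (bundleCover_surjective ρ)
    (isSmoothVectorField_coverField_const ρ s) fun x => (flatField_bundleCover ρ s x).symm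

end BundleCover

/-! ### Parallel potentials come from vector fields on the fibre. -/

section ParallelPotential

variable {E M : Type*} [NormedAddCommGroup E] [NormedSpace ℝ E] [TopologicalSpace M]
  [ChartedSpace E M] {ρ : TorusGroup →* (M ≃ₘ⟮𝓘(ℝ, E), 𝓘(ℝ, E)⟯ M)}
  [IsManifold 𝓘(ℝ, E) ∞ M] [T2Space M] [LocallyCompactSpace M]

/-- The value of a parallel potential on a constant vector field of the torus is induced by an
invariant vector field on the fibre. -/
theorem IsParallel.exists_field [FiniteDimensional ℝ E] {A : FibreForm ρ}
    (hs : ∀ U : (b : Torus) → TangentSpace 𝓘(ℝ, ℝ × ℝ) b, IsSmoothVectorField 𝓘(ℝ, ℝ × ℝ) U →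
      IsSmoothVectorField (bundleModel E) (fun v => A v (U (bundleProj ρ v))))
    (hv : ∀ v u, dProj ρ v (A v u) = 0) (hA : IsParallel A) (s : ℝ × ℝ) :
    ∃ X : (p : M) → TangentSpace 𝓘(ℝ, E) p, IsSmoothVectorField 𝓘(ℝ, E) X ∧
      (∀ x : Cover ρ, A (bundleCover ρ x) (mfderiv 𝓘(ℝ, ℝ × ℝ) 𝓘(ℝ, ℝ × ℝ) torusCover x.2 s) =
        dCover ρ x (X x.1) 0) ∧
      ∀ c p, mfderiv 𝓘(ℝ, E) 𝓘(ℝ, E) (ρ c) p (X p) = X (ρ c p) := by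
  have : CompleteSpace E := FiniteDimensional.complete ℝ E
  set V : (v : FlatBundle ρ) → TangentSpace (bundleModel E) v :=
    fun v => A v (torusField s (bundleProj ρ v)) with hV
  have hVs : IsSmoothVectorField (bundleModel E) V := hs _ (isSmoothVectorField_torusField s)
  have hVx : ∀ x : Cover ρ, V (bundleCover ρ x) =
      A (bundleCover ρ x) (mfderiv 𝓘(ℝ, ℝ × ℝ) 𝓘(ℝ, ℝ × ℝ) torusCover x.2 s) := fun x =>
    congrArg (A (bundleCover ρ x)) (torusField_torusCover s x.2)
  -- The values of the potential are vertical, so their lifts to `M × ℝ²` have no component along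
  -- `ℝ²`.
  have hw : ∀ x : Cover ρ, ∃ u : TangentSpace 𝓘(ℝ, E) x.1, V (bundleCover ρ x) = dCover ρ x u 0 := by
    intro x
    obtain ⟨u, r, hur⟩ := exists_dCover_eq ρ x (V (bundleCover ρ x))
    have h1 : dProj ρ (bundleCover ρ x) (dCover ρ x u r) = 0 := by
      rw [← hur]; exact hv _ _
    rw [dProj_dCover_eq_zero_iff] at h1
    subst h1
    exact ⟨u, hur⟩
  choose w hw using hw
  have hpull : VectorField.mpullback (bundleModel E) (bundleModel E) (bundleCover ρ) V =
      coverField ρ w 0 := by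
    funext x
    exact (isInvertible_mfderiv_bundleCover ρ x).inverse_apply_eq.2 (hw x)
  have hpull' : ∀ s', VectorField.mpullback (bundleModel E) (bundleModel E) (bundleCover ρ)
      (flatField ρ s') = coverField ρ 0 s' := fun s' => by
    funext x
    exact (isInvertible_mfderiv_bundleCover ρ x).inverse_apply_eq.2 (flatField_bundleCover ρ s' x)
  have hWs : IsSmoothVectorField (bundleModel E) (coverField ρ w 0) := by
    rw [← hpull]
    exact ContMDiff.mpullback_vectorField hVs (isLocalDiffeomorph_bundleCover ρ).contMDiff
      (isInvertible_mfderiv_bundleCover ρ) (by simp)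
  -- Brackets pull back under the local diffeomorphism `Q`, and parallelism makes the bracket
  -- downstairs zero because the derivative of a constant field vanishes.
  have hbr : ∀ (s' : ℝ × ℝ) (x : Cover ρ), VectorField.mlieBracket (bundleModel E)
      (coverField ρ 0 s') (coverField ρ w 0) x = 0 := by
    intro s' x
    have : IsManifold (bundleModel E) (minSmoothness ℝ 3) (Cover ρ) := by
      simp only [minSmoothness_of_isRCLikeNormedField]
      infer_instance
    have : IsManifold (bundleModel E) (minSmoothness ℝ 3) (FlatBundle ρ) := by
      simp only [minSmoothness_of_isRCLikeNormedField]
      infer_instance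
    rw [← hpull, ← hpull', ← VectorField.mpullback_mlieBracket (n := ∞)
      ((isSmoothVectorField_flatField ρ s').mdifferentiable (by simp) _)
      (hVs.mdifferentiable (by simp) _) ((isLocalDiffeomorph_bundleCover ρ).contMDiff x)
      (by simp only [minSmoothness_of_isRCLikeNormedField]; exact ENat.LEInfty.out)]
    have h1 := hA (torusField s') (torusField s) (flatField ρ s')
      (isSmoothVectorField_torusField s') (isSmoothVectorField_torusField s) (fun v => by
        obtain ⟨y, rfl⟩ := bundleCover_surjective ρ v
        refine ⟨⟨y, s', ?_⟩, ?_⟩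
        · rw [flatField_bundleCover]
        · rw [flatField_bundleCover, dProj_dCover]
          exact (torusField_torusCover s' y.2).symm) x
    rw [torusNabla_torusField] at h1
    have h2 : VectorField.mlieBracket (bundleModel E) (flatField ρ s') V (bundleCover ρ x) = 0 :=
      h1.trans (map_zero (A (bundleCover ρ x)))
    rw [VectorField.mpullback_apply, h2]
    exact map_zero _
  have hwt : ∀ (p : M) (t : ℝ × ℝ), w (p, t) = w (p, 0) := by
    intro p t
    have h1 := apply_add_of_mlieBracket_eq_zero (w := w) (s := t) hWs (hbr t) p 0
    rwa [zero_add] at h1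
  -- `x` and `c • x` represent the same point of the bundle, so their lifts of the same vertical
  -- vector differ by `dρ(c)`.
  have hinv : ∀ (c : TorusGroup) (x : Cover ρ),
      mfderiv 𝓘(ℝ, E) 𝓘(ℝ, E) (ρ c) x.1 (w x) = w (c • x) := by
    intro c x
    have h1 : bundleCover ρ (c • x) = bundleCover ρ x := Quotient.sound ⟨c, rfl⟩
    have h2 := dCover_smul ρ c x (w x) 0
    rw [← hw] at h2
    have h3 : (⟨bundleCover ρ x, V (bundleCover ρ x)⟩ :
        TangentBundle (bundleModel E) (FlatBundle ρ)) =
        ⟨bundleCover ρ (c • x), V (bundleCover ρ (c • x))⟩ := by rw [h1]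
    rw [h3, hw] at h2
    exact (dCover_injective ρ (c • x) (eq_of_heq (Bundle.TotalSpace.mk.inj h2).2)).1
  refine ⟨fun p => w (p, 0), ?_, fun x => ?_, fun c p => ?_⟩
  · have h1 : ContMDiff 𝓘(ℝ, E) (bundleModel E) ∞ (fun p : M => ((p, 0) : M × (ℝ × ℝ))) :=
      contMDiff_id.prodMk contMDiff_const
    have h2 : ContMDiff (bundleModel E).tangent 𝓘(ℝ, E).tangent ∞
        (tangentMap (bundleModel E) 𝓘(ℝ, E) (Prod.fst : M × (ℝ × ℝ) → M)) :=
      (contMDiff_fst (n := ∞)).contMDiff_tangentMap (by simp)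
    have h3 := h2.comp (ContMDiff.comp hWs h1)
    refine h3.congr fun p => ?_
    change (⟨p, w (p, 0)⟩ : TangentBundle 𝓘(ℝ, E) M) = ⟨p, mfderiv (bundleModel E) 𝓘(ℝ, E)
      (Prod.fst : M × (ℝ × ℝ) → M) (p, 0) (coverField ρ w 0 (p, 0))⟩
    rw [mfderiv_fst]
    rfl
  · rw [← hVx, hw]
    exact congrArg (fun u : E => dCover ρ x u 0) (hwt x.1 x.2)
  -- The action also shifts the plane coordinate, but `w` does not depend on it.
  · exact (hinv c (p, 0)).trans (hwt (ρ c p) _)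

end ParallelPotential

/-! ### The induced form on the product and its exterior derivative. -/

section ProductForm

variable {E M : Type*} [NormedAddCommGroup E] [NormedSpace ℝ E] [TopologicalSpace M]
  [ChartedSpace E M] [IsManifold 𝓘(ℝ, E) ∞ M]

/-- The tangent vector `(u, s)` of `M × ℝ²`. -/
def tangentPair (x : M × (ℝ × ℝ)) (u : TangentSpace 𝓘(ℝ, E) x.1) (s : ℝ × ℝ) :
    TangentSpace (bundleModel E) x := (u, s)

/-- The form `α - κ dθ₁ - γ dθ₂` on `M × ℝ²`. -/
noncomputable def productForm (α : OneForm 𝓘(ℝ, E) M) (κ γ : M → ℝ) :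
    OneForm (bundleModel E) (M × (ℝ × ℝ)) := fun x =>
  α.pullback (I := bundleModel E) (Prod.fst : M × (ℝ × ℝ) → M) x +
    ((-κ x.1) • dFun (bundleModel E) (fun y : M × (ℝ × ℝ) => y.2.1) x +
      (-γ x.1) • dFun (bundleModel E) (fun y : M × (ℝ × ℝ) => y.2.2) x)

theorem contMDiff_angle₁ : ContMDiff (bundleModel E) 𝓘(ℝ, ℝ) ∞ (fun y : M × (ℝ × ℝ) => y.2.1) :=
  (contDiff_fst (𝕜 := ℝ) (E := ℝ) (F := ℝ)).contMDiff.comp contMDiff_snd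

theorem contMDiff_angle₂ : ContMDiff (bundleModel E) 𝓘(ℝ, ℝ) ∞ (fun y : M × (ℝ × ℝ) => y.2.2) :=
  (contDiff_snd (𝕜 := ℝ) (E := ℝ) (F := ℝ)).contMDiff.comp contMDiff_snd

theorem dFun_angle₁ (x : M × (ℝ × ℝ)) (u : TangentSpace 𝓘(ℝ, E) x.1) (s : ℝ × ℝ) :
    dFun (bundleModel E) (fun y : M × (ℝ × ℝ) => y.2.1) x (tangentPair x u s) = s.1 := by
  have h1 : HasMFDerivAt (bundleModel E) 𝓘(ℝ, ℝ) (fun y : M × (ℝ × ℝ) => y.2.1) x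
      ((ContinuousLinearMap.fst ℝ ℝ ℝ).comp (ContinuousLinearMap.snd ℝ E (ℝ × ℝ))) :=
    ((hasFDerivAt_fst (𝕜 := ℝ) (E := ℝ) (F := ℝ) (p := x.2)).hasMFDerivAt).comp x (hasMFDerivAt_snd x)
  rw [h1.dFun_eq]
  rfl

theorem dFun_angle₂ (x : M × (ℝ × ℝ)) (u : TangentSpace 𝓘(ℝ, E) x.1) (s : ℝ × ℝ) :
    dFun (bundleModel E) (fun y : M × (ℝ × ℝ) => y.2.2) x (tangentPair x u s) = s.2 := by
  have h1 : HasMFDerivAt (bundleModel E) 𝓘(ℝ, ℝ) (fun y : M × (ℝ × ℝ) => y.2.2) x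
      ((ContinuousLinearMap.snd ℝ ℝ ℝ).comp (ContinuousLinearMap.snd ℝ E (ℝ × ℝ))) :=
    ((hasFDerivAt_snd (𝕜 := ℝ) (E := ℝ) (F := ℝ) (p := x.2)).hasMFDerivAt).comp x (hasMFDerivAt_snd x)
  rw [h1.dFun_eq]
  rfl

theorem mfderiv_fst_tangentPair (x : M × (ℝ × ℝ)) (u : TangentSpace 𝓘(ℝ, E) x.1) (s : ℝ × ℝ) :
    mfderiv (bundleModel E) 𝓘(ℝ, E) (Prod.fst : M × (ℝ × ℝ) → M) x (tangentPair x u s) = u := by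
  rw [mfderiv_fst]
  rfl

theorem dFun_neg_fst {κ : M → ℝ} (hκ : ContMDiff 𝓘(ℝ, E) 𝓘(ℝ, ℝ) ∞ κ) (x : M × (ℝ × ℝ))
    (u : TangentSpace 𝓘(ℝ, E) x.1) (s : ℝ × ℝ) :
    dFun (bundleModel E) (fun y : M × (ℝ × ℝ) => -κ y.1) x (tangentPair x u s) =
      -dFun 𝓘(ℝ, E) κ x.1 u := by
  rw [dFun_neg]
  have h1 : HasMFDerivAt (bundleModel E) 𝓘(ℝ, ℝ) (fun y : M × (ℝ × ℝ) => κ y.1) x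
      ((mfderiv 𝓘(ℝ, E) 𝓘(ℝ, ℝ) κ x.1).comp (ContinuousLinearMap.fst ℝ E (ℝ × ℝ))) :=
    ((hκ.mdifferentiable (by simp) x.1).hasMFDerivAt).comp x (hasMFDerivAt_fst x)
  rw [h1.dFun_eq]
  rfl

theorem productForm_apply (α : OneForm 𝓘(ℝ, E) M) (κ γ : M → ℝ) (x : M × (ℝ × ℝ))
    (u : TangentSpace 𝓘(ℝ, E) x.1) (s : ℝ × ℝ) :
    productForm α κ γ x (tangentPair x u s) = α x.1 u - s.1 * κ x.1 - s.2 * γ x.1 := by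
  have h1 : productForm α κ γ x (tangentPair x u s) =
      α x.1 (mfderiv (bundleModel E) 𝓘(ℝ, E) (Prod.fst : M × (ℝ × ℝ) → M) x (tangentPair x u s)) +
      ((-κ x.1) * dFun (bundleModel E) (fun y : M × (ℝ × ℝ) => y.2.1) x (tangentPair x u s) +
      (-γ x.1) * dFun (bundleModel E) (fun y : M × (ℝ × ℝ) => y.2.2) x (tangentPair x u s)) := rfl
  rw [h1, dFun_angle₁, dFun_angle₂, mfderiv_fst_tangentPair]
  ring

variable {α : OneForm 𝓘(ℝ, E) M} {κ γ : M → ℝ}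

theorem isSmoothOneForm_productForm (hα : IsSmoothOneForm 𝓘(ℝ, E) α)
    (hκ : ContMDiff 𝓘(ℝ, E) 𝓘(ℝ, ℝ) ∞ κ) (hγ : ContMDiff 𝓘(ℝ, E) 𝓘(ℝ, ℝ) ∞ γ) :
    IsSmoothOneForm (bundleModel E) (productForm α κ γ) :=
  (hα.pullback contMDiff_fst).add
    (((isSmoothOneForm_dFun contMDiff_angle₁).smul (hκ.neg.comp contMDiff_fst)).add
      ((isSmoothOneForm_dFun contMDiff_angle₂).smul (hγ.neg.comp contMDiff_fst)))

/-- The forms `dθ₁` and `dθ₂` are closed, so this is `dα - dκ ∧ dθ₁ - dγ ∧ dθ₂`. -/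
theorem d_productForm [FiniteDimensional ℝ E] (hα : IsSmoothOneForm 𝓘(ℝ, E) α)
    (hκ : ContMDiff 𝓘(ℝ, E) 𝓘(ℝ, ℝ) ∞ κ) (hγ : ContMDiff 𝓘(ℝ, E) 𝓘(ℝ, ℝ) ∞ γ) (x : M × (ℝ × ℝ))
    (u u' : TangentSpace 𝓘(ℝ, E) x.1) (s s' : ℝ × ℝ) :
    (productForm α κ γ).d (bundleModel E) x (tangentPair x u s) (tangentPair x u' s') =
      α.d 𝓘(ℝ, E) x.1 u u' - (dFun 𝓘(ℝ, E) κ x.1 u * s'.1 - dFun 𝓘(ℝ, E) κ x.1 u' * s.1) -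
        (dFun 𝓘(ℝ, E) γ x.1 u * s'.2 - dFun 𝓘(ℝ, E) γ x.1 u' * s.2) := by
  have hκ' : ContMDiff (bundleModel E) 𝓘(ℝ, ℝ) ∞ (fun y : M × (ℝ × ℝ) => -κ y.1) :=
    hκ.neg.comp contMDiff_fst
  have hγ' : ContMDiff (bundleModel E) 𝓘(ℝ, ℝ) ∞ (fun y : M × (ℝ × ℝ) => -γ y.1) :=
    hγ.neg.comp contMDiff_fst
  have s1 := isSmoothOneForm_dFun (contMDiff_angle₁ (E := E) (M := M))
  have s2 := isSmoothOneForm_dFun (contMDiff_angle₂ (E := E) (M := M))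
  have s0 : IsSmoothOneForm (bundleModel E)
    (α.pullback (I := bundleModel E) (Prod.fst : M × (ℝ × ℝ) → M)) := hα.pullback contMDiff_fst
  unfold productForm
  rw [OneForm.d_add (s0.differentiableAt_inChart x)
    (((s1.smul hκ').add (s2.smul hγ')).differentiableAt_inChart x),
    OneForm.d_add ((s1.smul hκ').differentiableAt_inChart x)
      ((s2.smul hγ').differentiableAt_inChart x),
    OneForm.d_smul (s1.differentiableAt_inChart x) (hκ'.mdifferentiable (by simp) x),
    OneForm.d_smul (s2.differentiableAt_inChart x) (hγ'.mdifferentiable (by simp) x),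
    OneForm.d_dFun (contMDiff_angle₁ x), OneForm.d_dFun (contMDiff_angle₂ x),
    OneForm.d_pullback (hα.differentiableAt_inChart x.1) (contMDiff_fst x),
    mfderiv_fst_tangentPair, mfderiv_fst_tangentPair, dFun_angle₁, dFun_angle₁, dFun_angle₂,
    dFun_angle₂, dFun_neg_fst hκ, dFun_neg_fst hκ, dFun_neg_fst hγ, dFun_neg_fst hγ]
  ring

end ProductForm

/-! ### The contact condition on the product in terms of two vector fields. -/

section ProductContact

variable {E M : Type*} [NormedAddCommGroup E] [NormedSpace ℝ E] [TopologicalSpace M]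
  [ChartedSpace E M] [IsManifold 𝓘(ℝ, E) ∞ M] [FiniteDimensional ℝ E]
  {α : OneForm 𝓘(ℝ, E) M} {X Y : (p : M) → TangentSpace 𝓘(ℝ, E) p}

/-- The form `α - α(X) dθ₁ - α(Y) dθ₂` on `M × ℝ²`, whose kernel contains `∂₁ + X` and `∂₂ + Y`. -/
noncomputable abbrev connectionForm (α : OneForm 𝓘(ℝ, E) M)
    (X Y : (p : M) → TangentSpace 𝓘(ℝ, E) p) : OneForm (bundleModel E) (M × (ℝ × ℝ)) :=
  productForm α (fun p => α p (X p)) (fun p => α p (Y p))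

/-- The coefficient of `dθ₁` is `-α(X)`, whose derivative supplies the missing term of Cartan's
formula. Orthogonality of `∂₁ + X` to `ξ` thus says that `X` is a contact field. -/
theorem d_connectionForm₁ (hα : IsSmoothOneForm 𝓘(ℝ, E) α) (hX : IsSmoothVectorField 𝓘(ℝ, E) X)
    (hY : IsSmoothVectorField 𝓘(ℝ, E) Y) (x : M × (ℝ × ℝ)) (u : TangentSpace 𝓘(ℝ, E) x.1) :
    (connectionForm α X Y).d (bundleModel E) x (tangentPair x (X x.1) (1, 0)) (tangentPair x u 0) =
      lieForm α X x.1 u := by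
  rw [d_productForm hα (hα.apply hX) (hα.apply hY)]
  simp [lieForm]

theorem d_connectionForm₂ (hα : IsSmoothOneForm 𝓘(ℝ, E) α) (hX : IsSmoothVectorField 𝓘(ℝ, E) X)
    (hY : IsSmoothVectorField 𝓘(ℝ, E) Y) (x : M × (ℝ × ℝ)) (u : TangentSpace 𝓘(ℝ, E) x.1) :
    (connectionForm α X Y).d (bundleModel E) x (tangentPair x (Y x.1) (0, 1)) (tangentPair x u 0) =
      lieForm α Y x.1 u := by
  rw [d_productForm hα (hα.apply hX) (hα.apply hY)]
  simp [lieForm]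

theorem d_connectionForm₁₂ (hα : IsSmoothOneForm 𝓘(ℝ, E) α) (hX : IsSmoothVectorField 𝓘(ℝ, E) X)
    (hY : IsSmoothVectorField 𝓘(ℝ, E) Y) (x : M × (ℝ × ℝ)) :
    (connectionForm α X Y).d (bundleModel E) x (tangentPair x (X x.1) (1, 0))
      (tangentPair x (Y x.1) (0, 1)) = bracketTerm α X Y x.1 := by
  rw [d_productForm hα (hα.apply hX) (hα.apply hY)]
  simp [bracketTerm]

/-- Adding the vertical vectors `X`, `Y` to `∂₁`, `∂₂` changes nothing, since the other `2 d + 1`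
arguments already lie in the vertical space of that dimension. Afterwards `∂₁ + X` and `∂₂ + Y` lie
in the kernel and `∂₁ + X` pairs with vertical vectors as a multiple of `α`, so the top form splits
off their mutual pairing `-α([X, Y])`. -/
theorem contactVolume_connectionForm (hα : IsSmoothOneForm 𝓘(ℝ, E) α) (hα0 : ∀ p, α p ≠ 0)
    (hX : IsSmoothVectorField 𝓘(ℝ, E) X) (hY : IsSmoothVectorField 𝓘(ℝ, E) Y)
    (hXξ : ∀ p u, α p u = 0 → lieForm α X p u = 0) {d : ℕ}
    (hE : Module.finrank ℝ E = 2 * d + 1) (x : M × (ℝ × ℝ))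
    (u : Fin (2 * d + 1) → TangentSpace 𝓘(ℝ, E) x.1) :
    (connectionForm α X Y).contactVolume (bundleModel E) (d + 1) x
      (Fin.cons (tangentPair x 0 (1, 0)) (Fin.cons (tangentPair x 0 (0, 1))
        (fun i => tangentPair x (u i) 0))) =
      2 * (d + 1) * bracketTerm α X Y x.1 * α.contactVolume 𝓘(ℝ, E) d x.1 u := by
  obtain ⟨k, -, hk⟩ := exists_lieForm_eq_mul hα hα0 hX hXξ
  set T := TangentSpace (bundleModel E) x with hT
  set a : T →ₗ[ℝ] ℝ := (connectionForm α X Y x : T →ₗ[ℝ] ℝ) with ha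
  set Ω : T →ₗ[ℝ] T →ₗ[ℝ] ℝ := (connectionForm α X Y).dLin x with hΩ
  have hskew : ∀ u v, Ω u v = -Ω v u := (connectionForm α X Y).d_skew x
  let ι : E →ₗ[ℝ] E × (ℝ × ℝ) := LinearMap.inl ℝ E (ℝ × ℝ)
  let S : Submodule ℝ T := LinearMap.range ι
  have hS : Module.finrank ℝ S ≤ 2 * d + 1 := by
    rw [← hE]
    exact LinearMap.finrank_range_le ι
  have : FiniteDimensional ℝ S := inferInstanceAs (FiniteDimensional ℝ (LinearMap.range ι))
  let v : Fin (2 * d + 1) → T := fun i => tangentPair x (u i) 0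
  have h1 := (oneFormWedgePowerAlt a Ω (d + 1)).map_cons_cons_add_of_mem S hS
    (tangentPair x 0 (1, 0)) (tangentPair x 0 (0, 1)) (tangentPair x (X x.1) 0)
    (tangentPair x (Y x.1) 0) ⟨X x.1, rfl⟩ ⟨Y x.1, rfl⟩ v fun i => ⟨u i, rfl⟩
  have e1 : (tangentPair x 0 (1, 0) + tangentPair x (X x.1) 0 : T) = tangentPair x (X x.1) (1, 0) :=
    Prod.ext (zero_add (X x.1 : E)) (add_zero ((1, 0) : ℝ × ℝ))
  have e2 : (tangentPair x 0 (0, 1) + tangentPair x (Y x.1) 0 : T) = tangentPair x (Y x.1) (0, 1) :=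
    Prod.ext (zero_add (Y x.1 : E)) (add_zero ((0, 1) : ℝ × ℝ))
  rw [e1, e2, oneFormWedgePowerAlt_apply a hskew, oneFormWedgePowerAlt_apply a hskew] at h1
  refine Eq.trans h1.symm ?_
  have ha0 : ∀ w, a (tangentPair x w 0) = α x.1 w := fun w =>
    (productForm_apply α _ _ x w 0).trans (by simp)
  have hv : ∀ i, Ω (tangentPair x (X x.1) (1, 0)) (v i) = k x.1 * a (v i) := fun i => by
    rw [ha0]
    exact (d_connectionForm₁ hα hX hY x (u i)).trans (hk x.1 (u i))
  have h2 := oneFormWedgePower_cons_cons hskew d (tangentPair x (X x.1) (1, 0))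
    (tangentPair x (Y x.1) (0, 1)) ((productForm_apply α _ _ x (X x.1) (1, 0)).trans (by simp))
    ((productForm_apply α _ _ x (Y x.1) (0, 1)).trans (by simp)) (k x.1) v hv
  refine h2.trans ?_
  have e3 : Ω (tangentPair x (X x.1) (1, 0)) (tangentPair x (Y x.1) (0, 1)) =
    bracketTerm α X Y x.1 := d_connectionForm₁₂ hα hX hY x
  have e4 : ∀ w w', Ω (tangentPair x w 0) (tangentPair x w' 0) = α.d 𝓘(ℝ, E) x.1 w w' :=
    fun w w' => (d_productForm hα (hα.apply hX) (hα.apply hY) x w w' 0 0).trans (by simp)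
  rw [e3]
  congr 1
  unfold OneForm.contactVolume oneFormWedgePower
  simp only [v, e4]
  exact Finset.sum_congr rfl fun σ _ => by rw [← ha0]

end ProductContact

/-! ### The vertical distribution and the pullback of a defining form. -/

section FibrePlane

variable {E M : Type*} [NormedAddCommGroup E] [NormedSpace ℝ E] [TopologicalSpace M]
  [ChartedSpace E M] {ρ : TorusGroup →* (M ≃ₘ⟮𝓘(ℝ, E), 𝓘(ℝ, E)⟯ M)}
  [IsManifold 𝓘(ℝ, E) ∞ M] [T2Space M] [LocallyCompactSpace M]
  {ξ : CoorientedHyperplaneField 𝓘(ℝ, E) M}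
  {η : CoorientedHyperplaneField (bundleModel E) (FlatBundle ρ)}

/-- Two lifts of a point differ by some `c`, and injectivity of `dQ` forces the vertical vectors to
correspond under `dρ(c)`. -/
theorem eq_of_totalSpace_dCover_eq {x y : Cover ρ} {u : TangentSpace 𝓘(ℝ, E) x.1}
    {u' : TangentSpace 𝓘(ℝ, E) y.1}
    (h : (⟨bundleCover ρ x, dCover ρ x u 0⟩ : TangentBundle (bundleModel E) (FlatBundle ρ)) =
      ⟨bundleCover ρ y, dCover ρ y u' 0⟩) :
    ∃ c, (⟨y.1, u'⟩ : TangentBundle 𝓘(ℝ, E) M) =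
      ⟨ρ c x.1, mfderiv 𝓘(ℝ, E) 𝓘(ℝ, E) (ρ c) x.1 u⟩ := by
  obtain ⟨c, rfl⟩ : ∃ c : TorusGroup, c • x = y :=
    Quotient.exact (congrArg Bundle.TotalSpace.proj h).symm
  have h1 := (dCover_smul ρ c x u 0).trans h
  have h2 := (dCover_injective ρ (c • x) (eq_of_heq (Bundle.TotalSpace.mk.inj h1).2)).1
  exact ⟨c, congrArg (Bundle.TotalSpace.mk _) h2.symm⟩

/-- Membership downstairs only provides some lift; since `ρ` acts by contactomorphisms, the
condition is the same for every lift. -/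
theorem dCover_mem_fibrePlane_iff (hρ : ∀ c, ξ.IsContactomorphism (ρ c)) (x : Cover ρ)
    (u : TangentSpace 𝓘(ℝ, E) x.1) :
    dCover ρ x u 0 ∈ fibrePlane ρ ξ (bundleCover ρ x) ↔ u ∈ ξ.plane x.1 := by
  refine ⟨?_, fun h => ⟨x, u, h, rfl⟩⟩
  rintro ⟨y, u', hu', h⟩
  obtain ⟨c, hc⟩ := eq_of_totalSpace_dCover_eq h
  have h1 : ∀ z : TangentBundle 𝓘(ℝ, E) M, (⟨y.1, u'⟩ : TangentBundle 𝓘(ℝ, E) M) = z →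
      z.2 ∈ ξ.plane z.1 := by rintro _ rfl; exact hu'
  exact (hρ c x.1 u).1.1 (h1 _ hc)

theorem dCover_mem_fibrePos_iff (hρ : ∀ c, ξ.IsContactomorphism (ρ c)) (x : Cover ρ)
    (u : TangentSpace 𝓘(ℝ, E) x.1) :
    dCover ρ x u 0 ∈ fibrePos ρ ξ (bundleCover ρ x) ↔ u ∈ ξ.pos x.1 := by
  refine ⟨?_, fun h => ⟨x, u, h, rfl⟩⟩
  rintro ⟨y, u', hu', h⟩
  obtain ⟨c, hc⟩ := eq_of_totalSpace_dCover_eq h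
  have h1 : ∀ z : TangentBundle 𝓘(ℝ, E) M, (⟨y.1, u'⟩ : TangentBundle 𝓘(ℝ, E) M) = z →
      z.2 ∈ ξ.pos z.1 := by rintro _ rfl; exact hu'
  exact (hρ c x.1 u).2.1 (h1 _ hc)

/-- If the horizontal lifts of the coordinate fields of the torus are induced by `∂₁ + X` and
`∂₂ + Y`, then the pullback to `M × ℝ²` of a form defining `η` is a multiple of
`α - α(X) dθ₁ - α(Y) dθ₂`. -/
theorem IsContactFibreBundle.exists_pullback_eq [FiniteDimensional ℝ E]
    (hρ : ∀ c, ξ.IsContactomorphism (ρ c))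
    (hη : IsContactFibreBundle ξ η) {α : OneForm 𝓘(ℝ, E) M} (hα : ξ.DefinedBy α)
    {α' : OneForm (bundleModel E) (FlatBundle ρ)} (hα' : η.DefinedBy α')
    {X Y : (p : M) → TangentSpace 𝓘(ℝ, E) p} (hX : IsSmoothVectorField 𝓘(ℝ, E) X)
    (hY : IsSmoothVectorField 𝓘(ℝ, E) Y)
    (hXη : ∀ x : Cover ρ, α' (bundleCover ρ x) (dCover ρ x (X x.1) (1, 0)) = 0)
    (hYη : ∀ x : Cover ρ, α' (bundleCover ρ x) (dCover ρ x (Y x.1) (0, 1)) = 0) :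
    ∃ F : M × (ℝ × ℝ) → ℝ, ContMDiff (bundleModel E) 𝓘(ℝ, ℝ) ∞ F ∧ (∀ x, 0 < F x) ∧
      (α'.pullback (I := bundleModel E) (M := M × (ℝ × ℝ)) (bundleCover ρ)) =
        fun x => F x • connectionForm α X Y x := by
  set θ : OneForm (bundleModel E) (M × (ℝ × ℝ)) :=
    α'.pullback (I := bundleModel E) (M := M × (ℝ × ℝ)) (bundleCover ρ) with hθ
  have hθs : IsSmoothOneForm (bundleModel E) θ :=
    hα'.1.pullback (isLocalDiffeomorph_bundleCover ρ).contMDiff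
  have hvert' : ∀ (x : Cover ρ) (u : TangentSpace 𝓘(ℝ, E) x.1),
      (α' (bundleCover ρ x) (dCover ρ x u 0) = 0 ↔ α x.1 u = 0) ∧
        (0 < α' (bundleCover ρ x) (dCover ρ x u 0) ↔ 0 < α x.1 u) := by
    intro x u
    have h0 : dProj ρ (bundleCover ρ x) (dCover ρ x u 0) = 0 :=
      (dProj_dCover_eq_zero_iff ρ x u 0).2 rfl
    have h1 := hη (bundleCover ρ x) (dCover ρ x u 0)
    rw [dCover_mem_fibrePlane_iff hρ, dCover_mem_fibrePos_iff hρ, (hα.2 x.1).2.1, (hα.2 x.1).2.2,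
      (hα'.2 (bundleCover ρ x)).2.1, (hα'.2 (bundleCover ρ x)).2.2] at h1
    exact ⟨⟨fun h => h1.1.1 ⟨h, h0⟩, fun h => (h1.1.2 h).1⟩,
      ⟨fun h => h1.2.1 ⟨h, h0⟩, fun h => (h1.2.2 h).1⟩⟩
  have hvert : ∀ (x : M × (ℝ × ℝ)) (u : TangentSpace 𝓘(ℝ, E) x.1),
      (θ x (tangentPair x u 0) = 0 ↔ α x.1 u = 0) ∧
        (0 < θ x (tangentPair x u 0) ↔ 0 < α x.1 u) := hvert'
  have hF : ∀ x : M × (ℝ × ℝ), ∃ F : ℝ, ∀ u, θ x (tangentPair x u 0) = F * α x.1 u := by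
    intro x
    let θx : E × (ℝ × ℝ) →L[ℝ] ℝ := θ x
    let L : E →ₗ[ℝ] ℝ := (θx : E × (ℝ × ℝ) →ₗ[ℝ] ℝ) ∘ₗ LinearMap.inl ℝ E (ℝ × ℝ)
    exact ContinuousLinearMap.exists_eq_mul_of_ker_le (hα.2 x.1).1 (θ := L)
      fun u hu => ((hvert x u).1).2 hu
  choose F hF using hF
  have hFpos : ∀ x, 0 < F x := by
    intro x
    obtain ⟨u, hu⟩ : ∃ u, 0 < α x.1 u := by
      have h1 := (hα.2 x.1).1
      rw [Ne, ContinuousLinearMap.ext_iff] at h1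
      push Not at h1
      obtain ⟨u, hu⟩ := h1
      rcases lt_or_gt_of_ne hu with h | h
      · exact ⟨-u, by rw [map_neg]; exact neg_pos.2 h⟩
      · exact ⟨u, h⟩
    have h1 := ((hvert x u).2).2 hu
    rw [hF] at h1
    exact (pos_iff_pos_of_mul_pos h1).2 hu
  have hFeq' : ∀ (x : M × (ℝ × ℝ)) (u : TangentSpace 𝓘(ℝ, E) x.1) (s : ℝ × ℝ),
      θ x (tangentPair x u s) = F x * connectionForm α X Y x (tangentPair x u s) := by
    intro x u s
    -- Split a tangent vector into a vertical vector and multiples of `∂₁ + X` and `∂₂ + Y`. Both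
    -- forms vanish on the latter, so the vertical proportionality factor `F` is the factor
    -- everywhere.
    have h1 : (tangentPair x u s) = tangentPair x (u - s.1 • X x.1 - s.2 • Y x.1) 0 +
        s.1 • tangentPair x (X x.1) (1, 0) + s.2 • tangentPair x (Y x.1) (0, 1) := by
      refine Prod.ext ?_ ?_
      · change u = u - s.1 • X x.1 - s.2 • Y x.1 + s.1 • X x.1 + s.2 • Y x.1
        abel
      · change s = 0 + s.1 • ((1, 0) : ℝ × ℝ) + s.2 • ((0, 1) : ℝ × ℝ)
        ext <;> simp
    have hX' : θ x (tangentPair x (X x.1) (1, 0)) = 0 := hXη x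
    have hY' : θ x (tangentPair x (Y x.1) (0, 1)) = 0 := hYη x
    rw [productForm_apply, h1, map_add, map_add, map_smul, map_smul, hF, hX', hY',
      map_sub, map_sub, map_smul, map_smul]
    simp
  have hFeq : ∀ (x : M × (ℝ × ℝ)) v, θ x v = F x * connectionForm α X Y x v :=
    fun x v => hFeq' x v.1 v.2
  refine ⟨F, contMDiff_of_eq_mul (β := connectionForm α X Y) (θ := fun x v => θ x v)
    (isSmoothOneForm_productForm hα.1 (hα.1.apply hX) (hα.1.apply hY)) (fun x h => ?_) hθs hFeq,
    hFpos, ?_⟩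
  · refine (hα.2 x.1).1 (ContinuousLinearMap.ext fun u => ?_)
    have h1 : connectionForm α X Y x (tangentPair x u 0) = 0 := by rw [h]; rfl
    rw [productForm_apply] at h1
    simpa using h1
  · funext x
    exact ContinuousLinearMap.ext fun v => hFeq x v

end FibrePlane

/-! ### Reduction to two contact vector fields on the fibre. -/

section Main

theorem OneForm.contactVolume_pullback {E E' H H' M N : Type*} [NormedAddCommGroup E]
    [NormedSpace ℝ E] [NormedAddCommGroup E'] [NormedSpace ℝ E'] [TopologicalSpace H]
    [TopologicalSpace H'] {I : ModelWithCorners ℝ E H} {I' : ModelWithCorners ℝ E' H'}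
    [I.Boundaryless] [I'.Boundaryless] [TopologicalSpace M] [ChartedSpace H M]
    [IsManifold I ∞ M] [TopologicalSpace N] [ChartedSpace H' N] [IsManifold I' ∞ N]
    [FiniteDimensional ℝ E'] {α : OneForm I' N} (hα : IsSmoothOneForm I' α) {F : M → N}
    (hF : ContMDiff I I' ∞ F) (m : ℕ) (p : M) (v : Fin (2 * m + 1) → TangentSpace I p) :
    (α.pullback (I := I) F).contactVolume I m p v =
      α.contactVolume I' m (F p) (fun i => mfderiv I I' F p (v i)) := by
  unfold OneForm.contactVolume oneFormWedgePower
  simp only [OneForm.d_pullback (hα.differentiableAt_inChart (F p)) (hF p)]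
  rfl

theorem AlternatingMap.exists_pos_of_ne_zero {T : Type*} [AddCommGroup T] [Module ℝ T] {n : ℕ}
    (f : T [⋀^Fin (n + 1)]→ₗ[ℝ] ℝ) {v : Fin (n + 1) → T} (hv : f v ≠ 0) : ∃ w, 0 < f w := by
  rcases lt_or_gt_of_ne hv with h | h
  · refine ⟨Function.update v 0 (-v 0), ?_⟩
    rw [f.map_update_neg, Function.update_eq_self]
    exact neg_pos.2 h
  · exact ⟨v, h⟩

theorem OneForm.exists_contactVolume_pos {E H M : Type*} [NormedAddCommGroup E] [NormedSpace ℝ E]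
    [TopologicalSpace H] {I : ModelWithCorners ℝ E H} [TopologicalSpace M] [ChartedSpace H M]
    (α : OneForm I M) {m : ℕ} {p : M} {v : Fin (2 * m + 1) → TangentSpace I p}
    (hv : α.contactVolume I m p v ≠ 0) : ∃ w, 0 < α.contactVolume I m p w := by
  have h1 := oneFormWedgePowerAlt_apply (α p : TangentSpace I p →ₗ[ℝ] ℝ) (Ω := α.dLin p)
    (α.d_skew p) m
  obtain ⟨w, hw⟩ := (oneFormWedgePowerAlt (α p : TangentSpace I p →ₗ[ℝ] ℝ)
    (α.dLin p) m).exists_pos_of_ne_zero (v := v) (by rw [h1]; exact hv)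
  rw [h1] at hw
  exact ⟨w, hw⟩

theorem mainTheorem11 {E M : Type*} [NormedAddCommGroup E] [NormedSpace ℝ E]
    (d : ℕ) (hE : Module.finrank ℝ E = 2 * d + 1)
    [TopologicalSpace M] [ChartedSpace E M] [IsManifold 𝓘(ℝ, E) ∞ M] [CompactSpace M] [T2Space M]
    (ξ : CoorientedHyperplaneField 𝓘(ℝ, E) M) (hξ : ξ.IsContact d)
    (ρ : TorusGroup →* ξ.contactomorphismGroup)
    (η : CoorientedHyperplaneField (bundleModel E)
      (FlatBundle (ξ.contactomorphismGroup.subtype.comp ρ)))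
    (hη : IsStrongBourgeois d ξ η) :
    ∃ φ : M → ℝ × ℝ,
      Supports d φ ξ ∧
      (∀ g ∈ ρ.range, ∀ p, φ ((g : M ≃ₘ⟮𝓘(ℝ, E), 𝓘(ℝ, E)⟯ M) p) = φ p) ∧
      ∃ β : OneForm 𝓘(ℝ, E) M,
        IsAdaptedForm d ξ φ β ∧
        (∀ g ∈ ρ.range, ∀ p v,
          β ((g : M ≃ₘ⟮𝓘(ℝ, E), 𝓘(ℝ, E)⟯ M) p)
            (mfderiv 𝓘(ℝ, E) 𝓘(ℝ, E) (g : M ≃ₘ⟮𝓘(ℝ, E), 𝓘(ℝ, E)⟯ M) p v) = β p v) ∧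
        IsInducedBy η β φ := by
  -- `finrank` is `0` for infinite-dimensional spaces, so its odd value here forces finite
  -- dimension.
  have : FiniteDimensional ℝ E := Module.finite_of_finrank_pos (by omega)
  set ρ' := ξ.contactomorphismGroup.subtype.comp ρ with hρ'
  have hρ : ∀ c, ξ.IsContactomorphism (ρ' c) := fun c => (ρ c).2
  obtain ⟨hfib, ⟨α', hα', hpos⟩, A, hpot, hpar⟩ := hη
  obtain ⟨α, hα, hvol⟩ := hξ
  obtain ⟨X, hX, hXA, hXinv⟩ := hpar.exists_field hpot.smooth hpot.vertical (1, 0)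
  obtain ⟨Y, hY, hYA, hYinv⟩ := hpar.exists_field hpot.smooth hpot.vertical (0, 1)
  -- Adding the potential to the flat lift of `s` gives the contact lift, which upstairs is the sum
  -- of `Z` and the constant field `s`.
  have hlift : ∀ {Z : (p : M) → TangentSpace 𝓘(ℝ, E) p} {s : ℝ × ℝ}, (∀ x : Cover ρ',
      A (bundleCover ρ' x) (mfderiv 𝓘(ℝ, ℝ × ℝ) 𝓘(ℝ, ℝ × ℝ) torusCover x.2 s) =
        dCover ρ' x (Z x.1) 0) → ∀ x : Cover ρ',
      dCover ρ' x (Z x.1) s ∈ contactConnection α' (bundleCover ρ' x) := by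
    intro Z s hZ x
    have h1 := hpot.lift α' hα' (bundleCover ρ' x) (dCover ρ' x 0 s) ⟨x, s, rfl⟩
    rw [dProj_dCover] at h1
    have h2 : dCover ρ' x 0 s + A (bundleCover ρ' x)
        (mfderiv 𝓘(ℝ, ℝ × ℝ) 𝓘(ℝ, ℝ × ℝ) torusCover x.2 s) = dCover ρ' x (Z x.1) s := by
      rw [hZ, ← dCover_add, zero_add, add_zero]
    exact h2 ▸ h1
  obtain ⟨F, hFs, hF0, hFeq⟩ := hfib.exists_pullback_eq hρ hα hα' hX hY
    (fun x => (hlift hXA x).1) (fun x => (hlift hYA x).1)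
  have hQ : ContMDiff (bundleModel E) (bundleModel E) ∞ (M := M × (ℝ × ℝ)) (bundleCover ρ') :=
    (isLocalDiffeomorph_bundleCover ρ').contMDiff
  have hσ : IsSmoothOneForm (bundleModel E) (connectionForm α X Y) :=
    isSmoothOneForm_productForm hα.1 (hα.1.apply hX) (hα.1.apply hY)
  -- The extra terms of `d(F σ)`, coming from `dF ∧ σ`, vanish on the kernel of `σ`, so
  -- orthogonality for `dα'` and for `dσ` agree there.
  have hd : ∀ (x : M × (ℝ × ℝ)) (v w : TangentSpace (bundleModel E) x),
      connectionForm α X Y x v = 0 → connectionForm α X Y x w = 0 →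
      α'.d (bundleModel E) (bundleCover ρ' x)
        (mfderiv (bundleModel E) (bundleModel E) (M := M × (ℝ × ℝ)) (bundleCover ρ') x v)
        (mfderiv (bundleModel E) (bundleModel E) (M := M × (ℝ × ℝ)) (bundleCover ρ') x w) =
        F x * (connectionForm α X Y).d (bundleModel E) x v w := by
    intro x v w hv hw
    refine (OneForm.d_pullback (hα'.1.differentiableAt_inChart _) (hQ x) v w).symm.trans ?_
    rw [hFeq, OneForm.d_smul (hσ.differentiableAt_inChart x) (hFs.mdifferentiable (by simp) x),
      hv, hw]
    ring
  have happ : ∀ (x : Cover ρ') (u : TangentSpace 𝓘(ℝ, E) x.1) (s : ℝ × ℝ),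
      α' (bundleCover ρ' x) (dCover ρ' x u s) =
        F x * (α x.1 u - s.1 * α x.1 (X x.1) - s.2 * α x.1 (Y x.1)) := by
    intro x u s
    have h1 : α' (bundleCover ρ' x) (dCover ρ' x u s) =
      F x * connectionForm α X Y x (tangentPair x u s) :=
        congrArg (fun L => L (tangentPair x u s)) (congrFun hFeq x)
    exact h1.trans (congrArg (F x * ·) (productForm_apply α _ _ x u s))
  have hcontact : ∀ {Z : (p : M) → TangentSpace 𝓘(ℝ, E) p} {s : ℝ × ℝ},
      (∀ x : Cover ρ', dCover ρ' x (Z x.1) s ∈ contactConnection α' (bundleCover ρ' x)) →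
      (∀ (x : M × (ℝ × ℝ)), connectionForm α X Y x (tangentPair x (Z x.1) s) = 0) →
      ∀ (x : M × (ℝ × ℝ)) (u : TangentSpace 𝓘(ℝ, E) x.1), α x.1 u = 0 →
        (connectionForm α X Y).d (bundleModel E) x (tangentPair x (Z x.1) s)
          (tangentPair x u 0) = 0 := by
    intro Z s hZ hZ0 x u hu
    have h1 : α' (bundleCover ρ' x) (dCover ρ' x u 0) = 0 := by
      rw [happ x u 0, hu]
      simp
    have h2 := (hZ x).2 (dCover ρ' x u 0) h1 ((dProj_dCover_eq_zero_iff ρ' x u 0).2 rfl)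
    have h3 : connectionForm α X Y x (tangentPair x u 0) = 0 := by
      rw [productForm_apply, hu]
      simp
    have h4 := (hd x _ _ (hZ0 x) h3).symm.trans h2
    exact (mul_eq_zero_iff_left (hF0 x).ne').1 h4
  have hXξ : ∀ p u, α p u = 0 → lieForm α X p u = 0 := by
    intro p u hu
    rw [← d_connectionForm₁ hα.1 hX hY (p, 0) u]
    exact hcontact (hlift hXA) (fun x => by rw [productForm_apply]; simp) (p, 0) u hu
  have hYξ : ∀ p u, α p u = 0 → lieForm α Y p u = 0 := by
    intro p u hu
    rw [← d_connectionForm₂ hα.1 hX hY (p, 0) u]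
    exact hcontact (hlift hYA) (fun x => by rw [productForm_apply]; simp) (p, 0) u hu
  have hbr : ∀ p, 0 < bracketTerm α X Y p := by
    intro p
    obtain ⟨v, hv⟩ := hvol p
    obtain ⟨u, hu⟩ := α.exists_contactVolume_pos hv
    have h1 := hpos (p, 0) u ⟨α, hα, hu⟩
    have h2 := OneForm.contactVolume_pullback (I := bundleModel E) hα'.1 hQ (d + 1) (p, 0)
      (Fin.cons (tangentPair (p, 0) 0 (1, 0)) (Fin.cons (tangentPair (p, 0) 0 (0, 1))
        (fun i => tangentPair (p, 0) (u i) 0)))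
    rw [hFeq, OneForm.contactVolume_smul hσ hFs (d + 1) (hF0 _).ne',
      contactVolume_connectionForm hα.1 (fun p => (hα.2 p).1) hX hY hXξ hE] at h2
    have h3 := h1.trans_eq (Eq.trans (congrArg (α'.contactVolume (bundleModel E) (d + 1)
      (bundleCover ρ' ((p, 0) : M × (ℝ × ℝ)))) (funext fun i => by
        refine Fin.cases rfl (fun i => ?_) i
        exact Fin.cases rfl (fun i => rfl) i)) h2.symm)
    -- Strip the positive factors one after the other: the power of `F`, the volume of the positive
    -- basis `u`, and finally `2 (d + 1)`.
    have h4 := (pos_iff_pos_of_mul_pos h3).1 (pow_pos (hF0 _) _)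
    have h5 := (pos_iff_pos_of_mul_pos h4).2 hu
    exact (pos_iff_pos_of_mul_pos h5).1 (by positivity)
  obtain ⟨f, hf0, hfinv, hbook, hadapt⟩ :=
    exists_adapted_of_contactFields hE hα hvol hX hY hXξ hYξ hbr
  have hinv : ∀ c p v, f (ρ' c p) * α (ρ' c p) (mfderiv 𝓘(ℝ, E) 𝓘(ℝ, E) (ρ' c) p v) =
      f p * α p v := fun c => hfinv (ρ' c) (hρ c) (hXinv c) (hYinv c)
  refine ⟨_, ⟨hbook, _, hadapt⟩, ?_, _, hadapt, ?_, ?_⟩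
  · rintro _ ⟨c, rfl⟩ p
    have h1 := hinv c p (X p)
    have h2 := hinv c p (Y p)
    rw [hXinv] at h1
    rw [hYinv] at h2
    exact Prod.ext (congrArg Neg.neg h1) h2
  · rintro _ ⟨c, rfl⟩ p v
    exact hinv c p v
  · intro x u s
    -- The signs in `φ = (-fα(X), fα(Y))` are chosen so that `β + φ₁ dθ₁ - φ₂ dθ₂` is `f` times `α -
    -- α(X) dθ₁ - α(Y) dθ₂`.
    have h1 : f x.1 * α x.1 u + -(f x.1 * α x.1 (X x.1)) * s.1 - f x.1 * α x.1 (Y x.1) * s.2 =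
        f x.1 * (α x.1 u - s.1 * α x.1 (X x.1) - s.2 * α x.1 (Y x.1)) := by ring
    have h2 : (f x.1 • α x.1) u = f x.1 * α x.1 u := rfl
    rw [(hα'.2 (bundleCover ρ' x)).2.1, (hα'.2 (bundleCover ρ' x)).2.2, happ, h2, h1,
      mul_eq_zero_iff_left (hF0 x).ne', mul_eq_zero_iff_left (hf0 x.1).ne',
      mul_pos_iff_of_pos_left (hF0 x), mul_pos_iff_of_pos_left (hf0 x.1)]
    exact ⟨Iff.rfl, Iff.rfl⟩

end Main
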